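/- **Notation.** For a finitely supported filter $a:\mathbb{Z}^d\to\mathbb{C}$ put $\widehat a(\omega)=\sum_k a(k)e^{-ik\cdot\omega}$. Let $M_{\sqrt2}=\begin{pmatrix}1&1\\1&-1\end{pmatrix}$, $N_{\sqrt2}=\begin{pmatrix}1&-1\\1&1\end{pmatrix}$, and for a dilation matrix $M$ let $\Omega_M=[(M^{\top})^{-1}\mathbb{Z}^d]\cap[0,1)^d$. The filter $a$ has order $m$ sum rules with respect to $M$ if $\widehat a(0)=1$ and $\widehat a(\omega+2\pi\xi)=O(\|\omega\|^m)$ as $\omega\to0$ for all $\xi\in\Omega_M\setminus\{0\}$; $\mathrm{sr}(a,M)$ is the largest such $m$. A filter $b$ has order $n$ vanishing moments if $\widehat b(\omega)=O(\|\omega\|^n)$ as $\omega\to 0$. The smoothness exponent is $$\mathrm{sm}(a,M)=\tfrac d2-d\log_{|\det M|}\rho_m(a,M),\qquad \rho_m(a,M)=\sup_{|\mu|=m}\limsup_{j\to\infty}\|\nabla^\mu S_{a,M}^j\delta\|_{\ell_2}^{1/j},\qquad m=\mathrm{sr}(a,M),$$ where $[S_{a,M}v](k)=|\det M|\sum_{l}v(l)\,a(k-Ml)$,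 $\nabla_k u=u-u(\cdot-k)$ and $\nabla^\mu=\nabla_{e_1}^{\mu_1}\cdots\nabla_{e_d}^{\mu_d}$. A one-dimensional filter $a$ is an orthonormal $2$-wavelet filter if $|\widehat a(\omega)|^2+|\widehat a(\omega+\pi)|^2=1$ for all $\omega$. Filters $\{a;b_1,b_2,b_3\}$ on $\mathbb{Z}^2$ form a double canonical quincunx tight framelet filter bank if, for all $\omega\in\mathbb{R}^2$ (with $b_0:=a$), $\sum_{\ell=0}^3|\widehat{b_\ell}(\omega)|^2=1$, $\sum_{\ell=0}^3\overline{\widehat{b_\ell}(\omega)}\,\widehat{b_\ell}(\omega+(\pi,\pi))=0$, and $\widehat{b_{1}}(\omega)=e^{-i\omega_1}\overline{\widehat{b_0}(\omega+(\pi,\pi))}$, $\widehat{b_3}(\omega)=e^{-i\omega_1}\overline{\widehat{b_2}(\omega+(\pi,\pi))}$. $D_4$ is the group of the eight signed $2\times2$ permutation matrices and $D_4^+$ its subgroup of diagonal matrices. **The one-dimensional filters.** For $n\ge1$ and $m=2n-1$, let $\mathcal{H}_n$ be the set of filters $a:\mathbb{Z}\to\mathbb{C}$ supported in $[2-2m,2m-1]$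 such that $a(1-k)=a(k)$ for all $k$, $a$ is an orthonormal $2$-wavelet filter, and the real part of $a$ is the filter with $$\widehat{\mathrm{Re}\,a}(\omega)=e^{-i\omega/2}\cos^{2m-1}(\tfrac\omega2)\sum_{j=0}^{m-1}\frac{(m-\frac12)(m+\frac12)\cdots(m-\frac12+j-1)}{j!}\sin^{2j}(\tfrac\omega2).$$ **Statement.** 1. For every $n\ge1$ the set $\mathcal{H}_n$ is non-empty, and $\mathrm{sr}(a,2)=2n-1$ for every $a\in\mathcal{H}_n$. 2. Let $n\ge1$ and let $a$ be any finitely supported complex orthonormal $2$-wavelet filter with $a(1-k)=a(k)$ for all $k$ and $\mathrm{sr}(a,2)=2n-1$ (in particular any $a\in\mathcal{H}_n$). Define $$\widehat{a^{2D}}(\omega_1,\omega_2)=\widehat a(\omega_1)\widehat a(\omega_2),\qquad \widehat{b_2}(\omega_1,\omega_2)=\widehat a(\omega_1)\widehat a(\omega_2+\pi),$$ $$\widehat{b_1}(\omega)=e^{-i\omega_1}\overline{\widehat{a^{2D}}(\omega+(\pi,\pi))},\qquad \widehat{b_3}(\omega)=e^{-i\omega_1}\overline{\widehat{b_2}(\omega+(\pi,\pi))}.$$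 Then $\{a^{2D};b_1,b_2,b_3\}$ is a double canonical quincunx tight framelet filter bank. The filter $a^{2D}$ is $D_4$-symmetric about $c=(\frac12,\frac12)$, that is, $a^{2D}(E(k-c)+c)=a^{2D}(k)$ for all $k\in\mathbb{Z}^2$, $E\in D_4$. Moreover $$\mathrm{sr}(a^{2D},M_{\sqrt2})\ge2n,\qquad \mathrm{sm}(a^{2D},M_{\sqrt2})=\mathrm{sm}(a^{2D},N_{\sqrt2})\ge2\,\mathrm{sm}(a,2).$$ The high-pass filters have the following symmetry, with $\mathring c=(\frac12,-\frac12)$: $b_1(E(k-\mathring c)+\mathring c)=(E_{11}E_{22}+E_{12}E_{21})\,b_1(k)$ for $E\in D_4$; $b_2(E(k-c)+c)=E_{22}\,b_2(k)$ and $b_3(E(k-\mathring c)+\mathring c)=E_{11}\,b_3(k)$ for $E\in D_4^+$. Each of $b_1,b_2,b_3$ has at least order $n$ vanishing moments. 3. For every choice of $a_n\in\mathcal{H}_n$ $(n\ge1)$, $2\,\mathrm{sm}(a_n,2)\to\infty$ as $n\to\infty$; hence $\mathrm{sm}(a_n^{2D},M_{\sqrt2})=\mathrm{sm}(a_n^{2D},N_{\sqrt2})\to\infty$.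 -/

import Mathlib

open Filter Topology Asymptotics

noncomputable section

/-- `l₀(ℤ^d)`: finitely supported complex filters on `ℤ^d`. -/
abbrev Filt (d : ℕ) : Type := (Fin d → ℤ) →₀ ℂ

/-- The symbol `â(ω) = ∑ₖ a(k) e^{-i k·ω}`. -/
def symbol {d : ℕ} (a : Filt d) (ω : Fin d → ℝ) : ℂ :=
  a.sum fun k x => x * Complex.exp (-Complex.I * ((∑ i, (k i : ℝ) * ω i : ℝ) : ℂ))

/-- The dilation `2` in dimension one. -/
def dil2 : Matrix (Fin 1) (Fin 1) ℤ := !![2]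

/-- The quincunx dilation matrix `M_{√2}`. -/
def quincunxM : Matrix (Fin 2) (Fin 2) ℤ := !![1, 1; 1, -1]

/-- The quincunx dilation matrix `N_{√2}`. -/
def quincunxN : Matrix (Fin 2) (Fin 2) ℤ := !![1, -1; 1, 1]

/-- `Ω_M = [(Mᵀ)⁻¹ ℤ^d] ∩ [0,1)^d`, for an invertible integer matrix `M`. -/
def dualNodes {d : ℕ} (M : Matrix (Fin d) (Fin d) ℤ) : Set (Fin d → ℝ) :=
  {ξ | (∀ i, 0 ≤ ξ i ∧ ξ i < 1) ∧
    ∃ k : Fin d → ℤ, (M.map (Int.cast : ℤ → ℝ)).transpose.mulVec ξ = fun i => (k i : ℝ)}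

/-- The shifted frequency `ω + 2πξ`. -/
def freqShift {d : ℕ} (ω ξ : Fin d → ℝ) : Fin d → ℝ := fun i => ω i + 2 * Real.pi * ξ i

/-- `{a; b₁, …, b_L}` is a tight `M`-framelet filter bank. -/
def IsTightFrameletFilterBank {d L : ℕ} (M : Matrix (Fin d) (Fin d) ℤ)
    (a : Filt d) (b : Fin L → Filt d) : Prop :=
  (∀ ω, ‖symbol a ω‖ ^ 2 + ∑ l, ‖symbol (b l) ω‖ ^ 2 = 1) ∧
  ∀ ξ ∈ dualNodes M, ξ ≠ 0 → ∀ ω,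
    (starRingEnd ℂ) (symbol a ω) * symbol a (freqShift ω ξ) +
      ∑ l, (starRingEnd ℂ) (symbol (b l) ω) * symbol (b l) (freqShift ω ξ) = 0

/-- `a` is an orthonormal `M`-wavelet filter: `∑_{ξ ∈ Ω_M} |â(ω + 2πξ)|² = 1`. -/
def IsOrthonormalFilter {d : ℕ} (a : Filt d) (M : Matrix (Fin d) (Fin d) ℤ) : Prop :=
  ∀ ω, ∑ᶠ ξ ∈ dualNodes M, ‖symbol a (freqShift ω ξ)‖ ^ 2 = 1

/-- The canonical relation `b̂(ω) = e^{-i ω·(1,0)} conj (â(ω + (π,π)))`. -/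
def IsCanonicalPair (a b : Filt 2) : Prop :=
  ∀ ω : Fin 2 → ℝ, symbol b ω =
    Complex.exp (-Complex.I * (ω 0 : ℂ)) * (starRingEnd ℂ) (symbol a fun i => ω i + Real.pi)

/-- `{a; b₁, b₂, b₃}` is a double canonical quincunx tight framelet filter bank. -/
def IsDoubleCanonical (a b₁ b₂ b₃ : Filt 2) : Prop :=
  IsTightFrameletFilterBank quincunxM a ![b₁, b₂, b₃] ∧
    IsCanonicalPair a b₁ ∧ IsCanonicalPair b₂ b₃

/-- `a` has order `m` sum rules with respect to `M`. -/
def HasSumRules {d : ℕ} (a : Filt d) (M : Matrix (Fin d) (Fin d) ℤ) (m : ℕ) : Prop :=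
  symbol a 0 = 1 ∧ ∀ ξ ∈ dualNodes M, ξ ≠ 0 →
    (fun ω : Fin d → ℝ => symbol a (freqShift ω ξ)) =O[𝓝 0] fun ω => ‖ω‖ ^ m

/-- `sr(a, M)`: the largest order of sum rules. -/
def sumRuleOrder {d : ℕ} (a : Filt d) (M : Matrix (Fin d) (Fin d) ℤ) : ℕ :=
  sSup {m | HasSumRules a M m}

/-- `b` has order `n` vanishing moments. -/
def HasVanishingMoments {d : ℕ} (b : Filt d) (n : ℕ) : Prop :=
  symbol b =O[𝓝 0] fun ω => ‖ω‖ ^ n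

/-- The difference operator `∇ₖ u = u - u(· - k)`. -/
def nabla {d : ℕ} (k : Fin d → ℤ) (u : Filt d) : Filt d := u - u.mapDomain (· + k)

/-- `∇^μ = ∇_{e₁}^{μ₁} ⋯ ∇_{e_d}^{μ_d}`. -/
def nablaPow {d : ℕ} (μ : Fin d → ℕ) (u : Filt d) : Filt d :=
  (List.finRange d).foldr (fun j v => (nabla (Pi.single j 1))^[μ j] v) u

/-- The subdivision operator `[S_{a,M} v](n) = |det M| ∑ₖ v(k) a(n - M k)`. -/
def subdivision {d : ℕ} (a : Filt d) (M : Matrix (Fin d) (Fin d) ℤ) (v : Filt d) : Filt d :=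
  v.sum fun k x => (((|M.det| : ℤ) : ℂ) * x) • a.mapDomain (· + M.mulVec k)

/-- The `l₂(ℤ^d)` norm of a filter. -/
def l2norm {d : ℕ} (u : Filt d) : ℝ := Real.sqrt (u.sum fun _ x => ‖x‖ ^ 2)

/-- `ρ_m(a, M)₂`: the largest exponential growth rate of `‖∇^μ S_{a,M}ⁿ δ‖₂` over `|μ| = m`. -/
def rho {d : ℕ} (m : ℕ) (a : Filt d) (M : Matrix (Fin d) (Fin d) ℤ) : ℝ :=
  ⨆ μ : {μ : Fin d → ℕ // ∑ i, μ i = m},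
    limsup (fun n : ℕ =>
      l2norm (nablaPow μ.1 ((subdivision a M)^[n] (Finsupp.single 0 1))) ^ (1 / (n : ℝ))) atTop

/-- The smoothness exponent
`sm(a, M) = d/2 - d log_{|det M|} ρ_m(a, M)₂` with `m = sr(a, M)`. -/
def smoothness {d : ℕ} (a : Filt d) (M : Matrix (Fin d) (Fin d) ℤ) : ℝ :=
  (d : ℝ) / 2 - d * Real.logb ((|M.det| : ℤ) : ℝ) (rho (sumRuleOrder a M) a M)

/-- The dihedral group `D₄`. -/
def groupD4 : Set (Matrix (Fin 2) (Fin 2) ℤ) :=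
  {!![1, 0; 0, 1], -!![1, 0; 0, 1], !![1, 0; 0, -1], -!![1, 0; 0, -1],
    !![0, 1; 1, 0], -!![0, 1; 1, 0], !![0, 1; -1, 0], -!![0, 1; -1, 0]}

/-- The group `D₄⁺ = {± diag(1,1), ± diag(1,-1)}`. -/
def groupD4plus : Set (Matrix (Fin 2) (Fin 2) ℤ) :=
  {!![1, 0; 0, 1], -!![1, 0; 0, 1], !![1, 0; 0, -1], -!![1, 0; 0, -1]}

/-- `b(E(k - c) + c) = χ(E) b(k)` for all `E ∈ G` and `k`, the points `E(k - c) + c` being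
integer points. With `χ = 1` this is `G`-symmetry about `c`; signs allow antisymmetry. -/
def IsSymmetricAbout {d : ℕ} (G : Set (Matrix (Fin d) (Fin d) ℤ)) (c : Fin d → ℝ)
    (χ : Matrix (Fin d) (Fin d) ℤ → ℤ) (b : Filt d) : Prop :=
  ∀ E ∈ G, ∀ k : Fin d → ℤ, ∃ l : Fin d → ℤ,
    ((fun i => (l i : ℝ)) =
      (E.map (Int.cast : ℤ → ℝ)).mulVec ((fun i => (k i : ℝ)) - c) + c) ∧
    b l = (χ E : ℂ) * b k

/-- The tensor product `(u ⊗ v)(k₁, k₂) = u(k₁) v(k₂)`. -/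
def tensor (u v : Filt 1) : Filt 2 :=
  u.sum fun k x => v.sum fun l y => Finsupp.single ![k 0, l 0] (x * y)

/-- The filter `(-1)^k a(k)`, whose symbol is `â(ω + π)`. -/
def modulate (a : Filt 1) : Filt 1 :=
  a.sum fun k x => Finsupp.single k ((-1 : ℂ) ^ (k 0) * x)

/-- The filter `b(k₁, k₂) = (-1)^{1+k₁+k₂} conj (a(1 - k₁, -k₂))`, whose symbol is
`e^{-iω₁} conj (â(ω + (π, π)))`. -/
def canonicalFilter (a : Filt 2) : Filt 2 :=
  a.sum fun k x => Finsupp.single ![1 - k 0, -k 1] ((-1 : ℂ) ^ (k 0 + k 1) * (starRingEnd ℂ) x)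

/-- `a2D` with symbol `â(ω₁) â(ω₂)`. -/
def lowpass2D (a : Filt 1) : Filt 2 := tensor a a

/-- `b₂` with symbol `â(ω₁) â(ω₂ + π)`. -/
def highpass2 (a : Filt 1) : Filt 2 := tensor a (modulate a)

/-- `b₁` with symbol `e^{-iω₁} conj (â(ω₁ + π) â(ω₂ + π))`. -/
def highpass1 (a : Filt 1) : Filt 2 := canonicalFilter (lowpass2D a)

/-- `b₃` with symbol `e^{-iω₁} conj (b̂₂(ω + (π, π)))`. -/
def highpass3 (a : Filt 1) : Filt 2 := canonicalFilter (highpass2 a)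

/-- A one-dimensional filter symmetric about `1/2`. -/
def IsSymmetricHalf (a : Filt 1) : Prop := ∀ k : ℤ, a ![1 - k] = a ![k]

/-- Symmetric complex orthonormal `2`-wavelet filters with linear-phase moments. The real part is
the symmetric filter with symbol
`e^{-iω/2} cos^{2m-1}(ω/2) ∑_{j<m} ((m-1/2)_j / j!) sin^{2j}(ω/2)`, the truncation being that of
the Taylor series of `(1 - x)^{-(m-1/2)}`, and the imaginary part is any real symmetric
completion, supported in `[2-2m, 2m-1]`, to an orthonormal filter. -/
structure IsHanFilter (m : ℕ) (a : Filt 1) : Prop where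
  support : ∀ k : ℤ, a ![k] ≠ 0 → 2 - 2 * (m : ℤ) ≤ k ∧ k ≤ 2 * (m : ℤ) - 1
  symm : IsSymmetricHalf a
  orthonormal : IsOrthonormalFilter a dil2
  realPart : ∀ ω : ℝ,
    symbol (a.mapRange (fun z => (z.re : ℂ)) (by simp)) ![ω] =
      Complex.exp (-Complex.I * (ω / 2 : ℝ)) *
        ((Real.cos (ω / 2) ^ (2 * m - 1) *
          ∑ j ∈ Finset.range m,
            (∏ i ∈ Finset.range j, ((m : ℝ) - 1 / 2 + i) / (i + 1)) *
              Real.sin (ω / 2) ^ (2 * j) : ℝ) : ℂ)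

theorem symbol_single {d : ℕ} (k : Fin d → ℤ) (x : ℂ) (ω : Fin d → ℝ) :
    symbol (Finsupp.single k x) ω =
      x * Complex.exp (-Complex.I * ((∑ i, (k i : ℝ) * ω i : ℝ) : ℂ)) := by
  simp [symbol]

theorem symbol_finsuppSum {d e : ℕ} (a : Filt e) (f : (Fin e → ℤ) → ℂ → Filt d)
    (ω : Fin d → ℝ) :
    symbol (a.sum f) ω = a.sum fun k x => symbol (f k x) ω := by
  simp only [symbol]
  rw [Finsupp.sum_sum_index]
  · intro k; simp
  · intro k x y; ring

theorem symbol_tensor (u v : Filt 1) (ω : Fin 2 → ℝ) :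
    symbol (tensor u v) ω = symbol u ![ω 0] * symbol v ![ω 1] := by
  simp only [tensor, symbol_finsuppSum, symbol_single]
  simp only [symbol, Finsupp.sum, Finset.sum_mul_sum]
  refine Finset.sum_congr rfl fun k _ => Finset.sum_congr rfl fun l _ => ?_
  rw [mul_mul_mul_comm, ← Complex.exp_add]
  congr 2
  simp [Fin.sum_univ_two]
  ring

theorem symbol_modulate (a : Filt 1) (ω : Fin 1 → ℝ) :
    symbol (modulate a) ω = symbol a fun i => ω i + Real.pi := by
  simp only [modulate, symbol_finsuppSum, symbol_single]
  simp only [symbol, Finsupp.sum]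
  refine Finset.sum_congr rfl fun k _ => ?_
  have h : (-1 : ℂ) ^ (k 0) = Complex.exp (-Complex.I * ((k 0 : ℝ) * Real.pi : ℝ)) := by
    have h1 : Complex.exp (-(Real.pi * Complex.I)) = -1 := by
      rw [Complex.exp_neg, Complex.exp_pi_mul_I]; norm_num
    rw [← h1, ← Complex.exp_int_mul]
    congr 1
    push_cast
    ring
  rw [h, mul_comm (Complex.exp _) (a k), mul_assoc, ← Complex.exp_add]
  congr 2
  simp
  ring

theorem symbol_highpass2 (a : Filt 1) (ω : Fin 2 → ℝ) :
    symbol (highpass2 a) ω = symbol a ![ω 0] * symbol a ![ω 1 + Real.pi] := by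
  rw [highpass2, symbol_tensor, symbol_modulate]
  congr 2
  ext i
  simp

theorem isCanonicalPair_canonicalFilter (a : Filt 2) : IsCanonicalPair a (canonicalFilter a) := by
  intro ω
  simp only [canonicalFilter, symbol_finsuppSum, symbol_single]
  simp only [symbol, Finsupp.sum, map_sum, Finset.mul_sum]
  refine Finset.sum_congr rfl fun k _ => ?_
  have h : (-1 : ℂ) ^ (k 0 + k 1) = Complex.exp (Complex.I * (((k 0 : ℝ) + k 1) * Real.pi : ℝ)) := by
    rw [← Complex.exp_pi_mul_I, ← Complex.exp_int_mul]
    congr 1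
    push_cast
    ring
  rw [h, map_mul, ← Complex.exp_conj, mul_left_comm, ← Complex.exp_add, mul_right_comm, mul_comm,
    ← Complex.exp_add]
  congr 2
  simp [Fin.sum_univ_two]
  ring

end

/-!
The sum rules, symmetries and filter bank identities of the two-dimensional filters reduce to the
one-dimensional filter `a`, because all symbols involved are products of values of `â`. The
substance lies in the smoothness exponents and in the existence of the filters.

*Existence.* Up to the phase `e^{-iω/2}`, the symbol of a symmetric filter is `R + i S` with the
even real functions `R`, `S` belonging to the real and the imaginary part, so that
`|â|² = R² + S²`. The prescribed real part gives `R² = B(sin² (ω/2))` with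
`B(x) = (1 - x)^{2p+1} P(x)²`, `p = m - 1`, where `P` is a Taylor polynomial of
`(1 - x)^{-(p+1/2)}`. Since `P` solves the differential equation of the full series up to one
monomial, `B' = -c x^p (1 - x)^{2p} P` (`hasDerivAt_maxFlat`). Hence `B(x) + B(1 - x) ≤ 1`
(`maxFlat_add_flip_le`), and the deficit `1 - B(x) - B(1 - x)` is a nonnegative polynomial in
`cos (2ω)`, which by the Fejér–Riesz theorem (`exists_fejerRiesz`) is `4 |s(e^{2iω})|²` for a real
polynomial `s`. The real part of twice `e^{-i(2p+1/2)ω} s(e^{2iω})` is the required `S`: the shift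
by `π` turns its cosines into sines (`exists_imaginary_part`).

*Sum rules.* Orthonormality gives `|â(ω + π)|² ≤ 1 - B(sin² (ω/2))`, hence at least `m` sum rules.
With more of them, `S²` would vanish at the origin to the exact order `2m`; but `S` is even and
analytic, and `m` is odd (`IsHanFilter.le_of_hasSumRules`).

*The quincunx smoothness.* By Parseval's identity `ρ` only depends on the absolute values of the
symbols of the iterated subdivision scheme. These are the same for the two quincunx dilations,
which differ by an element of `D₄` (`cascadeAbs_quincunx_eq`). As the square of the quincunx matrix
is twice the identity, two quincunx steps multiply the symbol by values of `â` at the four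
frequencies `ω₁, ω₂, ω₁ + ω₂, ω₁ - ω₂`. Discarding two of them, which is possible because
`|â| ≤ 1`, leaves a tensor product of dyadic schemes in the frequencies `(ω₁, ω₂)`,
`(ω₁, ω₁ + ω₂)` or `(ω₂, ω₁ + ω₂)`. By the addition theorem `|sin (ω₁/2)|` is at most
`|sin (ω₂/2)| + |sin ((ω₁ + ω₂)/2)|`, so that a difference operator of order `2m`, whatever its
direction, is dominated by products of two differences of order `m` in one of these pairs of
frequencies. This gives `ρ_{m'}(a^{2D}) ≤ ρ_m(a)` for all `m' ≥ 2m` (`rho_quincunxM`). To take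
logarithms, `ρ > 0` is needed; it holds because the coefficients of the iterates keep their sum
while their supports grow at most exponentially (`rho_pos`).

*Growth of the smoothness.* The flatness of `B` at the origin bounds `|â(ω)|²` near `π` by a power
of `cos² (ω/2)` with an explicit constant. For the product over two consecutive frequencies `ω`
and `2ω` this yields a bound by a power of `12 cos² (ω/2) cos² ω`, one of the two factors having
the better base `3` in place of `4`. Together with the factor `sin² (ω/2)` of the difference
operator, which telescopes through
`sin (2ω) = 4 sin (ω/2) cos (ω/2) cos ω`, each pair of steps gains `3/4` to the power `m`, up to a
polynomial in `m`, and `ρ → 0` (`IsHanFilter.rho_le`).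
-/

noncomputable section

open MeasureTheory

/-! ### Symbol calculus -/

theorem symbol_zero_filter {d : ℕ} (ω : Fin d → ℝ) : symbol (0 : Filt d) ω = 0 := by
  simp [symbol]

theorem symbol_add {d : ℕ} (u v : Filt d) (ω : Fin d → ℝ) :
    symbol (u + v) ω = symbol u ω + symbol v ω := by
  simp only [symbol]
  rw [Finsupp.sum_add_index'] <;> intros <;> ring

theorem symbol_smul {d : ℕ} (c : ℂ) (u : Filt d) (ω : Fin d → ℝ) :
    symbol (c • u) ω = c * symbol u ω := by
  simp only [symbol]
  rw [Finsupp.sum_smul_index (by simp), Finsupp.mul_sum]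
  exact Finsupp.sum_congr fun k _ => by ring

theorem symbol_neg {d : ℕ} (u : Filt d) (ω : Fin d → ℝ) : symbol (-u) ω = -symbol u ω := by
  rw [← neg_one_smul ℂ u, symbol_smul]; ring

theorem symbol_sub {d : ℕ} (u v : Filt d) (ω : Fin d → ℝ) :
    symbol (u - v) ω = symbol u ω - symbol v ω := by
  rw [sub_eq_add_neg, symbol_add, symbol_neg]; ring

theorem symbol_finsetSum {d : ℕ} {ι : Type*} (s : Finset ι) (u : ι → Filt d) (ω : Fin d → ℝ) :
    symbol (∑ i ∈ s, u i) ω = ∑ i ∈ s, symbol (u i) ω := by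
  classical
  induction s using Finset.induction_on with
  | empty => simp [symbol_zero_filter]
  | insert i s hi ih => rw [Finset.sum_insert hi, Finset.sum_insert hi, symbol_add, ih]

theorem symbol_translate {d : ℕ} (u : Filt d) (k : Fin d → ℤ) (ω : Fin d → ℝ) :
    symbol (u.mapDomain (· + k)) ω =
      Complex.exp (-Complex.I * ((∑ i, (k i : ℝ) * ω i : ℝ) : ℂ)) * symbol u ω := by
  simp only [symbol]
  rw [Finsupp.sum_mapDomain_index (by simp) (by intros; ring), Finsupp.mul_sum]
  refine Finsupp.sum_congr fun l _ => ?_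
  rw [mul_left_comm, ← Complex.exp_add]
  congr 2
  simp only [Pi.add_apply, Int.cast_add, add_mul, Finset.sum_add_distrib, Complex.ofReal_add]
  ring

theorem symbol_nabla {d : ℕ} (k : Fin d → ℤ) (u : Filt d) (ω : Fin d → ℝ) :
    symbol (nabla k u) ω =
      (1 - Complex.exp (-Complex.I * ((∑ i, (k i : ℝ) * ω i : ℝ) : ℂ))) * symbol u ω := by
  rw [nabla, symbol_sub, symbol_translate]; ring

theorem norm_one_sub_exp_neg (t : ℝ) :
    ‖1 - Complex.exp (-Complex.I * (t : ℂ))‖ = 2 * |Real.sin (t / 2)| := by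
  have h := Complex.norm_exp_I_mul_ofReal_sub_one (-t)
  rw [norm_sub_rev] at h
  rw [neg_mul, ← mul_neg, ← Complex.ofReal_neg, h, neg_div, Real.sin_neg, norm_mul]
  simp

theorem norm_symbol_nabla_iterate {d : ℕ} (i : Fin d) (n : ℕ) (u : Filt d) (ω : Fin d → ℝ) :
    ‖symbol ((nabla (Pi.single i 1))^[n] u) ω‖ =
      (2 * |Real.sin (ω i / 2)|) ^ n * ‖symbol u ω‖ := by
  induction n with
  | zero => simp
  | succ n ih =>
    rw [Function.iterate_succ_apply', symbol_nabla, norm_mul, ih, norm_one_sub_exp_neg]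
    have : ∑ j, (((Pi.single i 1 : Fin d → ℤ) j : ℤ) : ℝ) * ω j = ω i := by
      rw [Finset.sum_eq_single i] <;> simp +contextual
    rw [this]; ring

theorem norm_symbol_nablaPow {d : ℕ} (μ : Fin d → ℕ) (u : Filt d) (ω : Fin d → ℝ) :
    ‖symbol (nablaPow μ u) ω‖ = (∏ i, (2 * |Real.sin (ω i / 2)|) ^ μ i) * ‖symbol u ω‖ := by
  have key : ∀ l : List (Fin d),
      ‖symbol (l.foldr (fun j v => (nabla (Pi.single j 1))^[μ j] v) u) ω‖ =
        (l.map fun i => (2 * |Real.sin (ω i / 2)|) ^ μ i).prod * ‖symbol u ω‖ := by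
    intro l
    induction l with
    | nil => simp
    | cons j l ih =>
      rw [List.foldr_cons, norm_symbol_nabla_iterate, ih, List.map_cons, List.prod_cons, mul_assoc]
  rw [nablaPow, key, ← List.prod_ofFn, List.ofFn_eq_map]

/-- The action `ω ↦ Mᵀ ω` of a dilation matrix on frequencies. -/
def freqMap {d : ℕ} (M : Matrix (Fin d) (Fin d) ℤ) (ω : Fin d → ℝ) : Fin d → ℝ :=
  fun j => ∑ i, (M i j : ℝ) * ω i

theorem symbol_subdivision {d : ℕ} (a : Filt d) (M : Matrix (Fin d) (Fin d) ℤ) (v : Filt d)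
    (ω : Fin d → ℝ) :
    symbol (subdivision a M v) ω =
      ((|M.det| : ℤ) : ℂ) * symbol v (freqMap M ω) * symbol a ω := by
  simp only [subdivision, symbol_finsuppSum, symbol_smul, symbol_translate]
  rw [symbol.eq_def v, Finsupp.mul_sum, Finsupp.sum_mul]
  refine Finsupp.sum_congr fun k _ => ?_
  have : ∑ i, ((M.mulVec k i : ℤ) : ℝ) * ω i = ∑ j, (k j : ℝ) * freqMap M ω j := by
    simp only [Matrix.mulVec, dotProduct, freqMap, Int.cast_sum, Int.cast_mul, Finset.sum_mul,
      Finset.mul_sum]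
    rw [Finset.sum_comm]
    exact Finset.sum_congr rfl fun _ _ => Finset.sum_congr rfl fun _ _ => by ring
  rw [this]
  ring

/-- `|Ŝʲδ|` at the frequency `ω`. -/
def cascadeAbs {d : ℕ} (a : Filt d) (M : Matrix (Fin d) (Fin d) ℤ) (j : ℕ) (ω : Fin d → ℝ) : ℝ :=
  ‖symbol ((subdivision a M)^[j] (Finsupp.single 0 1)) ω‖

theorem cascadeAbs_zero {d : ℕ} (a : Filt d) (M : Matrix (Fin d) (Fin d) ℤ) (ω : Fin d → ℝ) :
    cascadeAbs a M 0 ω = 1 := by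
  simp [cascadeAbs, symbol_single]

theorem cascadeAbs_succ {d : ℕ} (a : Filt d) (M : Matrix (Fin d) (Fin d) ℤ) (j : ℕ)
    (ω : Fin d → ℝ) :
    cascadeAbs a M (j + 1) ω = |(M.det : ℝ)| * cascadeAbs a M j (freqMap M ω) * ‖symbol a ω‖ := by
  simp only [cascadeAbs]
  rw [Function.iterate_succ_apply', symbol_subdivision, norm_mul, norm_mul]
  congr 2
  simp

theorem cascadeAbs_nonneg {d : ℕ} (a : Filt d) (M : Matrix (Fin d) (Fin d) ℤ) (j : ℕ)
    (ω : Fin d → ℝ) : 0 ≤ cascadeAbs a M j ω := norm_nonneg _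

/-! ### Parseval's identity on the torus -/

instance fact_two_pi_pos : Fact (0 < 2 * Real.pi) := ⟨Real.two_pi_pos⟩

/-- The circle `ℝ / 2πℤ`. -/
abbrev Circ : Type := AddCircle (2 * Real.pi)

/-- The normalised Haar measure of the circle. -/
abbrev circMeasure : Measure Circ := AddCircle.haarAddCircle

/-- The normalised Haar measure of the torus `(ℝ / 2πℤ)^d`. -/
abbrev torusMeasure (d : ℕ) : Measure (Fin d → Circ) := Measure.pi fun _ => circMeasure

/-- The symbol of a filter as a function on the torus. -/
def torusSymbol {d : ℕ} (u : Filt d) (x : Fin d → Circ) : ℂ :=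
  u.sum fun k c => c * ∏ i, fourier (-(k i)) (x i)

theorem torusSymbol_coe {d : ℕ} (u : Filt d) (ω : Fin d → ℝ) :
    torusSymbol u (fun i => (ω i : Circ)) = symbol u ω := by
  simp only [torusSymbol, symbol]
  refine Finsupp.sum_congr fun k _ => ?_
  congr 1
  simp only [fourier_coe_apply]
  rw [← Complex.exp_sum]
  congr 1
  push_cast
  rw [Finset.mul_sum]
  refine Finset.sum_congr rfl fun i _ => ?_
  have : (Real.pi : ℂ) ≠ 0 := by exact_mod_cast Real.pi_ne_zero
  field_simp

theorem exists_torus_rep {d : ℕ} (x : Fin d → Circ) :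
    ∃ ω : Fin d → ℝ, (fun i => (ω i : Circ)) = x := by
  choose ω h using fun i => QuotientAddGroup.mk_surjective (x i)
  exact ⟨ω, funext h⟩

theorem continuous_torusSymbol {d : ℕ} (u : Filt d) : Continuous (torusSymbol u) := by
  unfold torusSymbol Finsupp.sum
  fun_prop

theorem integral_fourier_circ (n : ℤ) :
    ∫ x, fourier n x ∂circMeasure = if n = 0 then (1 : ℂ) else 0 := by
  have h := congrFun (fourierCoeff_fourier (T := 2 * Real.pi) n) 0
  rw [fourierCoeff] at h
  simp only [neg_zero, fourier_zero, one_smul] at h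
  rw [h, Pi.single_apply]
  simp [eq_comm]

theorem integral_torus_character {d : ℕ} (n : Fin d → ℤ) :
    ∫ x, ∏ i, fourier (n i) (x i) ∂torusMeasure d = if n = 0 then (1 : ℂ) else 0 := by
  rw [integral_fintype_prod_eq_prod (fun i (y : Circ) => (fourier (n i) y : ℂ))]
  simp only [integral_fourier_circ]
  split_ifs with h
  · simp [h]
  · obtain ⟨i, hi⟩ := Function.ne_iff.mp h
    exact Finset.prod_eq_zero (Finset.mem_univ i) (if_neg hi)

theorem integrable_torus {d : ℕ} {E : Type*} [NormedAddCommGroup E] {f : (Fin d → Circ) → E}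
    (hf : Continuous f) : Integrable f (torusMeasure d) :=
  hf.integrable_of_hasCompactSupport (HasCompactSupport.of_compactSpace f)

theorem l2norm_nonneg {d : ℕ} (u : Filt d) : 0 ≤ l2norm u := Real.sqrt_nonneg _

theorem l2norm_sq {d : ℕ} (u : Filt d) : l2norm u ^ 2 = u.sum fun _ x => ‖x‖ ^ 2 :=
  Real.sq_sqrt (Finsupp.sum_nonneg' fun _ => by positivity)

theorem l2norm_sq_eq_integral {d : ℕ} (u : Filt d) :
    l2norm u ^ 2 = ∫ x, ‖torusSymbol u x‖ ^ 2 ∂torusMeasure d := by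
  have h1 : ∀ x, ((‖torusSymbol u x‖ ^ 2 : ℝ) : ℂ) = ∑ k ∈ u.support, ∑ l ∈ u.support,
      (u k * (starRingEnd ℂ) (u l)) * ∏ i, fourier ((l - k) i) (x i) := by
    intro x
    rw [← Complex.normSq_eq_norm_sq, ← Complex.mul_conj]
    simp only [torusSymbol, Finsupp.sum, map_sum, Finset.sum_mul_sum]
    refine Finset.sum_congr rfl fun k _ => Finset.sum_congr rfl fun l _ => ?_
    rw [map_mul, map_prod, mul_mul_mul_comm, ← Finset.prod_mul_distrib]
    congr 1
    refine Finset.prod_congr rfl fun i _ => ?_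
    rw [← fourier_neg, neg_neg, ← fourier_add, Pi.sub_apply]
    congr 2
    ring
  apply Complex.ofReal_injective
  rw [← integral_complex_ofReal]
  simp only [h1]
  rw [integral_finsetSum _ fun k _ => integrable_torus (by fun_prop), l2norm_sq]
  simp only [Finsupp.sum, Complex.ofReal_sum]
  refine Finset.sum_congr rfl fun k hk => ?_
  rw [integral_finsetSum _ fun k _ => integrable_torus (by fun_prop)]
  simp only [integral_const_mul, integral_torus_character, sub_eq_zero]
  simp only [mul_ite, mul_one, mul_zero, Finset.sum_ite_eq', hk, if_true]
  rw [Complex.mul_conj, Complex.normSq_eq_norm_sq]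

/-- A pointwise bound for the symbol bounds the `l₂` norm. -/
theorem l2norm_sq_le_of_symbol_le {d : ℕ} (u : Filt d) {B : ℝ}
    (h : ∀ ω, ‖symbol u ω‖ ^ 2 ≤ B) : l2norm u ^ 2 ≤ B := by
  rw [l2norm_sq_eq_integral]
  calc _ ≤ ∫ _, B ∂torusMeasure d := by
        refine integral_mono (integrable_torus ?_) (integrable_const _) fun x => ?_
        · exact (continuous_torusSymbol u).norm.pow 2
        · obtain ⟨ω, rfl⟩ := exists_torus_rep x
          simpa only [torusSymbol_coe] using h ω
    _ = B := by simp

/-- The `l₂` norm only depends on the absolute value of the symbol. -/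
theorem l2norm_congr {d : ℕ} {u v : Filt d} (h : ∀ ω, ‖symbol u ω‖ = ‖symbol v ω‖) :
    l2norm u = l2norm v := by
  refine (sq_eq_sq₀ (l2norm_nonneg u) (l2norm_nonneg v)).mp ?_
  rw [l2norm_sq_eq_integral, l2norm_sq_eq_integral]
  congr 1
  funext x
  obtain ⟨ω, rfl⟩ := exists_torus_rep x
  rw [torusSymbol_coe, torusSymbol_coe, h]

/-- A bound of `|v̂|²` by products of `|û|²` over pairs of the frequencies `ω₁, ω₂, ω₁ + ω₂` bounds
`‖v‖` by `‖u‖²`: by translation invariance of the Haar measure, any two of these frequencies are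
independent and equidistributed. -/
theorem l2norm_sq_le_of_symbol_le_pairs (u : Filt 1) (v : Filt 2) {K : ℝ}
    (h : ∀ s t : ℝ, ‖symbol v ![s, t]‖ ^ 2 ≤
      K * (‖symbol u ![s]‖ ^ 2 * ‖symbol u ![t]‖ ^ 2 +
        ‖symbol u ![s]‖ ^ 2 * ‖symbol u ![s + t]‖ ^ 2 +
        ‖symbol u ![t]‖ ^ 2 * ‖symbol u ![s + t]‖ ^ 2)) :
    l2norm v ^ 2 ≤ 3 * K * (l2norm u ^ 2) ^ 2 := by
  set g : Circ → ℝ := fun y => ‖torusSymbol u fun _ => y‖ ^ 2 with hg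
  have gc : Continuous g :=
    ((continuous_torusSymbol u).comp (continuous_pi fun _ => continuous_id)).norm.pow 2
  have hcoe : ∀ s : ℝ, g (s : Circ) = ‖symbol u ![s]‖ ^ 2 := by
    intro s
    rw [hg, ← torusSymbol_coe]
    congr 3
  have hI : ∫ y, g y ∂circMeasure = l2norm u ^ 2 := by
    rw [l2norm_sq_eq_integral,
      ← (measurePreserving_funUnique circMeasure (Fin 1)).integral_comp']
    congr 1
  have hcomp : ∀ f : Circ × Circ → ℝ, Continuous f → Integrable f (circMeasure.prod circMeasure) :=
    fun f hf => hf.integrable_of_hasCompactSupport (HasCompactSupport.of_compactSpace f)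
  have h1 : ∫ z : Circ × Circ, g z.1 * g z.2 ∂(circMeasure.prod circMeasure) =
      (l2norm u ^ 2) ^ 2 := by
    rw [integral_prod_mul g g, hI]; ring
  have h2 : ∫ z : Circ × Circ, g z.1 * g (z.1 + z.2) ∂(circMeasure.prod circMeasure) =
      (l2norm u ^ 2) ^ 2 := by
    rw [integral_prod _ (hcomp _ (by fun_prop))]
    simp only [integral_const_mul]
    have : ∀ x : Circ, ∫ y, g (x + y) ∂circMeasure = l2norm u ^ 2 := fun x => by
      rw [integral_add_left_eq_self g x, hI]
    simp only [this, integral_mul_const, hI]; ring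
  have h3 : ∫ z : Circ × Circ, g z.2 * g (z.1 + z.2) ∂(circMeasure.prod circMeasure) =
      (l2norm u ^ 2) ^ 2 := by
    rw [integral_prod_symm _ (hcomp _ (by fun_prop))]
    simp only [integral_const_mul]
    have : ∀ y : Circ, ∫ x, g (x + y) ∂circMeasure = l2norm u ^ 2 := fun x => by
      rw [integral_add_right_eq_self g x, hI]
    simp only [this, integral_mul_const, hI]; ring
  have hv : l2norm v ^ 2 = ∫ z : Circ × Circ, ‖torusSymbol v ![z.1, z.2]‖ ^ 2
      ∂(circMeasure.prod circMeasure) := by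
    rw [l2norm_sq_eq_integral,
      ← (measurePreserving_finTwoArrow circMeasure).integral_comp']
    congr 1
  have hvc : Continuous fun z : Circ × Circ => ‖torusSymbol v ![z.1, z.2]‖ ^ 2 := by
    refine ((continuous_torusSymbol v).comp (continuous_pi fun i => ?_)).norm.pow 2
    fin_cases i
    · exact continuous_fst
    · exact continuous_snd
  rw [hv]
  calc _ ≤ ∫ z : Circ × Circ, K * (g z.1 * g z.2 + g z.1 * g (z.1 + z.2) + g z.2 * g (z.1 + z.2))
        ∂(circMeasure.prod circMeasure) := by
        refine integral_mono (hcomp _ hvc) (hcomp _ (by fun_prop)) fun z => ?_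
        obtain ⟨s, hs⟩ := QuotientAddGroup.mk_surjective z.1
        obtain ⟨t, ht⟩ := QuotientAddGroup.mk_surjective z.2
        have hst := h s t
        rw [← torusSymbol_coe v, ← hcoe, ← hcoe, ← hcoe] at hst
        have e : (fun i => ((![s, t] i : ℝ) : Circ)) = ![z.1, z.2] := by
          funext i
          fin_cases i
          · exact hs
          · exact ht
        have e3 : (((s + t : ℝ)) : Circ) = z.1 + z.2 := by
          rw [← hs, ← ht]; rfl
        have e1 : (s : Circ) = z.1 := hs
        have e2 : (t : Circ) = z.2 := ht
        rw [e, e1, e2, e3] at hst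
        exact hst
    _ = _ := by
        rw [integral_const_mul, integral_add (hcomp _ (by fun_prop)) (hcomp _ (by fun_prop)),
          integral_add (hcomp _ (by fun_prop)) (hcomp _ (by fun_prop)), h1, h2, h3]
        ring

end

noncomputable section

/-! ### Growth rates and the quantity `ρ` -/

theorem tendsto_const_rpow_inv_nat {K : ℝ} (hK : 0 < K) :
    Tendsto (fun j : ℕ => K ^ (1 / (j : ℝ))) atTop (𝓝 1) := by
  have h : Tendsto (fun j : ℕ => 1 / (j : ℝ)) atTop (𝓝 0) := tendsto_one_div_atTop_nhds_zero_nat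
  simpa [Function.comp_def] using (Real.continuousAt_const_rpow hK.ne' (b := 0)).tendsto.comp h

theorem const_mul_pow_rpow_inv {K r : ℝ} (hK : 0 ≤ K) (hr : 0 ≤ r) {j : ℕ} (hj : j ≠ 0) :
    (K * r ^ j) ^ (1 / (j : ℝ)) = K ^ (1 / (j : ℝ)) * r := by
  rw [Real.mul_rpow hK (by positivity), one_div, Real.pow_rpow_inv_natCast hr hj]

/-- A geometric bound of a sequence bounds its root growth rate. The boundedness of the roots is
recorded because the `limsup` of an unbounded real sequence has a junk value. -/
theorem limsup_root_le {x : ℕ → ℝ} (hx : ∀ j, 0 ≤ x j) {K r : ℝ} (hr : 0 ≤ r)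
    (h : ∀ᶠ j in atTop, x j ≤ K * r ^ j) :
    IsBoundedUnder (· ≤ ·) atTop (fun j : ℕ => x j ^ (1 / (j : ℝ))) ∧
      limsup (fun j : ℕ => x j ^ (1 / (j : ℝ))) atTop ≤ r := by
  have hK : 0 < max K 1 := by positivity
  have ht : Tendsto (fun j : ℕ => (max K 1) ^ (1 / (j : ℝ)) * r) atTop (𝓝 r) := by
    simpa using (tendsto_const_rpow_inv_nat hK).mul_const r
  have hle : ∀ᶠ j : ℕ in atTop, x j ^ (1 / (j : ℝ)) ≤ (max K 1) ^ (1 / (j : ℝ)) * r := by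
    filter_upwards [h, eventually_ne_atTop 0] with j h1 h2
    rw [← const_mul_pow_rpow_inv hK.le hr h2]
    refine Real.rpow_le_rpow (hx j) (h1.trans ?_) (by positivity)
    gcongr
    exact le_max_left _ _
  refine ⟨ht.isBoundedUnder_le.mono_le hle, ?_⟩
  rw [← ht.limsup_eq]
  refine limsup_le_limsup hle ?_ ht.isBoundedUnder_le
  exact isCoboundedUnder_le_of_le atTop (x := 0) fun j => Real.rpow_nonneg (hx j) _

theorem le_limsup_root {x : ℕ → ℝ} {c q : ℝ} (hc : 0 < c) (hq : 0 ≤ q)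
    (h : ∀ j, c * q ^ j ≤ x j)
    (hb : IsBoundedUnder (· ≤ ·) atTop (fun j : ℕ => x j ^ (1 / (j : ℝ)))) :
    q ≤ limsup (fun j : ℕ => x j ^ (1 / (j : ℝ))) atTop := by
  have ht : Tendsto (fun j : ℕ => c ^ (1 / (j : ℝ)) * q) atTop (𝓝 q) := by
    simpa using (tendsto_const_rpow_inv_nat hc).mul_const q
  rw [← ht.limsup_eq]
  refine limsup_le_limsup ?_ ht.isCoboundedUnder_le hb
  filter_upwards [eventually_ne_atTop 0] with j h2
  rw [← const_mul_pow_rpow_inv hc.le hq h2]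
  exact Real.rpow_le_rpow (by positivity) (h j) (by positivity)

theorem rho_le {d : ℕ} [NeZero d] {m : ℕ} {a : Filt d} {M : Matrix (Fin d) (Fin d) ℤ} {r : ℝ}
    (hr : 0 ≤ r) (h : ∀ μ : Fin d → ℕ, ∑ i, μ i = m → ∃ K, ∀ᶠ j in atTop,
      l2norm (nablaPow μ ((subdivision a M)^[j] (Finsupp.single 0 1))) ≤ K * r ^ j) :
    rho m a M ≤ r := by
  have : Nonempty {μ : Fin d → ℕ // ∑ i, μ i = m} := ⟨⟨Pi.single 0 m, by simp⟩⟩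
  refine ciSup_le fun μ => ?_
  obtain ⟨K, hK⟩ := h μ.1 μ.2
  exact (limsup_root_le (fun _ => l2norm_nonneg _) hr hK).2

/-! ### A lower bound for the differences of the subdivision scheme -/

/-- The support of `u` is contained in the cube `[-K, K]^d`. -/
def SupportedIn {d : ℕ} (u : Filt d) (K : ℕ) : Prop := ∀ k, u k ≠ 0 → ∀ i, |k i| ≤ (K : ℤ)

theorem exists_supportedIn {d : ℕ} (u : Filt d) : ∃ K, SupportedIn u K := by
  refine ⟨u.support.sup fun k => Finset.univ.sup fun i => (k i).natAbs, fun k hk i => ?_⟩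
  have h1 : (k i).natAbs ≤ Finset.univ.sup fun i => (k i).natAbs :=
    Finset.le_sup (f := fun i => (k i).natAbs) (Finset.mem_univ i)
  have h2 : (Finset.univ.sup fun i => (k i).natAbs) ≤
      u.support.sup fun k => Finset.univ.sup fun i => (k i).natAbs :=
    Finset.le_sup (f := fun k : Fin d → ℤ => Finset.univ.sup fun i => (k i).natAbs)
      (Finsupp.mem_support_iff.mpr hk)
  rw [Int.abs_eq_natAbs]
  exact_mod_cast h1.trans h2

theorem mapDomain_add_apply {d : ℕ} (u : Filt d) (k l : Fin d → ℤ) :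
    u.mapDomain (· + k) l = u (l - k) := by
  have := Finsupp.mapDomain_apply (f := (· + k)) (add_left_injective k) u (l - k)
  simpa using this

theorem nabla_apply {d : ℕ} (u : Filt d) (k l : Fin d → ℤ) :
    nabla k u l = u l - u (l - k) := by
  rw [nabla, Finsupp.sub_apply, mapDomain_add_apply]

theorem SupportedIn.nabla_single {d : ℕ} {u : Filt d} {K : ℕ} (h : SupportedIn u K) (i : Fin d) :
    SupportedIn (nabla (Pi.single i 1) u) (K + 1) := by
  intro k hk j
  rw [nabla_apply] at hk
  push_cast
  by_cases h1 : u k = 0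
  · have h2 : u (k - Pi.single i 1) ≠ 0 := fun h2 => hk (by rw [h1, h2, sub_zero])
    have h3 := h _ h2 j
    rw [Pi.sub_apply, Pi.single_apply] at h3
    split_ifs at h3 <;> rw [abs_le] at * <;> constructor <;> linarith [h3.1, h3.2]
  · linarith [h k h1 j]

theorem norm_le_of_nabla_le {d : ℕ} {u : Filt d} {K : ℕ} (h : SupportedIn u K) (i : Fin d) {B : ℝ}
    (hB : ∀ k, ‖nabla (Pi.single i 1) u k‖ ≤ B) (k : Fin d → ℤ) :
    ‖u k‖ ≤ (2 * K + 1) * B := by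
  have hB0 : 0 ≤ B := (norm_nonneg _).trans (hB 0)
  have tel : ∀ s : ℕ, ‖u k - u (k - s • Pi.single i 1)‖ ≤ s * B := by
    intro s
    induction s with
    | zero => simp
    | succ s ih =>
      have h1 := hB (k - s • Pi.single i 1)
      rw [nabla_apply] at h1
      have h2 : k - (s + 1) • Pi.single i 1 = k - s • Pi.single i 1 - Pi.single i 1 := by
        rw [succ_nsmul]; abel
      rw [h2]
      refine (norm_sub_le_norm_sub_add_norm_sub _ (u (k - s • Pi.single i 1)) _).trans ?_
      push_cast
      linarith
  by_cases hk : u k = 0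
  · rw [hk, norm_zero]; positivity
  · have h0 : u (k - (2 * K + 1) • Pi.single i 1) = 0 := by
      by_contra h0
      have h1 := h _ h0 i
      have h2 := h _ hk i
      rw [Pi.sub_apply, Pi.smul_apply, Pi.single_eq_same, nsmul_eq_mul, mul_one] at h1
      push_cast at h1
      rw [abs_le] at h1 h2
      linarith [h1.1, h2.2]
    have := tel (2 * K + 1)
    rw [h0, sub_zero] at this
    exact_mod_cast this

theorem norm_apply_le_l2norm {d : ℕ} (u : Filt d) (k : Fin d → ℤ) : ‖u k‖ ≤ l2norm u := by
  refine Real.le_sqrt_of_sq_le ?_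
  by_cases hk : u k = 0
  · rw [hk]; simpa using Finsupp.sum_nonneg' fun _ => by positivity
  · exact Finset.single_le_sum (f := fun k => ‖u k‖ ^ 2) (fun _ _ => by positivity)
      (Finsupp.mem_support_iff.mpr hk)

/-- An operator of order `p` enlarges supports by at most `p`, and can be inverted on compactly
supported sequences at the cost of a power `p` of the size of the support. -/
def IsDifferenceOfOrder {d : ℕ} (F : Filt d → Filt d) (p : ℕ) : Prop :=
  ∀ (u : Filt d) (K : ℕ) (B : ℝ), SupportedIn u K → (∀ k, ‖F u k‖ ≤ B) →
    SupportedIn (F u) (K + p) ∧ ∀ k, ‖u k‖ ≤ (2 * (K + p : ℝ) + 1) ^ p * B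

theorem isDifferenceOfOrder_id {d : ℕ} : IsDifferenceOfOrder (d := d) (fun u => u) 0 :=
  fun _ _ _ h hB => ⟨by simpa using h, by simpa using hB⟩

theorem isDifferenceOfOrder_nabla {d : ℕ} (i : Fin d) :
    IsDifferenceOfOrder (nabla (Pi.single i 1)) 1 := by
  intro u K B h hB
  have hB0 : 0 ≤ B := (norm_nonneg _).trans (hB 0)
  refine ⟨h.nabla_single i, fun k => (norm_le_of_nabla_le h i hB k).trans ?_⟩
  rw [pow_one]
  gcongr
  simp

theorem IsDifferenceOfOrder.comp {d : ℕ} {F G : Filt d → Filt d} {p q : ℕ}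
    (hG : IsDifferenceOfOrder G q) (hF : IsDifferenceOfOrder F p) :
    IsDifferenceOfOrder (fun u => G (F u)) (p + q) := by
  intro u K B h hB
  have hB0 : 0 ≤ B := (norm_nonneg _).trans (hB 0)
  have hs : SupportedIn (F u) (K + p) := by
    exact (hF u K _ h fun k => norm_apply_le_l2norm _ k).1
  obtain ⟨h1, h2⟩ := hG (F u) (K + p) B hs hB
  refine ⟨by rwa [← add_assoc], fun k => ((hF u K _ h h2).2 k).trans ?_⟩
  rw [pow_add, mul_assoc]
  push_cast
  have hp : (0 : ℝ) ≤ p := by positivity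
  have hq : (0 : ℝ) ≤ q := by positivity
  gcongr ?_ ^ p * (?_ ^ q * B) <;> linarith

theorem isDifferenceOfOrder_nablaPow {d : ℕ} (μ : Fin d → ℕ) :
    IsDifferenceOfOrder (nablaPow μ) (∑ i, μ i) := by
  have hit : ∀ (i : Fin d) (n : ℕ),
      IsDifferenceOfOrder (fun u => (nabla (Pi.single i 1))^[n] u) n := by
    intro i n
    induction n with
    | zero => exact isDifferenceOfOrder_id
    | succ n ih =>
      simp only [Function.iterate_succ_apply']
      exact (isDifferenceOfOrder_nabla i).comp ih
  have key : ∀ l : List (Fin d), IsDifferenceOfOrder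
      (fun u => l.foldr (fun j v => (nabla (Pi.single j 1))^[μ j] v) u) (l.map μ).sum := by
    intro l
    induction l with
    | nil => exact isDifferenceOfOrder_id
    | cons j l ih =>
      simp only [List.foldr_cons, List.map_cons, List.sum_cons, add_comm (μ j)]
      exact (hit j (μ j)).comp ih
  have := key (List.finRange d)
  rwa [← List.ofFn_eq_map, List.sum_ofFn] at this

theorem norm_symbol_zero_le {d : ℕ} {u : Filt d} {K : ℕ} (h : SupportedIn u K) {B : ℝ}
    (hB : ∀ k, ‖u k‖ ≤ B) : ‖symbol u 0‖ ≤ (2 * K + 1) ^ d * B := by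
  have hB0 : 0 ≤ B := (norm_nonneg _).trans (hB 0)
  have hs : u.support ⊆ Fintype.piFinset fun _ : Fin d => Finset.Icc (-(K : ℤ)) K := by
    intro k hk
    rw [Fintype.mem_piFinset]
    intro i
    rw [Finset.mem_Icc]
    exact abs_le.mp (h k (Finsupp.mem_support_iff.mp hk) i)
  have hc : (u.support.card : ℝ) ≤ (2 * K + 1) ^ d := by
    have h1 := Finset.card_le_card hs
    rw [Fintype.card_piFinset] at h1
    simp only [Int.card_Icc, Finset.prod_const, Finset.card_univ, Fintype.card_fin] at h1
    have h2 : ((K : ℤ) + 1 - -(K : ℤ)).toNat = 2 * K + 1 := by omega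
    rw [h2] at h1
    exact_mod_cast h1
  calc ‖symbol u 0‖ = ‖∑ k ∈ u.support, u k‖ := by simp [symbol, Finsupp.sum]
    _ ≤ ∑ k ∈ u.support, ‖u k‖ := norm_sum_le _ _
    _ ≤ u.support.card * B := by
        rw [← nsmul_eq_mul]
        exact Finset.sum_le_card_nsmul _ _ _ fun k _ => hB k
    _ ≤ _ := by gcongr

theorem SupportedIn.subdivision {d : ℕ} {a v : Filt d} {A K c : ℕ} (ha : SupportedIn a A)
    (hv : SupportedIn v K) {M : Matrix (Fin d) (Fin d) ℤ} (hM : ∀ i, ∑ j, |M i j| ≤ (c : ℤ)) :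
    SupportedIn (subdivision a M v) (A + c * K) := by
  intro n hn i
  rw [_root_.subdivision, Finsupp.sum, Finsupp.finsetSum_apply] at hn
  obtain ⟨k, hk, hne⟩ := Finset.exists_ne_zero_of_sum_ne_zero hn
  rw [Finsupp.smul_apply, mapDomain_add_apply] at hne
  have h1 := ha _ (right_ne_zero_of_mul hne) i
  have h2 : |M.mulVec k i| ≤ c * K := by
    rw [Matrix.mulVec, dotProduct]
    calc |∑ j, M i j * k j| ≤ ∑ j, |M i j * k j| := Finset.abs_sum_le_sum_abs _ _
      _ ≤ ∑ j, |M i j| * K := by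
          refine Finset.sum_le_sum fun j _ => ?_
          rw [abs_mul]
          exact mul_le_mul_of_nonneg_left (hv k (Finsupp.mem_support_iff.mp hk) j) (abs_nonneg _)
      _ ≤ c * K := by
          rw [← Finset.sum_mul]
          exact mul_le_mul_of_nonneg_right (hM i) (by positivity)
  rw [Pi.sub_apply] at h1
  rw [abs_le] at *
  push_cast
  constructor <;> linarith [h1.1, h1.2, h2.1, h2.2]

theorem freqMap_zero {d : ℕ} (M : Matrix (Fin d) (Fin d) ℤ) : freqMap M 0 = 0 := by
  funext j; simp [freqMap]

theorem cascadeAbs_at_zero {d : ℕ} {a : Filt d} (ha : symbol a 0 = 1)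
    (M : Matrix (Fin d) (Fin d) ℤ) (j : ℕ) : cascadeAbs a M j 0 = |(M.det : ℝ)| ^ j := by
  induction j with
  | zero => rw [cascadeAbs_zero, pow_zero]
  | succ j ih => rw [cascadeAbs_succ, freqMap_zero, ih, ha, norm_one, pow_succ]; ring

/-- The differences of a subdivision scheme decay at most geometrically: `∑ₖ (Sʲδ)(k) = |det M|ʲ`
does not decay, the support of `Sʲδ` grows geometrically, and each difference operator loses at
most a factor of the size of the support. -/
theorem exists_le_l2norm_nablaPow {d : ℕ} {a : Filt d} (ha : symbol a 0 = 1)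
    {M : Matrix (Fin d) (Fin d) ℤ} (hM : M.det ≠ 0) (μ : Fin d → ℕ) :
    ∃ c q : ℝ, 0 < c ∧ 0 < q ∧ ∀ j,
      c * q ^ j ≤ l2norm (nablaPow μ ((subdivision a M)^[j] (Finsupp.single 0 1))) := by
  obtain ⟨A, hA⟩ := exists_supportedIn a
  set p := ∑ i, μ i with hp
  obtain ⟨c, hc⟩ : ∃ c : ℕ, ∀ i, ∑ j, |M i j| ≤ (c : ℤ) := by
    refine ⟨(∑ i, ∑ j, |M i j|).toNat, fun i => (Int.self_le_toNat _).trans' ?_⟩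
    exact Finset.single_le_sum (f := fun i => ∑ j, |M i j|)
      (fun _ _ => Finset.sum_nonneg fun _ _ => abs_nonneg _) (Finset.mem_univ i)
  have hsupp : ∀ j, SupportedIn ((subdivision a M)^[j] (Finsupp.single 0 1))
      (A * (c + 1) ^ j) := by
    intro j
    induction j with
    | zero =>
      intro k hk i
      have hk0 : k = 0 := by
        by_contra h
        exact hk (Finsupp.single_eq_of_ne h)
      simp [hk0]
    | succ j ih =>
      rw [Function.iterate_succ_apply']
      intro k hk i
      refine (hA.subdivision ih hc k hk i).trans ?_
      have h1 : 1 ≤ (c + 1) ^ j := Nat.one_le_pow _ _ (by omega)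
      have : A + c * (A * (c + 1) ^ j) ≤ A * (c + 1) ^ (j + 1) := by
        rw [pow_succ]
        nlinarith [Nat.mul_le_mul_left A h1]
      exact_mod_cast this
  set L : ℝ := 2 * (A + p) + 1 with hL
  have hLpos : 0 < L := by positivity
  have hcc : (0 : ℝ) < c + 1 := by positivity
  refine ⟨(L ^ (d + p))⁻¹, ((c + 1 : ℝ) ^ (d + p))⁻¹, by positivity, by positivity, fun j => ?_⟩
  set u := (subdivision a M)^[j] (Finsupp.single 0 1) with hu
  have hdet : 1 ≤ ‖symbol u 0‖ := by
    have h1 : ‖symbol u 0‖ = _ := cascadeAbs_at_zero ha M j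
    rw [h1]
    refine one_le_pow₀ ?_
    exact_mod_cast Int.one_le_abs hM
  have h1 := (isDifferenceOfOrder_nablaPow μ u _ _ (hsupp j)
    fun k => norm_apply_le_l2norm _ k).2
  have h2 := hdet.trans (norm_symbol_zero_le (hsupp j) h1)
  rw [← hp] at h2
  set N := l2norm (nablaPow μ u) with hN
  have hN0 : 0 ≤ N := l2norm_nonneg _
  have hone : (1 : ℝ) ≤ (c + 1 : ℝ) ^ j :=
    one_le_pow₀ (by linarith [(Nat.cast_nonneg c : (0 : ℝ) ≤ c)])
  have hA0 : (0 : ℝ) ≤ A := Nat.cast_nonneg A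
  have hp0 : (0 : ℝ) ≤ p := Nat.cast_nonneg p
  have hx1 : 2 * ((A * (c + 1) ^ j : ℕ) : ℝ) + 1 ≤ L * (c + 1) ^ j := by
    push_cast; nlinarith [mul_nonneg hp0 (zero_le_one.trans hone)]
  have hx2 : 2 * (((A * (c + 1) ^ j : ℕ) : ℝ) + p) + 1 ≤ L * (c + 1) ^ j := by
    push_cast; nlinarith [mul_le_mul_of_nonneg_left hone hp0]
  have h3 : 1 ≤ (L * (c + 1) ^ j) ^ (d + p) * N := by
    refine h2.trans ?_
    rw [pow_add, mul_assoc]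
    gcongr
  rw [inv_pow, ← mul_inv, ← pow_mul, mul_comm (d + p) j, pow_mul, ← mul_pow]
  rw [inv_le_iff_one_le_mul₀ (by positivity), mul_comm]
  exact h3

/-- `ρ` is positive, provided that the differences grow at most geometrically. -/
theorem rho_pos {d : ℕ} [NeZero d] {m : ℕ} {a : Filt d} (ha : symbol a 0 = 1)
    {M : Matrix (Fin d) (Fin d) ℤ} (hM : M.det ≠ 0) {r : ℝ}
    (hr : 0 ≤ r) (h : ∀ μ : Fin d → ℕ, ∑ i, μ i = m → ∃ K, ∀ᶠ j in atTop,
      l2norm (nablaPow μ ((subdivision a M)^[j] (Finsupp.single 0 1))) ≤ K * r ^ j) :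
    0 < rho m a M := by
  let μ₀ : {μ : Fin d → ℕ // ∑ i, μ i = m} := ⟨Pi.single 0 m, by simp⟩
  have hb : ∀ μ : {μ : Fin d → ℕ // ∑ i, μ i = m}, _ := fun μ =>
    limsup_root_le (fun _ => l2norm_nonneg _) hr (h μ.1 μ.2).choose_spec
  obtain ⟨c, q, hc, hq, hle⟩ := exists_le_l2norm_nablaPow ha hM μ₀.1
  refine hq.trans_le ((le_limsup_root hc hq.le hle (hb μ₀).1).trans ?_)
  refine le_ciSup (f := fun μ : {μ : Fin d → ℕ // ∑ i, μ i = m} => limsup (fun n : ℕ =>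
      l2norm (nablaPow μ.1 ((subdivision a M)^[n] (Finsupp.single 0 1))) ^ (1 / (n : ℝ))) atTop)
    ⟨r, ?_⟩ μ₀
  rintro _ ⟨μ, rfl⟩
  exact (hb μ).2

/-- In dimension one, a rate larger than `ρ` is eventually an upper bound. -/
theorem eventually_le_of_rho_lt {m : ℕ} {a : Filt 1} {M : Matrix (Fin 1) (Fin 1) ℤ} {r R : ℝ}
    (hR : 0 ≤ R) (h : ∃ K, ∀ᶠ j in atTop,
      l2norm (nablaPow (fun _ => m) ((subdivision a M)^[j] (Finsupp.single 0 1))) ≤ K * R ^ j)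
    (hr : rho m a M < r) : ∀ᶠ j in atTop,
      l2norm (nablaPow (fun _ => m) ((subdivision a M)^[j] (Finsupp.single 0 1))) ≤ r ^ j := by
  obtain ⟨K, hK⟩ := h
  have hb := (limsup_root_le (fun _ => l2norm_nonneg _) hR hK).1
  have hrho : rho m a M = limsup (fun n : ℕ => l2norm (nablaPow (fun _ => m)
      ((subdivision a M)^[n] (Finsupp.single 0 1))) ^ (1 / (n : ℝ))) atTop := by
    have hs : ∀ μ : {μ : Fin 1 → ℕ // ∑ i, μ i = m}, μ = ⟨fun _ => m, by simp⟩ := by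
      rintro ⟨μ, hμ⟩
      ext i
      fin_cases i
      simpa using hμ
    let _ : Unique {μ : Fin 1 → ℕ // ∑ i, μ i = m} := ⟨⟨_⟩, hs⟩
    rw [rho, ciSup_unique]
    rfl
  rw [hrho] at hr
  filter_upwards [eventually_lt_of_limsup_lt hr hb, eventually_ne_atTop 0] with j h1 h2
  have h3 := l2norm_nonneg (nablaPow (fun _ => m)
    ((subdivision a M)^[j] (Finsupp.single 0 1)))
  have h4 := pow_le_pow_left₀ (Real.rpow_nonneg h3 _) h1.le j
  rwa [one_div, Real.rpow_inv_natCast_pow h3 h2] at h4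

/-! ### One-dimensional filters -/

theorem mem_dualNodes_dil2 (ξ : Fin 1 → ℝ) : ξ ∈ dualNodes dil2 ↔ ξ = 0 ∨ ξ = ![1 / 2] := by
  simp only [dualNodes, dil2, Set.mem_ofPred_eq]
  constructor
  · rintro ⟨h, k, hk⟩
    have h1 := congrFun hk 0
    simp [Matrix.mulVec, dotProduct] at h1
    obtain ⟨h2, h3⟩ := h 0
    have h4 : (0 : ℤ) ≤ k 0 := by
      have : (0 : ℝ) ≤ k 0 := by rw [← h1]; linarith
      exact_mod_cast this
    have h5 : k 0 < 2 := by
      have : (k 0 : ℝ) < 2 := by rw [← h1]; linarith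
      exact_mod_cast this
    have h6 : k 0 = 0 ∨ k 0 = 1 := by omega
    rcases h6 with h6 | h6 <;> rw [h6] at h1
    · left; funext i; fin_cases i; simp at h1 ⊢; linarith
    · right; funext i; fin_cases i; simp at h1 ⊢; linarith
  · rintro (rfl | rfl)
    · exact ⟨by simp, 0, by funext i; simp⟩
    · refine ⟨fun i => by fin_cases i; norm_num, ![1], ?_⟩
      funext i; fin_cases i
      simp [Matrix.mulVec, dotProduct]

/-- The absolute value `|â(t)|` of the symbol of a one-dimensional filter. -/
def amp (a : Filt 1) (t : ℝ) : ℝ := ‖symbol a ![t]‖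

theorem amp_nonneg (a : Filt 1) (t : ℝ) : 0 ≤ amp a t := norm_nonneg _

theorem freqShift_zero {d : ℕ} (ω : Fin d → ℝ) : freqShift ω 0 = ω := by
  funext i; simp [freqShift]

theorem freqShift_half (t : ℝ) : freqShift ![t] ![1 / 2] = ![t + Real.pi] := by
  funext i; fin_cases i; simp [freqShift]; ring

theorem isOrthonormalFilter_dil2_iff (a : Filt 1) :
    IsOrthonormalFilter a dil2 ↔ ∀ t, amp a t ^ 2 + amp a (t + Real.pi) ^ 2 = 1 := by
  have hs : dualNodes dil2 = {0, ![1 / 2]} := by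
    ext ξ; rw [mem_dualNodes_dil2]; rfl
  have hne : (0 : Fin 1 → ℝ) ≠ ![1 / 2] := by
    intro h
    have := congrFun h 0
    norm_num at this
  have key : ∀ t : ℝ, ∑ᶠ ξ ∈ dualNodes dil2, ‖symbol a (freqShift ![t] ξ)‖ ^ 2 =
      amp a t ^ 2 + amp a (t + Real.pi) ^ 2 := by
    intro t
    rw [hs, finsum_mem_pair hne, freqShift_half, freqShift_zero, amp, amp]
  constructor
  · intro h t
    rw [← key]
    exact h _
  · intro h ω
    have : ω = ![ω 0] := by funext i; fin_cases i; rfl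
    rw [this, key, h]

theorem amp_le_one {a : Filt 1} (h : IsOrthonormalFilter a dil2) (t : ℝ) : amp a t ≤ 1 := by
  have h1 := (isOrthonormalFilter_dil2_iff a).mp h t
  nlinarith [amp_nonneg a t, sq_nonneg (amp a (t + Real.pi))]

theorem symbol_add_two_pi (a : Filt 1) (t : ℝ) :
    symbol a ![t + Real.pi + Real.pi] = symbol a ![t] := by
  simp only [symbol]
  refine Finsupp.sum_congr fun k _ => ?_
  congr 1
  rw [Complex.exp_eq_exp_iff_exists_int]
  refine ⟨-(k 0), ?_⟩
  simp
  ring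

theorem symbol_neg_freq {a : Filt 1} (h : IsSymmetricHalf a) (t : ℝ) :
    symbol a ![-t] = Complex.exp (Complex.I * t) * symbol a ![t] := by
  have hs : ∀ k : Fin 1 → ℤ, a (1 - k) = a k := by
    intro k
    have h1 : k = ![k 0] := by funext i; fin_cases i; rfl
    have h2 : 1 - k = ![1 - k 0] := by funext i; fin_cases i; rfl
    rw [h2, h, ← h1]
  simp only [symbol, Finsupp.sum, Finset.mul_sum]
  refine Finset.sum_bij' (fun k _ => 1 - k) (fun k _ => 1 - k) ?_ ?_ ?_ ?_ ?_
  · intro k hk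
    rw [Finsupp.mem_support_iff, hs]; exact Finsupp.mem_support_iff.mp hk
  · intro k hk
    rw [Finsupp.mem_support_iff, hs]; exact Finsupp.mem_support_iff.mp hk
  · intro k _; abel
  · intro k _; abel
  · intro k _
    rw [hs, mul_left_comm, ← Complex.exp_add]
    congr 2
    simp
    ring

theorem amp_neg {a : Filt 1} (h : IsSymmetricHalf a) (t : ℝ) : amp a (-t) = amp a t := by
  rw [amp, symbol_neg_freq h, norm_mul, mul_comm Complex.I, Complex.norm_exp_ofReal_mul_I,
    one_mul, amp]

theorem freqMap_dil2 (t : ℝ) : freqMap dil2 ![t] = ![2 * t] := by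
  funext i; fin_cases i; simp [freqMap, dil2]

theorem det_dil2 : dil2.det = 2 := by simp [dil2]

theorem cascadeAbs_dil2_succ (a : Filt 1) (j : ℕ) (t : ℝ) :
    cascadeAbs a dil2 (j + 1) ![t] = 2 * cascadeAbs a dil2 j ![2 * t] * amp a t := by
  rw [cascadeAbs_succ, freqMap_dil2, det_dil2, amp]
  norm_num

theorem cascadeAbs_dil2_le {a : Filt 1} (h : IsOrthonormalFilter a dil2) (j : ℕ) (t : ℝ) :
    cascadeAbs a dil2 j ![t] ≤ 2 ^ j := by
  induction j generalizing t with
  | zero => rw [cascadeAbs_zero, pow_zero]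
  | succ j ih =>
    rw [cascadeAbs_dil2_succ, pow_succ]
    have h1 := ih (2 * t)
    have h2 := amp_le_one h t
    have h3 := amp_nonneg a t
    have h4 := cascadeAbs_nonneg a dil2 j ![2 * t]
    nlinarith [mul_le_mul h1 h2 h3 (by positivity)]

theorem norm_symbol_nablaPow_dil2 (a : Filt 1) (m j : ℕ) (t : ℝ) :
    ‖symbol (nablaPow (fun _ => m) ((subdivision a dil2)^[j] (Finsupp.single 0 1))) ![t]‖ =
      (2 * |Real.sin (t / 2)|) ^ m * cascadeAbs a dil2 j ![t] := by
  rw [norm_symbol_nablaPow, cascadeAbs]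
  simp

theorem eq_vec_one {α : Type*} (ω : Fin 1 → α) : ω = ![ω 0] := by funext i; fin_cases i; rfl

theorem eq_vec_two {α : Type*} (ω : Fin 2 → α) : ω = ![ω 0, ω 1] := by funext i; fin_cases i <;> rfl

theorem l2norm_nablaPow_dil2_le {a : Filt 1} (h : IsOrthonormalFilter a dil2) (m j : ℕ) :
    l2norm (nablaPow (fun _ => m) ((subdivision a dil2)^[j] (Finsupp.single 0 1))) ≤
      2 ^ m * 2 ^ j := by
  refine (sq_le_sq₀ (l2norm_nonneg _) (by positivity)).mp ?_
  refine l2norm_sq_le_of_symbol_le _ fun ω => ?_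
  rw [eq_vec_one ω, norm_symbol_nablaPow_dil2]
  have h1 := cascadeAbs_nonneg a dil2 j ![ω 0]
  have h2 := cascadeAbs_dil2_le h j (ω 0)
  have h3 : 2 * |Real.sin (ω 0 / 2)| ≤ 2 := by
    linarith [Real.abs_sin_le_one (ω 0 / 2)]
  gcongr

theorem fun_eq_const_of_sum_eq {m : ℕ} {μ : Fin 1 → ℕ} (h : ∑ i, μ i = m) : μ = fun _ => m := by
  funext i
  fin_cases i
  simpa using h

theorem rho_dil2_pos {a : Filt 1} (h : IsOrthonormalFilter a dil2) (ha : symbol a 0 = 1) (m : ℕ) :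
    0 < rho m a dil2 := by
  refine rho_pos ha (by rw [det_dil2]; norm_num) (r := 2) (by norm_num) fun μ hμ => ?_
  rw [fun_eq_const_of_sum_eq hμ]
  exact ⟨2 ^ m, Eventually.of_forall (l2norm_nablaPow_dil2_le h m)⟩

/-! ### The quincunx filters -/

theorem freqMap_quincunxM (s t : ℝ) : freqMap quincunxM ![s, t] = ![s + t, s - t] := by
  funext i; fin_cases i <;> simp [freqMap, quincunxM]; ring

theorem freqMap_quincunxN (s t : ℝ) : freqMap quincunxN ![s, t] = ![s + t, t - s] := by
  funext i; fin_cases i <;> simp [freqMap, quincunxN]; ring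

theorem det_quincunxM : quincunxM.det = -2 := by simp [quincunxM, Matrix.det_fin_two]

theorem det_quincunxN : quincunxN.det = 2 := by simp [quincunxN, Matrix.det_fin_two]

theorem symbol_lowpass2D (a : Filt 1) (ω : Fin 2 → ℝ) :
    symbol (lowpass2D a) ω = symbol a ![ω 0] * symbol a ![ω 1] := symbol_tensor a a ω

theorem cascadeAbs_quincunxM_succ (a : Filt 1) (j : ℕ) (s t : ℝ) :
    cascadeAbs (lowpass2D a) quincunxM (j + 1) ![s, t] =
      2 * cascadeAbs (lowpass2D a) quincunxM j ![s + t, s - t] * (amp a s * amp a t) := by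
  rw [cascadeAbs_succ, freqMap_quincunxM, det_quincunxM, symbol_lowpass2D, norm_mul, amp, amp]
  norm_num

theorem cascadeAbs_quincunxN_succ (a : Filt 1) (j : ℕ) (s t : ℝ) :
    cascadeAbs (lowpass2D a) quincunxN (j + 1) ![s, t] =
      2 * cascadeAbs (lowpass2D a) quincunxN j ![s + t, t - s] * (amp a s * amp a t) := by
  rw [cascadeAbs_succ, freqMap_quincunxN, det_quincunxN, symbol_lowpass2D, norm_mul, amp, amp]
  norm_num

/-- The subdivision schemes of the two quincunx dilations have symbols of the same absolute value:
`|â(ω₁) â(ω₂)|` is invariant under the group `D₄`, in which the two dilations differ. -/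
theorem cascadeAbs_quincunx_eq {a : Filt 1} (h : IsSymmetricHalf a) (j : ℕ) {s t s' t' : ℝ}
    (hst : |s| = |s'| ∧ |t| = |t'| ∨ |s| = |t'| ∧ |t| = |s'|) :
    cascadeAbs (lowpass2D a) quincunxM j ![s, t] =
      cascadeAbs (lowpass2D a) quincunxN j ![s', t'] := by
  have hamp : ∀ {x y : ℝ}, |x| = |y| → amp a x = amp a y := by
    intro x y hxy
    rcases abs_eq_abs.mp hxy with rfl | rfl
    · rfl
    · exact amp_neg h y
  induction j generalizing s t s' t' with
  | zero => rw [cascadeAbs_zero, cascadeAbs_zero]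
  | succ j ih =>
    rw [cascadeAbs_quincunxM_succ, cascadeAbs_quincunxN_succ]
    have h1 : amp a s * amp a t = amp a s' * amp a t' := by
      rcases hst with ⟨h1, h2⟩ | ⟨h1, h2⟩
      · rw [hamp h1, hamp h2]
      · rw [hamp h1, hamp h2, mul_comm]
    have key : ∀ {x y x' y' : ℝ}, |x| = |x'| → |y| = |y'| →
        |x + y| = |x' + y'| ∧ |x - y| = |y' - x'| ∨ |x + y| = |y' - x'| ∧ |x - y| = |x' + y'| := by
      intro x y x' y' hx hy
      rcases abs_eq_abs.mp hx with rfl | rfl <;> rcases abs_eq_abs.mp hy with rfl | rfl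
      · exact Or.inl ⟨rfl, abs_sub_comm _ _⟩
      · exact Or.inr ⟨by rw [← abs_neg]; congr 1; ring, by congr 1; ring⟩
      · exact Or.inr ⟨by congr 1; ring, by rw [← abs_neg]; congr 1; ring⟩
      · exact Or.inl ⟨by rw [← abs_neg]; congr 1; ring, by congr 1; ring⟩
    have hst' : |s + t| = |s' + t'| ∧ |s - t| = |t' - s'| ∨
        |s + t| = |t' - s'| ∧ |s - t| = |s' + t'| := by
      rcases hst with ⟨h1, h2⟩ | ⟨h1, h2⟩
      · exact key h1 h2
      · rw [add_comm s' t', abs_sub_comm t' s']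
        exact key h1 h2
    rw [h1, ih hst']

/-- Two steps of the quincunx scheme are a tensor product step of the dyadic scheme with the
frequencies `ω₁, ω₂` and one with `ω₁ + ω₂, ω₁ - ω₂`. All symbols are at most one, so that any two
of these four frequencies may be kept. -/
theorem cascadeAbs_quincunxM_le {a : Filt 1} (h : IsOrthonormalFilter a dil2) (j : ℕ) (s t : ℝ) :
    let F := cascadeAbs (lowpass2D a) quincunxM j ![s, t]
    let U := fun x => cascadeAbs a dil2 (j / 2) ![x]
    F ≤ 2 * (U s * U t) ∧ F ≤ 2 * (U s * U (s + t)) ∧ F ≤ 2 * (U t * U (s + t)) := by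
  have h0 := amp_nonneg a
  have h1 := amp_le_one h
  induction j using Nat.twoStepInduction generalizing s t with
  | zero => simp only [Nat.zero_div, cascadeAbs_zero]; norm_num
  | one =>
    have : cascadeAbs (lowpass2D a) quincunxM 1 ![s, t] ≤ 2 := by
      rw [cascadeAbs_quincunxM_succ, cascadeAbs_zero]
      linarith [mul_le_one₀ (h1 s) (h0 t) (h1 t)]
    simp only [Nat.reduceDiv, cascadeAbs_zero, mul_one]
    exact ⟨this, this, this⟩
  | more j ih _ =>
    have e : (j + 2) / 2 = j / 2 + 1 := by omega
    have hF : cascadeAbs (lowpass2D a) quincunxM (j + 2) ![s, t] =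
        4 * cascadeAbs (lowpass2D a) quincunxM j ![2 * s, 2 * t] *
          (amp a s * amp a t * amp a (s + t) * amp a (s - t)) := by
      rw [cascadeAbs_quincunxM_succ, cascadeAbs_quincunxM_succ]
      have e1 : s + t + (s - t) = 2 * s := by ring
      have e2 : s + t - (s - t) = 2 * t := by ring
      rw [e1, e2]
      ring
    obtain ⟨i1, i2, i3⟩ := ih (2 * s) (2 * t)
    rw [← mul_add] at i2 i3
    have hFn := cascadeAbs_nonneg (lowpass2D a) quincunxM j ![2 * s, 2 * t]
    have hUn := fun x : ℝ => cascadeAbs_nonneg a dil2 (j / 2) ![x]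
    -- dropping two of the four factors
    have step : ∀ {F V W x y z w : ℝ}, 0 ≤ F → F ≤ 2 * (V * W) → 0 ≤ V → 0 ≤ W →
        0 ≤ x → 0 ≤ y → 0 ≤ z → z ≤ 1 → 0 ≤ w → w ≤ 1 →
        4 * F * (x * y * z * w) ≤ 2 * (2 * V * x * (2 * W * y)) := by
      intro F V W x y z w hF hFV hV hW hx hy hz hz1 hw hw1
      have hzw : z * w ≤ 1 := mul_le_one₀ hz1 hw hw1
      calc 4 * F * (x * y * z * w) = 4 * F * (x * y) * (z * w) := by ring
        _ ≤ 4 * F * (x * y) * 1 := by gcongr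
        _ ≤ 4 * (2 * (V * W)) * (x * y) * 1 := by gcongr
        _ = _ := by ring
    simp only [e, cascadeAbs_dil2_succ, hF]
    refine ⟨?_, ?_, ?_⟩
    · exact step hFn i1 (hUn _) (hUn _) (h0 s) (h0 t) (h0 _) (h1 (s + t)) (h0 _) (h1 (s - t))
    · have := step hFn i2 (hUn _) (hUn _) (h0 s) (h0 (s + t)) (h0 _) (h1 t) (h0 _) (h1 (s - t))
      rwa [mul_right_comm (amp a s) (amp a (s + t))] at this
    · have := step hFn i3 (hUn _) (hUn _) (h0 t) (h0 (s + t)) (h0 _) (h1 s) (h0 _) (h1 (s - t))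
      rwa [mul_right_comm (amp a t), mul_comm (amp a t)] at this

/-- If each of `x, y` exceeds the other by at most `z`, a monomial of degree `2 m` or more in `x`
and `y` is bounded by products of `m`-th powers of two of the three numbers. -/
theorem pow_mul_pow_le_pairs {x y z : ℝ} (hx : 0 ≤ x) (hy : 0 ≤ y) (hz : 0 ≤ z) (hx1 : x ≤ 1)
    (hy1 : y ≤ 1) (hxy : x ≤ y + z) (hyx : y ≤ x + z) {m p q : ℕ} (hpq : 2 * m ≤ p + q) :
    x ^ p * y ^ q ≤ 2 ^ m * (x ^ m * y ^ m + x ^ m * z ^ m + y ^ m * z ^ m) := by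
  have key : ∀ {u v : ℝ}, 0 ≤ u → 0 ≤ v → v ≤ u → u ≤ 1 → u ≤ v + z → ∀ {p q : ℕ},
      2 * m ≤ p + q → u ^ p * v ^ q ≤ 2 ^ m * (u ^ m * v ^ m + u ^ m * z ^ m) := by
    intro u v hu hv hvu hu1 huv p q hpq
    have h1 : u ≤ 2 * max v z := by linarith [le_max_left v z, le_max_right v z]
    have h2 : u ^ m ≤ 2 ^ m * (v ^ m + z ^ m) := by
      calc u ^ m ≤ (2 * max v z) ^ m := by gcongr
        _ = 2 ^ m * (max v z) ^ m := mul_pow _ _ _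
        _ ≤ 2 ^ m * (v ^ m + z ^ m) := by
            gcongr
            rcases max_choice v z with h | h <;> rw [h]
            · linarith [pow_nonneg hz m]
            · linarith [pow_nonneg hv m]
    calc u ^ p * v ^ q ≤ u ^ p * u ^ q := by gcongr
      _ = u ^ (p + q) := (pow_add _ _ _).symm
      _ ≤ u ^ (2 * m) := pow_le_pow_of_le_one hu hu1 hpq
      _ = u ^ m * u ^ m := by rw [two_mul, pow_add]
      _ ≤ u ^ m * (2 ^ m * (v ^ m + z ^ m)) := by gcongr
      _ = _ := by ring
  rcases le_total y x with h | h
  · refine (key hx hy h hx1 hxy hpq).trans ?_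
    exact mul_le_mul_of_nonneg_left (le_add_of_nonneg_right (by positivity)) (by positivity)
  · rw [mul_comm (x ^ p)]
    refine (key hy hx h hy1 hyx (by rwa [add_comm])).trans ?_
    refine mul_le_mul_of_nonneg_left ?_ (by positivity)
    linarith [mul_nonneg (pow_nonneg hx m) (pow_nonneg hz m), mul_comm (x ^ m) (y ^ m)]

/-- Differences of order at least `2 m` of the quincunx scheme are controlled by the square of
differences of order `m` of the dyadic scheme. A high power of `|sin (ω₁/2)|` alone is turned into
a product over two frequencies by
`|sin (ω₁/2)| ≤ |sin (ω₂/2)| + |sin ((ω₁+ω₂)/2)|`. -/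
theorem exists_l2norm_quincunxM_le {a : Filt 1} (h : IsOrthonormalFilter a dil2) {m : ℕ}
    {μ : Fin 2 → ℕ} (hμ : 2 * m ≤ ∑ i, μ i) : ∃ K, ∀ j,
      l2norm (nablaPow μ ((subdivision (lowpass2D a) quincunxM)^[j] (Finsupp.single 0 1))) ≤
        K * l2norm (nablaPow (fun _ => m)
          ((subdivision a dil2)^[j / 2] (Finsupp.single 0 1))) ^ 2 := by
  rw [Fin.sum_univ_two] at hμ
  set C : ℝ := 2 ^ (μ 0 + μ 1) * 2 ^ m * 2 with hC
  have hC0 : 0 < C := by positivity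
  refine ⟨3 * C, fun j => ?_⟩
  set v := nablaPow μ ((subdivision (lowpass2D a) quincunxM)^[j] (Finsupp.single 0 1)) with hv
  set u := nablaPow (fun _ => m) ((subdivision a dil2)^[j / 2] (Finsupp.single 0 1)) with hu
  have main : l2norm v ^ 2 ≤ 3 * (3 * C ^ 2) * (l2norm u ^ 2) ^ 2 := by
    refine l2norm_sq_le_of_symbol_le_pairs u v fun s t => ?_
    set x := |Real.sin (s / 2)| with hx
    set y := |Real.sin (t / 2)| with hy
    set z := |Real.sin ((s + t) / 2)| with hz
    have tri : ∀ p q : ℝ, |Real.sin (p - q)| ≤ |Real.sin p| + |Real.sin q| := by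
      intro p q
      rw [Real.sin_sub]
      refine (abs_sub _ _).trans (add_le_add ?_ ?_) <;> rw [abs_mul]
      · exact mul_le_of_le_one_right (abs_nonneg _) (Real.abs_cos_le_one _)
      · exact mul_le_of_le_one_left (abs_nonneg _) (Real.abs_cos_le_one _)
    have hxy : x ≤ y + z := by
      have h1 := tri ((s + t) / 2) (t / 2)
      have h2 : (s + t) / 2 - t / 2 = s / 2 := by ring
      rw [h2] at h1
      linarith
    have hyx : y ≤ x + z := by
      have h1 := tri ((s + t) / 2) (s / 2)
      have h2 : (s + t) / 2 - s / 2 = t / 2 := by ring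
      rw [h2] at h1
      linarith
    have hpow := pow_mul_pow_le_pairs (abs_nonneg _) (abs_nonneg _) (abs_nonneg _)
      (Real.abs_sin_le_one _) (Real.abs_sin_le_one _) hxy hyx hμ
    obtain ⟨b1, b2, b3⟩ := cascadeAbs_quincunxM_le h j s t
    set F := cascadeAbs (lowpass2D a) quincunxM j ![s, t] with hF
    have hF0 : 0 ≤ F := cascadeAbs_nonneg _ _ _ _
    have hvF : ‖symbol v ![s, t]‖ = (2 * x) ^ μ 0 * (2 * y) ^ μ 1 * F := by
      rw [hv, norm_symbol_nablaPow, Fin.prod_univ_two]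
      rfl
    have hX : ∀ p : ℝ, |Real.sin (p / 2)| ^ m * cascadeAbs a dil2 (j / 2) ![p] ≤
        ‖symbol u ![p]‖ := by
      intro p
      rw [hu, norm_symbol_nablaPow_dil2]
      have := cascadeAbs_nonneg a dil2 (j / 2) ![p]
      gcongr
      linarith [abs_nonneg (Real.sin (p / 2))]
    have hU := fun p : ℝ => cascadeAbs_nonneg a dil2 (j / 2) ![p]
    -- combining the bound of the sines with the bound of the cascade for the same two frequencies
    have pair : ∀ {e f P Q X Y : ℝ}, 0 ≤ e → 0 ≤ f → 0 ≤ P → 0 ≤ Q → F ≤ 2 * (P * Q) →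
        e * P ≤ X → f * Q ≤ Y → e * f * F ≤ 2 * (X * Y) := by
      intro e f P Q X Y he hf hP hQ hFPQ hX hY
      calc e * f * F ≤ e * f * (2 * (P * Q)) := by gcongr
        _ = 2 * ((e * P) * (f * Q)) := by ring
        _ ≤ 2 * (X * Y) := by
            have := (mul_nonneg he hP).trans hX
            gcongr
    have hx0 : 0 ≤ x ^ m := by positivity
    have hy0 : 0 ≤ y ^ m := by positivity
    have hz0 : 0 ≤ z ^ m := by positivity
    have p1 := pair hx0 hy0 (hU s) (hU t) b1 (hX s) (hX t)
    have p2 := pair hx0 hz0 (hU s) (hU (s + t)) b2 (hX s) (hX (s + t))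
    have p3 := pair hy0 hz0 (hU t) (hU (s + t)) b3 (hX t) (hX (s + t))
    set X := ‖symbol u ![s]‖
    set Y := ‖symbol u ![t]‖
    set Z := ‖symbol u ![s + t]‖
    have hvle : ‖symbol v ![s, t]‖ ≤ C * (X * Y + X * Z + Y * Z) := by
      rw [hvF]
      calc (2 * x) ^ μ 0 * (2 * y) ^ μ 1 * F
          = 2 ^ (μ 0 + μ 1) * (x ^ μ 0 * y ^ μ 1) * F := by rw [mul_pow, mul_pow, pow_add]; ring
        _ ≤ 2 ^ (μ 0 + μ 1) * (2 ^ m * (x ^ m * y ^ m + x ^ m * z ^ m + y ^ m * z ^ m)) * F := by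
            gcongr
        _ = 2 ^ (μ 0 + μ 1) * 2 ^ m *
            (x ^ m * y ^ m * F + x ^ m * z ^ m * F + y ^ m * z ^ m * F) := by ring
        _ ≤ 2 ^ (μ 0 + μ 1) * 2 ^ m * (2 * (X * Y) + 2 * (X * Z) + 2 * (Y * Z)) := by gcongr
        _ = _ := by rw [hC]; ring
    calc ‖symbol v ![s, t]‖ ^ 2 ≤ (C * (X * Y + X * Z + Y * Z)) ^ 2 := by gcongr
      _ = C ^ 2 * (X * Y + X * Z + Y * Z) ^ 2 := mul_pow _ _ _
      _ ≤ C ^ 2 * (3 * (X ^ 2 * Y ^ 2 + X ^ 2 * Z ^ 2 + Y ^ 2 * Z ^ 2)) := by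
          gcongr
          nlinarith [sq_nonneg (X * Y - X * Z), sq_nonneg (X * Y - Y * Z),
            sq_nonneg (X * Z - Y * Z)]
      _ = _ := by ring
  have hu0 := l2norm_nonneg u
  refine (sq_le_sq₀ (l2norm_nonneg v) (by positivity)).mp (main.trans (le_of_eq ?_))
  ring

theorem pow_two_mul_half_le {r : ℝ} (hr : 0 < r) (j : ℕ) :
    r ^ (2 * (j / 2)) ≤ (1 + r⁻¹) * r ^ j := by
  have hri : 0 < r⁻¹ := inv_pos.mpr hr
  rcases Nat.even_or_odd' j with ⟨i, rfl | rfl⟩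
  · rw [Nat.mul_div_cancel_left i (by norm_num)]
    nlinarith [pow_pos hr (2 * i)]
  · have : (2 * i + 1) / 2 = i := by omega
    rw [this, pow_succ]
    have h1 : (1 + r⁻¹) * (r ^ (2 * i) * r) = r ^ (2 * i) * r + r ^ (2 * i) := by
      field_simp
    rw [h1]
    nlinarith [pow_pos hr (2 * i), mul_pos (pow_pos hr (2 * i)) hr]

/-- The rate of the quincunx scheme is at most that of the dyadic scheme: two quincunx steps
correspond to one dyadic step, but in two frequencies. -/
theorem rho_quincunxM {a : Filt 1} (h : IsOrthonormalFilter a dil2) (ha : symbol a 0 = 1)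
    {m m' : ℕ} (hm : 2 * m ≤ m') :
    0 < rho m' (lowpass2D a) quincunxM ∧ rho m' (lowpass2D a) quincunxM ≤ rho m a dil2 := by
  have hpos := rho_dil2_pos h ha m
  have key : ∀ r, rho m a dil2 < r → ∀ μ : Fin 2 → ℕ, ∑ i, μ i = m' → ∃ K, ∀ᶠ j in atTop,
      l2norm (nablaPow μ ((subdivision (lowpass2D a) quincunxM)^[j] (Finsupp.single 0 1))) ≤
        K * r ^ j := by
    intro r hr μ hμ
    have hr0 := hpos.trans hr
    obtain ⟨K, hK⟩ := exists_l2norm_quincunxM_le h (hμ ▸ hm : 2 * m ≤ ∑ i, μ i)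
    have hev := eventually_le_of_rho_lt (R := 2) (by norm_num)
      ⟨2 ^ m, Eventually.of_forall (l2norm_nablaPow_dil2_le h m)⟩ hr
    have htend : Tendsto (fun j : ℕ => j / 2) atTop atTop :=
      Nat.tendsto_div_const_atTop (by norm_num)
    refine ⟨|K| * (1 + r⁻¹), ?_⟩
    filter_upwards [htend.eventually hev] with j hj
    have h0 := l2norm_nonneg (nablaPow (fun _ => m)
      ((subdivision a dil2)^[j / 2] (Finsupp.single 0 1)))
    calc _ ≤ _ := hK j
      _ ≤ |K| * (r ^ (j / 2)) ^ 2 := by gcongr; exact le_abs_self K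
      _ = |K| * r ^ (2 * (j / 2)) := by rw [← pow_mul, mul_comm (j / 2)]
      _ ≤ |K| * ((1 + r⁻¹) * r ^ j) := by gcongr; exact pow_two_mul_half_le hr0 j
      _ = _ := by ring
  constructor
  · refine rho_pos ?_ (by rw [det_quincunxM]; norm_num) (r := rho m a dil2 + 1) (by linarith)
      (key _ (by linarith))
    have h0 : (![0] : Fin 1 → ℝ) = 0 := by funext i; fin_cases i; rfl
    rw [symbol_lowpass2D]
    simp only [Pi.zero_apply, h0, ha, mul_one]
  · exact le_of_forall_gt_imp_ge_of_dense fun r hr => rho_le (hpos.trans hr).le (key r hr)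

theorem rho_quincunx_eq {a : Filt 1} (h : IsSymmetricHalf a) (m : ℕ) :
    rho m (lowpass2D a) quincunxM = rho m (lowpass2D a) quincunxN := by
  have key : ∀ (μ : Fin 2 → ℕ) (j : ℕ),
      l2norm (nablaPow μ ((subdivision (lowpass2D a) quincunxM)^[j] (Finsupp.single 0 1))) =
        l2norm (nablaPow μ ((subdivision (lowpass2D a) quincunxN)^[j] (Finsupp.single 0 1))) := by
    intro μ j
    refine l2norm_congr fun ω => ?_
    rw [norm_symbol_nablaPow, norm_symbol_nablaPow, eq_vec_two ω]
    have := cascadeAbs_quincunx_eq h j (s := ω 0) (t := ω 1) (Or.inl ⟨rfl, rfl⟩)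
    rw [cascadeAbs, cascadeAbs] at this
    rw [this]
  simp only [rho, key]

/-! ### Sum rules and vanishing moments -/

theorem norm_vec_one (ω : Fin 1 → ℝ) : ‖ω‖ = |ω 0| := by
  simp [Pi.norm_def]

theorem hasSumRules_dil2_iff (a : Filt 1) (k : ℕ) :
    HasSumRules a dil2 k ↔
      symbol a 0 = 1 ∧ ∃ C, ∀ᶠ t in 𝓝 (0 : ℝ), amp a (t + Real.pi) ≤ C * |t| ^ k := by
  have hne : (![1 / 2] : Fin 1 → ℝ) ≠ 0 := by
    intro h
    have := congrFun h 0
    norm_num at this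
  refine and_congr_right fun _ => ?_
  constructor
  · intro h
    obtain ⟨C, hC⟩ := (h _ ((mem_dualNodes_dil2 _).mpr (Or.inr rfl)) hne).bound
    refine ⟨C, ?_⟩
    have ht : Tendsto (fun t : ℝ => (![t] : Fin 1 → ℝ)) (𝓝 0) (𝓝 0) := by
      refine tendsto_pi_nhds.mpr fun i => ?_
      fin_cases i
      exact tendsto_id
    filter_upwards [ht.eventually hC] with t hC
    rw [freqShift_half, norm_pow, norm_norm, norm_vec_one] at hC
    exact hC
  · rintro ⟨C, hC⟩ ξ hξ hξ0
    obtain rfl : ξ = ![1 / 2] := ((mem_dualNodes_dil2 ξ).mp hξ).resolve_left hξ0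
    refine IsBigO.of_bound C ?_
    have ht : Tendsto (fun ω : Fin 1 → ℝ => ω 0) (𝓝 0) (𝓝 0) :=
      (continuous_apply (0 : Fin 1)).tendsto 0
    filter_upwards [ht.eventually hC] with ω hC
    rw [eq_vec_one ω, freqShift_half]
    simpa [norm_vec_one, amp] using hC

theorem half_half_ne_zero : (![1 / 2, 1 / 2] : Fin 2 → ℝ) ≠ 0 := by
  intro h
  have := congrFun h 0
  norm_num at this

theorem eq_half_half_of_sum_diff {ξ : Fin 2 → ℝ} (h : ∀ i, 0 ≤ ξ i ∧ ξ i < 1) {k l : ℤ}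
    (h1 : ξ 0 + ξ 1 = k) (h2 : ξ 0 - ξ 1 = l) : ξ = 0 ∨ ξ = ![1 / 2, 1 / 2] := by
  obtain ⟨h3, h4⟩ := h 0
  obtain ⟨h5, h6⟩ := h 1
  have a1 : (-1 : ℤ) < l := by
    have : (-1 : ℝ) < l := by linarith
    exact_mod_cast this
  have a2 : l < 1 := by
    have : (l : ℝ) < 1 := by linarith
    exact_mod_cast this
  have a3 : (-1 : ℤ) < k := by
    have : (-1 : ℝ) < k := by linarith
    exact_mod_cast this
  have a4 : k < 2 := by
    have : (k : ℝ) < 2 := by linarith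
    exact_mod_cast this
  obtain rfl : l = 0 := by omega
  have a5 : k = 0 ∨ k = 1 := by omega
  push_cast at h2
  rcases a5 with rfl | rfl <;> push_cast at h1
  · left; funext i; fin_cases i <;> simp <;> linarith
  · right; funext i; fin_cases i <;> simp <;> linarith

theorem mem_dualNodes_quincunxM (ξ : Fin 2 → ℝ) :
    ξ ∈ dualNodes quincunxM ↔ ξ = 0 ∨ ξ = ![1 / 2, 1 / 2] := by
  constructor
  · rintro ⟨h, k, hk⟩
    have h1 := congrFun hk 0
    have h2 := congrFun hk 1
    simp [quincunxM, Matrix.mulVec, dotProduct] at h1 h2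
    exact eq_half_half_of_sum_diff h h1 (by linarith : ξ 0 - ξ 1 = k 1)
  · rintro (rfl | rfl)
    · exact ⟨by simp, 0, by funext i; simp⟩
    · refine ⟨fun i => by fin_cases i <;> norm_num, ![1, 0], ?_⟩
      funext i
      fin_cases i <;> simp [quincunxM, Matrix.mulVec, dotProduct]
      norm_num

theorem mem_dualNodes_quincunxN (ξ : Fin 2 → ℝ) :
    ξ ∈ dualNodes quincunxN ↔ ξ = 0 ∨ ξ = ![1 / 2, 1 / 2] := by
  constructor
  · rintro ⟨h, k, hk⟩
    have h1 := congrFun hk 0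
    have h2 := congrFun hk 1
    simp [quincunxN, Matrix.mulVec, dotProduct] at h1 h2
    refine eq_half_half_of_sum_diff h h1 (?_ : ξ 0 - ξ 1 = (-(k 1) : ℤ))
    push_cast
    linarith
  · rintro (rfl | rfl)
    · exact ⟨by simp, 0, by funext i; simp⟩
    · refine ⟨fun i => by fin_cases i <;> norm_num, ![1, 0], ?_⟩
      funext i
      fin_cases i <;> simp [quincunxN, Matrix.mulVec, dotProduct]
      norm_num

theorem dualNodes_quincunx_eq : dualNodes quincunxM = dualNodes quincunxN := by
  ext ξ
  rw [mem_dualNodes_quincunxM, mem_dualNodes_quincunxN]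

theorem sumRuleOrder_quincunx_eq (a : Filt 2) :
    sumRuleOrder a quincunxM = sumRuleOrder a quincunxN := by
  simp only [sumRuleOrder, HasSumRules, dualNodes_quincunx_eq]

theorem freqShift_half_half (ω : Fin 2 → ℝ) :
    freqShift ω ![1 / 2, 1 / 2] = fun i => ω i + Real.pi := by
  funext i; fin_cases i <;> simp [freqShift] <;> ring

theorem tendsto_apply_zero {d : ℕ} (i : Fin d) :
    Tendsto (fun ω : Fin d → ℝ => ω i) (𝓝 0) (𝓝 0) := (continuous_apply i).tendsto 0

theorem hasSumRules_lowpass2D {a : Filt 1} {m : ℕ} (h : HasSumRules a dil2 m) :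
    HasSumRules (lowpass2D a) quincunxM (2 * m) := by
  obtain ⟨h0, C, hC⟩ := (hasSumRules_dil2_iff a m).mp h
  have hz : (![0] : Fin 1 → ℝ) = 0 := by funext i; fin_cases i; rfl
  refine ⟨by rw [symbol_lowpass2D]; simp only [Pi.zero_apply, hz, h0, mul_one], ?_⟩
  intro ξ hξ hξ0
  obtain rfl : ξ = ![1 / 2, 1 / 2] := ((mem_dualNodes_quincunxM ξ).mp hξ).resolve_left hξ0
  refine IsBigO.of_bound (|C| * |C|) ?_
  filter_upwards [(tendsto_apply_zero (0 : Fin 2)).eventually hC,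
    (tendsto_apply_zero (1 : Fin 2)).eventually hC] with ω h1 h2
  rw [freqShift_half_half, symbol_lowpass2D, norm_mul, norm_pow, norm_norm, two_mul, pow_add]
  have hb : ∀ i : Fin 2, amp a (ω i + Real.pi) ≤ C * |ω i| ^ m →
      amp a (ω i + Real.pi) ≤ |C| * ‖ω‖ ^ m := by
    intro i hi
    refine hi.trans ?_
    have h3 : |ω i| ≤ ‖ω‖ := norm_le_pi_norm ω i
    have h4 := le_abs_self C
    gcongr
  calc _ ≤ (|C| * ‖ω‖ ^ m) * (|C| * ‖ω‖ ^ m) :=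
        mul_le_mul (hb 0 h1) (hb 1 h2) (amp_nonneg _ _) (by positivity)
    _ = _ := by ring

/-- Restricting to the diagonal recovers sum rules of the one-dimensional filter. -/
theorem HasSumRules.of_lowpass2D {a : Filt 1} (h0 : symbol a 0 = 1) {k : ℕ}
    (h : HasSumRules (lowpass2D a) quincunxM k) : HasSumRules a dil2 (k / 2) := by
  refine (hasSumRules_dil2_iff a _).mpr ⟨h0, ?_⟩
  obtain ⟨C, hC⟩ :=
    (h.2 _ ((mem_dualNodes_quincunxM _).mpr (Or.inr rfl)) half_half_ne_zero).bound
  have ht : Tendsto (fun t : ℝ => (![t, t] : Fin 2 → ℝ)) (𝓝 0) (𝓝 0) := by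
    refine tendsto_pi_nhds.mpr fun i => ?_
    fin_cases i <;> exact tendsto_id
  have hone : ∀ᶠ t in 𝓝 (0 : ℝ), |t| ≤ 1 := by
    filter_upwards [Metric.closedBall_mem_nhds (0 : ℝ) one_pos] with t ht
    simpa using ht
  refine ⟨Real.sqrt |C|, ?_⟩
  filter_upwards [ht.eventually hC, hone] with t hC h1
  rw [freqShift_half_half, symbol_lowpass2D, norm_mul, norm_pow, norm_norm] at hC
  have hn : ‖(![t, t] : Fin 2 → ℝ)‖ = |t| := by
    have : (![t, t] : Fin 2 → ℝ) = fun _ => t := by funext i; fin_cases i <;> rfl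
    rw [this, pi_norm_const, Real.norm_eq_abs]
  have h2 : amp a (t + Real.pi) * amp a (t + Real.pi) ≤ C * |t| ^ k := by
    rw [hn] at hC; exact hC
  rw [← Real.sqrt_sq (pow_nonneg (abs_nonneg t) (k / 2)), ← Real.sqrt_mul (abs_nonneg C)]
  refine Real.le_sqrt_of_sq_le ?_
  rw [sq]
  refine h2.trans (mul_le_mul (le_abs_self C) ?_ (by positivity) (abs_nonneg C))
  rw [← pow_mul]
  exact pow_le_pow_of_le_one (abs_nonneg t) h1 (by omega)

theorem HasSumRules.of_le {a : Filt 1} {k m : ℕ} (hk : k ≤ m) (h : HasSumRules a dil2 m) :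
    HasSumRules a dil2 k := by
  rw [hasSumRules_dil2_iff] at *
  obtain ⟨h0, C, hC⟩ := h
  refine ⟨h0, |C|, ?_⟩
  have hone : ∀ᶠ t in 𝓝 (0 : ℝ), |t| ≤ 1 := by
    filter_upwards [Metric.closedBall_mem_nhds (0 : ℝ) one_pos] with t ht
    simpa using ht
  filter_upwards [hC, hone] with t hC h1
  refine hC.trans (mul_le_mul (le_abs_self C) ?_ (by positivity) (abs_nonneg C))
  exact pow_le_pow_of_le_one (abs_nonneg t) h1 hk

/-- A positive value of the sum rule order is attained, and is the largest order. -/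
theorem sumRuleOrder_spec {d : ℕ} {a : Filt d} {M : Matrix (Fin d) (Fin d) ℤ} {m : ℕ}
    (hm : m ≠ 0) (h : sumRuleOrder a M = m) :
    HasSumRules a M m ∧ ∀ k, HasSumRules a M k → k ≤ m := by
  have hb : BddAbove {m | HasSumRules a M m} := by
    by_contra hb
    rw [sumRuleOrder, Nat.sSup_of_not_bddAbove hb] at h
    exact hm h.symm
  have hne : {m | HasSumRules a M m}.Nonempty := by
    by_contra hne
    rw [Set.not_nonempty_iff_eq_empty] at hne
    rw [sumRuleOrder, hne] at h
    simp at h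
    exact hm h.symm
  rw [← h]
  exact ⟨Nat.sSup_mem hne hb, fun k hk => le_csSup hb hk⟩

theorem two_mul_le_sumRuleOrder_lowpass2D {a : Filt 1} {m : ℕ} (hm : m ≠ 0)
    (h : sumRuleOrder a dil2 = m) : 2 * m ≤ sumRuleOrder (lowpass2D a) quincunxM := by
  obtain ⟨h1, h2⟩ := sumRuleOrder_spec hm h
  refine le_csSup ⟨2 * m + 1, fun k hk => ?_⟩ (hasSumRules_lowpass2D h1)
  have := h2 _ (HasSumRules.of_lowpass2D h1.1 hk)
  omega

theorem hasVanishingMoments_of_le_amp {a : Filt 1} {m n : ℕ} (h : HasSumRules a dil2 m)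
    (hn : n ≤ m) {b : Filt 2} (i : Fin 2)
    (hb : ∀ ω : Fin 2 → ℝ, ‖symbol b ω‖ ≤ amp a (ω i + Real.pi)) : HasVanishingMoments b n := by
  obtain ⟨h0, C, hC⟩ := (hasSumRules_dil2_iff a n).mp (h.of_le hn)
  refine IsBigO.of_bound |C| ?_
  filter_upwards [(tendsto_apply_zero i).eventually hC] with ω h1
  refine (hb ω).trans (h1.trans ?_)
  rw [norm_pow, norm_norm]
  have h3 : |ω i| ≤ ‖ω‖ := norm_le_pi_norm ω i
  have h4 := le_abs_self C
  gcongr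

/-! ### Smoothness of the quincunx filters -/

theorem smoothness_quincunx_eq {a : Filt 1} (h : IsSymmetricHalf a) :
    smoothness (lowpass2D a) quincunxM = smoothness (lowpass2D a) quincunxN := by
  rw [smoothness, smoothness, sumRuleOrder_quincunx_eq, rho_quincunx_eq h, det_quincunxM,
    det_quincunxN]
  norm_num

theorem smoothness_dil2 (a : Filt 1) :
    smoothness a dil2 = 1 / 2 - Real.logb 2 (rho (sumRuleOrder a dil2) a dil2) := by
  rw [smoothness, det_dil2]
  norm_num

theorem two_mul_smoothness_le {a : Filt 1} (h : IsOrthonormalFilter a dil2) {m : ℕ} (hm : m ≠ 0)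
    (hsr : sumRuleOrder a dil2 = m) :
    2 * smoothness a dil2 ≤ smoothness (lowpass2D a) quincunxM := by
  have h0 := (sumRuleOrder_spec hm hsr).1.1
  have hle := two_mul_le_sumRuleOrder_lowpass2D hm hsr
  obtain ⟨h1, h2⟩ := rho_quincunxM h h0 hle
  rw [smoothness_dil2, smoothness, det_quincunxM, hsr]
  have h3 := Real.logb_le_logb_of_le (b := 2) (by norm_num) h1 h2
  norm_num
  linarith

/-! ### The filter bank -/

theorem IsCanonicalPair.norm_symbol {a b : Filt 2} (h : IsCanonicalPair a b) (ω : Fin 2 → ℝ) :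
    ‖symbol b ω‖ = ‖symbol a fun i => ω i + Real.pi‖ := by
  rw [h ω, norm_mul, RCLike.norm_conj]
  have : -Complex.I * (ω 0 : ℂ) = ((-(ω 0) : ℝ) : ℂ) * Complex.I := by push_cast; ring
  rw [this, Complex.norm_exp_ofReal_mul_I, one_mul]

theorem symbol_two_add_two_pi (a : Filt 2) (ω : Fin 2 → ℝ) :
    symbol a (fun i => ω i + Real.pi + Real.pi) = symbol a ω := by
  simp only [symbol]
  refine Finsupp.sum_congr fun k _ => ?_
  congr 1
  rw [Complex.exp_eq_exp_iff_exists_int]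
  refine ⟨-(k 0 + k 1), ?_⟩
  simp [Fin.sum_univ_two]
  ring

/-- A canonical pair satisfies the aliasing cancellation at the frequency `(π, π)`. -/
theorem IsCanonicalPair.cancel {a b : Filt 2} (h : IsCanonicalPair a b) (ω : Fin 2 → ℝ) :
    (starRingEnd ℂ) (symbol a ω) * symbol a (fun i => ω i + Real.pi) +
      (starRingEnd ℂ) (symbol b ω) * symbol b (fun i => ω i + Real.pi) = 0 := by
  rw [h ω, h fun i => ω i + Real.pi, symbol_two_add_two_pi, map_mul, Complex.conj_conj,
    ← Complex.exp_conj]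
  have h1 : (starRingEnd ℂ) (-Complex.I * (ω 0 : ℂ)) = Complex.I * (ω 0 : ℂ) := by simp
  have h2 : Complex.exp (-Complex.I * ((ω 0 + Real.pi : ℝ) : ℂ)) =
      -Complex.exp (-Complex.I * (ω 0 : ℂ)) := by
    rw [Complex.ofReal_add, mul_add, Complex.exp_add]
    have : Complex.exp (-Complex.I * (Real.pi : ℂ)) = -1 := by
      rw [neg_mul, mul_comm, Complex.exp_neg, Complex.exp_pi_mul_I]; norm_num
    rw [this]; ring
  have h3 : Complex.exp (Complex.I * (ω 0 : ℂ)) * Complex.exp (-Complex.I * (ω 0 : ℂ)) = 1 := by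
    rw [← Complex.exp_add]; simp
  rw [h1, h2]
  linear_combination (-(symbol a fun i => ω i + Real.pi) * (starRingEnd ℂ) (symbol a ω)) * h3

theorem amp_add_two_pi (a : Filt 1) (t : ℝ) : amp a (t + Real.pi + Real.pi) = amp a t := by
  rw [amp, symbol_add_two_pi, amp]

theorem norm_symbol_lowpass2D (a : Filt 1) (ω : Fin 2 → ℝ) :
    ‖symbol (lowpass2D a) ω‖ = amp a (ω 0) * amp a (ω 1) := by
  rw [symbol_lowpass2D, norm_mul, amp, amp]

theorem norm_symbol_highpass1 (a : Filt 1) (ω : Fin 2 → ℝ) :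
    ‖symbol (highpass1 a) ω‖ = amp a (ω 0 + Real.pi) * amp a (ω 1 + Real.pi) := by
  rw [highpass1, IsCanonicalPair.norm_symbol (isCanonicalPair_canonicalFilter _),
    norm_symbol_lowpass2D]

theorem norm_symbol_highpass2 (a : Filt 1) (ω : Fin 2 → ℝ) :
    ‖symbol (highpass2 a) ω‖ = amp a (ω 0) * amp a (ω 1 + Real.pi) := by
  rw [symbol_highpass2, norm_mul, amp, amp]

theorem norm_symbol_highpass3 (a : Filt 1) (ω : Fin 2 → ℝ) :
    ‖symbol (highpass3 a) ω‖ = amp a (ω 0 + Real.pi) * amp a (ω 1) := by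
  rw [highpass3, IsCanonicalPair.norm_symbol (isCanonicalPair_canonicalFilter _),
    norm_symbol_highpass2, amp_add_two_pi]

theorem isDoubleCanonical_of_orthonormal {a : Filt 1} (h : IsOrthonormalFilter a dil2) :
    IsDoubleCanonical (lowpass2D a) (highpass1 a) (highpass2 a) (highpass3 a) := by
  have c1 : IsCanonicalPair (lowpass2D a) (highpass1 a) := isCanonicalPair_canonicalFilter _
  have c2 : IsCanonicalPair (highpass2 a) (highpass3 a) := isCanonicalPair_canonicalFilter _
  refine ⟨⟨fun ω => ?_, fun ξ hξ hξ0 ω => ?_⟩, c1, c2⟩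
  · rw [isOrthonormalFilter_dil2_iff] at h
    simp only [Fin.sum_univ_three, Matrix.cons_val_zero, Matrix.cons_val_one, Matrix.cons_val]
    rw [norm_symbol_lowpass2D, norm_symbol_highpass1, norm_symbol_highpass2,
      norm_symbol_highpass3]
    linear_combination (amp a (ω 1) ^ 2 + amp a (ω 1 + Real.pi) ^ 2) * h (ω 0) + h (ω 1)
  · obtain rfl : ξ = ![1 / 2, 1 / 2] := ((mem_dualNodes_quincunxM ξ).mp hξ).resolve_left hξ0
    simp only [Fin.sum_univ_three, Matrix.cons_val_zero, Matrix.cons_val_one, Matrix.cons_val,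
      freqShift_half_half]
    linear_combination c1.cancel ω + c2.cancel ω

/-! ### Coefficients and symmetry -/

theorem tensor_apply (u v : Filt 1) (k : Fin 2 → ℤ) : tensor u v k = u ![k 0] * v ![k 1] := by
  have h1 : ∀ (w : Filt 1) (n : ℤ) (F : ℂ → ℂ), F 0 = 0 →
      (w.sum fun l y => if l 0 = n then F y else 0) = F (w ![n]) := by
    intro w n F hF
    rw [Finsupp.sum, Finset.sum_eq_single ![n]]
    · simp
    · intro l _ hl
      refine if_neg fun h => hl ?_
      rw [eq_vec_one l, h]
    · intro hn
      rw [Finsupp.notMem_support_iff.mp hn, hF]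
      simp
  have h2 : ∀ (l₁ l₂ : Fin 1 → ℤ) (z : ℂ), (Finsupp.single ![l₁ 0, l₂ 0] z : Filt 2) k =
      if l₁ 0 = k 0 then (if l₂ 0 = k 1 then z else 0) else 0 := by
    intro l₁ l₂ z
    rw [Finsupp.single_apply]
    have : (![l₁ 0, l₂ 0] = k) ↔ l₁ 0 = k 0 ∧ l₂ 0 = k 1 := by
      constructor
      · rintro rfl; exact ⟨rfl, rfl⟩
      · rintro ⟨h, h'⟩; funext i; fin_cases i; exacts [h, h']
    simp only [this, ite_and]
  simp only [tensor, Finsupp.sum_apply, h2]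
  have h3 : ∀ (l₁ : Fin 1 → ℤ) (x : ℂ), (v.sum fun l₂ y =>
      if l₁ 0 = k 0 then (if l₂ 0 = k 1 then x * y else 0) else 0) =
      if l₁ 0 = k 0 then x * v ![k 1] else 0 := by
    intro l₁ x
    split_ifs
    · exact h1 v (k 1) (fun y => x * y) (by simp)
    · simp
  simp only [h3]
  exact h1 u (k 0) (fun x => x * v ![k 1]) (by simp)

theorem finsuppSum_single_apply {d : ℕ} (a : Filt d) (g : (Fin d → ℤ) → Fin d → ℤ)
    (hg : Function.Involutive g) (F : (Fin d → ℤ) → ℂ → ℂ) (hF : ∀ k, F k 0 = 0)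
    (l : Fin d → ℤ) :
    (a.sum fun k x => Finsupp.single (g k) (F k x) : Filt d) l = F (g l) (a (g l)) := by
  rw [Finsupp.sum_apply, Finsupp.sum, Finset.sum_eq_single (g l)]
  · rw [hg l, Finsupp.single_eq_same]
  · intro k _ hk
    refine Finsupp.single_eq_of_ne fun h => hk ?_
    rw [h, hg k]
  · intro hn
    rw [Finsupp.notMem_support_iff.mp hn, hF, Finsupp.single_zero, Finsupp.zero_apply]

theorem modulate_apply (a : Filt 1) (k : Fin 1 → ℤ) : modulate a k = (-1 : ℂ) ^ (k 0) * a k :=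
  finsuppSum_single_apply a id (fun _ => rfl) (fun k x => (-1 : ℂ) ^ (k 0) * x) (by simp) k

theorem canonicalFilter_apply (a : Filt 2) (k : Fin 2 → ℤ) :
    canonicalFilter a k =
      (-1 : ℂ) ^ (1 - k 0 + -k 1) * (starRingEnd ℂ) (a ![1 - k 0, -k 1]) := by
  refine finsuppSum_single_apply a (fun k => ![1 - k 0, -k 1]) (fun k => ?_)
    (fun k x => (-1 : ℂ) ^ (k 0 + k 1) * (starRingEnd ℂ) x) (by simp) k
  funext i
  fin_cases i <;> simp

theorem neg_one_zpow_congr {p q : ℤ} (h : (p - q) % 2 = 0) : (-1 : ℂ) ^ p = (-1) ^ q := by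
  obtain ⟨w, hw⟩ : ∃ w, p = q + 2 * w := ⟨(p - q) / 2, by omega⟩
  rw [hw, zpow_add₀ (by norm_num), zpow_mul]
  norm_num

theorem neg_one_zpow_congr_neg {p q : ℤ} (h : (p - q) % 2 = 1) :
    (-1 : ℂ) ^ p = -(-1) ^ q := by
  rw [neg_one_zpow_congr (q := q + 1) (by omega), zpow_add₀ (by norm_num)]
  simp

theorem affine_map_eq_of_coord {E : Matrix (Fin 2) (Fin 2) ℤ} {k l : Fin 2 → ℤ} {c₀ c₁ : ℝ}
    (h0 : (l 0 : ℝ) = E 0 0 * (k 0 - c₀) + E 0 1 * (k 1 - c₁) + c₀)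
    (h1 : (l 1 : ℝ) = E 1 0 * (k 0 - c₀) + E 1 1 * (k 1 - c₁) + c₁) :
    (fun i => (l i : ℝ)) =
      (E.map (Int.cast : ℤ → ℝ)).mulVec ((fun i => (k i : ℝ)) - ![c₀, c₁]) + ![c₀, c₁] := by
  funext i
  rw [Pi.add_apply, Matrix.mulVec, dotProduct, Fin.sum_univ_two]
  fin_cases i
  · exact h0
  · exact h1

theorem isSymmetricAbout_lowpass2D {a : Filt 1} (h : IsSymmetricHalf a) :
    IsSymmetricAbout groupD4 ![1 / 2, 1 / 2] (fun _ => 1) (lowpass2D a) := by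
  intro E hE k
  have h0 := h (k 0)
  have h1 := h (k 1)
  simp only [lowpass2D, tensor_apply, Int.cast_one, one_mul]
  rcases hE with rfl | rfl | rfl | rfl | rfl | rfl | rfl | rfl
  · exact ⟨![k 0, k 1], affine_map_eq_of_coord (by simp) (by simp), rfl⟩
  · exact ⟨![1 - k 0, 1 - k 1], affine_map_eq_of_coord (by simp; ring) (by simp; ring),
      by simp [h0, h1]⟩
  · exact ⟨![k 0, 1 - k 1], affine_map_eq_of_coord (by simp) (by simp; ring), by simp [h1]⟩
  · exact ⟨![1 - k 0, k 1], affine_map_eq_of_coord (by simp; ring) (by simp), by simp [h0]⟩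
  · exact ⟨![k 1, k 0], affine_map_eq_of_coord (by simp) (by simp), by simp [mul_comm]⟩
  · exact ⟨![1 - k 1, 1 - k 0], affine_map_eq_of_coord (by simp; ring) (by simp; ring),
      by simp [h0, h1, mul_comm]⟩
  · exact ⟨![k 1, 1 - k 0], affine_map_eq_of_coord (by simp) (by simp; ring),
      by simp [h0, mul_comm]⟩
  · exact ⟨![1 - k 1, k 0], affine_map_eq_of_coord (by simp; ring) (by simp),
      by simp [h1, mul_comm]⟩

theorem highpass1_apply (a : Filt 1) (k : Fin 2 → ℤ) :
    highpass1 a k = (-1 : ℂ) ^ (1 - k 0 + -k 1) *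
      ((starRingEnd ℂ) (a ![1 - k 0]) * (starRingEnd ℂ) (a ![-k 1])) := by
  rw [highpass1, canonicalFilter_apply, lowpass2D, tensor_apply, map_mul]
  rfl

theorem highpass2_apply (a : Filt 1) (k : Fin 2 → ℤ) :
    highpass2 a k = (-1 : ℂ) ^ (k 1) * (a ![k 0] * a ![k 1]) := by
  rw [highpass2, tensor_apply, modulate_apply]
  simp only [Matrix.cons_val_zero]
  ring

theorem highpass3_apply (a : Filt 1) (k : Fin 2 → ℤ) :
    highpass3 a k = (-1 : ℂ) ^ (1 - k 0) *
      ((starRingEnd ℂ) (a ![1 - k 0]) * (starRingEnd ℂ) (a ![-k 1])) := by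
  have hc : (starRingEnd ℂ) ((-1 : ℂ) ^ (-k 1)) = (-1) ^ (-k 1) := by
    rw [map_zpow₀, map_neg, map_one]
  have hs : (-1 : ℂ) ^ (1 - k 0 + -k 1) * (-1) ^ (-k 1) = (-1) ^ (1 - k 0) := by
    rw [← zpow_add₀ (by norm_num)]
    exact neg_one_zpow_congr (by omega)
  rw [highpass3, canonicalFilter_apply, highpass2_apply]
  simp only [Matrix.cons_val_zero, Matrix.cons_val_one, map_mul]
  rw [hc, ← mul_assoc, hs]

theorem isSymmetricAbout_highpass1 {a : Filt 1} (h : IsSymmetricHalf a) :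
    IsSymmetricAbout groupD4 ![1 / 2, -1 / 2]
      (fun E => E 0 0 * E 1 1 + E 0 1 * E 1 0) (highpass1 a) := by
  intro E hE k
  have h0 := h (k 0)
  have h1 : a ![1 + k 1] = a ![-k 1] := by
    have := h (-k 1)
    rwa [sub_neg_eq_add] at this
  simp only [highpass1_apply]
  rcases hE with rfl | rfl | rfl | rfl | rfl | rfl | rfl | rfl
  · refine ⟨![k 0, k 1], affine_map_eq_of_coord (by simp) (by simp), ?_⟩
    simp
  · refine ⟨![1 - k 0, -1 - k 1], affine_map_eq_of_coord (by simp; ring) (by simp; ring), ?_⟩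
    have e : (-1 : ℂ) ^ (1 - (1 - k 0) + -(-1 - k 1)) = (-1) ^ (1 - k 0 + -k 1) :=
      neg_one_zpow_congr (by omega)
    have e1 : -(-1 - k 1) = 1 + k 1 := by ring
    have e2 : 1 - (1 - k 0) = k 0 := by ring
    simp only [Matrix.cons_val_zero, Matrix.cons_val_one, e]
    simp [e1, e2, h0, h1]
  · refine ⟨![k 0, -1 - k 1], affine_map_eq_of_coord (by simp) (by simp; ring), ?_⟩
    have e : (-1 : ℂ) ^ (1 - k 0 + -(-1 - k 1)) = -(-1) ^ (1 - k 0 + -k 1) :=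
      neg_one_zpow_congr_neg (by omega)
    have e1 : -(-1 - k 1) = 1 + k 1 := by ring
    simp only [Matrix.cons_val_zero, Matrix.cons_val_one, e]
    simp [e1, h1]
  · refine ⟨![1 - k 0, k 1], affine_map_eq_of_coord (by simp; ring) (by simp), ?_⟩
    have e : (-1 : ℂ) ^ (1 - (1 - k 0) + -k 1) = -(-1) ^ (1 - k 0 + -k 1) :=
      neg_one_zpow_congr_neg (by omega)
    have e2 : 1 - (1 - k 0) = k 0 := by ring
    simp only [Matrix.cons_val_zero, Matrix.cons_val_one, e]
    simp [e2, h0]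
  · refine ⟨![1 + k 1, k 0 - 1], affine_map_eq_of_coord (by simp; ring) (by simp; ring), ?_⟩
    have e : (-1 : ℂ) ^ (1 - (1 + k 1) + -(k 0 - 1)) = (-1) ^ (1 - k 0 + -k 1) :=
      neg_one_zpow_congr (by omega)
    have e1 : 1 - (1 + k 1) = -k 1 := by ring
    have e2 : -(k 0 - 1) = 1 - k 0 := by ring
    simp only [Matrix.cons_val_zero, Matrix.cons_val_one, e]
    simp [e1, mul_comm]
  · refine ⟨![-k 1, -k 0], affine_map_eq_of_coord (by simp; ring) (by simp; ring), ?_⟩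
    have e : (-1 : ℂ) ^ (1 - -k 1 + -(-k 0)) = (-1) ^ (1 - k 0 + -k 1) :=
      neg_one_zpow_congr (by omega)
    simp only [Matrix.cons_val_zero, Matrix.cons_val_one, e]
    simp [h0, h1, mul_comm]
  · refine ⟨![1 + k 1, -k 0], affine_map_eq_of_coord (by simp; ring) (by simp; ring), ?_⟩
    have e : (-1 : ℂ) ^ (1 - (1 + k 1) + -(-k 0)) = -(-1) ^ (1 - k 0 + -k 1) :=
      neg_one_zpow_congr_neg (by omega)
    have e1 : 1 - (1 + k 1) = -k 1 := by ring
    simp only [Matrix.cons_val_zero, Matrix.cons_val_one, e]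
    simp [e1, h0, mul_comm]
  · refine ⟨![-k 1, k 0 - 1], affine_map_eq_of_coord (by simp; ring) (by simp; ring), ?_⟩
    have e : (-1 : ℂ) ^ (1 - -k 1 + -(k 0 - 1)) = -(-1) ^ (1 - k 0 + -k 1) :=
      neg_one_zpow_congr_neg (by omega)
    simp only [Matrix.cons_val_zero, Matrix.cons_val_one, e]
    simp [h1, mul_comm]

theorem isSymmetricAbout_highpass2 {a : Filt 1} (h : IsSymmetricHalf a) :
    IsSymmetricAbout groupD4plus ![1 / 2, 1 / 2] (fun E => E 1 1) (highpass2 a) := by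
  intro E hE k
  have h0 := h (k 0)
  have h1 := h (k 1)
  have e : (-1 : ℂ) ^ (1 - k 1) = -(-1) ^ (k 1) := neg_one_zpow_congr_neg (by omega)
  simp only [highpass2_apply]
  rcases hE with rfl | rfl | rfl | rfl
  · exact ⟨![k 0, k 1], affine_map_eq_of_coord (by simp) (by simp), by simp⟩
  · exact ⟨![1 - k 0, 1 - k 1], affine_map_eq_of_coord (by simp; ring) (by simp; ring),
      by simp [h0, h1, e]⟩
  · exact ⟨![k 0, 1 - k 1], affine_map_eq_of_coord (by simp) (by simp; ring), by simp [h1, e]⟩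
  · exact ⟨![1 - k 0, k 1], affine_map_eq_of_coord (by simp; ring) (by simp), by simp [h0]⟩

theorem isSymmetricAbout_highpass3 {a : Filt 1} (h : IsSymmetricHalf a) :
    IsSymmetricAbout groupD4plus ![1 / 2, -1 / 2] (fun E => E 0 0) (highpass3 a) := by
  intro E hE k
  have h0 := h (k 0)
  have h1 : a ![k 1 + 1] = a ![-k 1] := by
    have := h (-k 1)
    rwa [sub_neg_eq_add, add_comm] at this
  have e : (-1 : ℂ) ^ (k 0) = -(-1) ^ (1 - k 0) := neg_one_zpow_congr_neg (by omega)
  simp only [highpass3_apply]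
  rcases hE with rfl | rfl | rfl | rfl
  · exact ⟨![k 0, k 1], affine_map_eq_of_coord (by simp) (by simp), by simp⟩
  · exact ⟨![1 - k 0, -1 - k 1], affine_map_eq_of_coord (by simp; ring) (by simp; ring),
      by simp [h0, h1, e]⟩
  · exact ⟨![k 0, -1 - k 1], affine_map_eq_of_coord (by simp) (by simp; ring), by simp [h1]⟩
  · exact ⟨![1 - k 0, k 1], affine_map_eq_of_coord (by simp; ring) (by simp), by simp [h0, e]⟩

/-- The quincunx filter bank built from a symmetric orthonormal filter. -/
theorem quincunx_filterBank {n : ℕ} (hn : 1 ≤ n) {a : Filt 1} (hs : IsSymmetricHalf a)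
    (ho : IsOrthonormalFilter a dil2) (hsr : sumRuleOrder a dil2 = 2 * n - 1) :
    IsDoubleCanonical (lowpass2D a) (highpass1 a) (highpass2 a) (highpass3 a) ∧
      IsSymmetricAbout groupD4 ![1 / 2, 1 / 2] (fun _ => 1) (lowpass2D a) ∧
      2 * n ≤ sumRuleOrder (lowpass2D a) quincunxM ∧
      smoothness (lowpass2D a) quincunxM = smoothness (lowpass2D a) quincunxN ∧
      2 * smoothness a dil2 ≤ smoothness (lowpass2D a) quincunxM ∧
      IsSymmetricAbout groupD4 ![1 / 2, -1 / 2]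
        (fun E => E 0 0 * E 1 1 + E 0 1 * E 1 0) (highpass1 a) ∧
      IsSymmetricAbout groupD4plus ![1 / 2, 1 / 2] (fun E => E 1 1) (highpass2 a) ∧
      IsSymmetricAbout groupD4plus ![1 / 2, -1 / 2] (fun E => E 0 0) (highpass3 a) ∧
      HasVanishingMoments (highpass1 a) n ∧
      HasVanishingMoments (highpass2 a) n ∧
      HasVanishingMoments (highpass3 a) n := by
  have hm : 2 * n - 1 ≠ 0 := by omega
  have hnm : n ≤ 2 * n - 1 := by omega
  have hsum := (sumRuleOrder_spec hm hsr).1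
  have h0 := amp_nonneg a
  have h1 := amp_le_one ho
  refine ⟨isDoubleCanonical_of_orthonormal ho, isSymmetricAbout_lowpass2D hs, ?_,
    smoothness_quincunx_eq hs, two_mul_smoothness_le ho hm hsr, isSymmetricAbout_highpass1 hs,
    isSymmetricAbout_highpass2 hs, isSymmetricAbout_highpass3 hs, ?_, ?_, ?_⟩
  · have := two_mul_le_sumRuleOrder_lowpass2D hm hsr
    omega
  · refine hasVanishingMoments_of_le_amp hsum hnm 0 fun ω => ?_
    rw [norm_symbol_highpass1]
    exact mul_le_of_le_one_right (h0 _) (h1 _)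
  · refine hasVanishingMoments_of_le_amp hsum hnm 1 fun ω => ?_
    rw [norm_symbol_highpass2]
    exact mul_le_of_le_one_left (h0 _) (h1 _)
  · refine hasVanishingMoments_of_le_amp hsum hnm 0 fun ω => ?_
    rw [norm_symbol_highpass3]
    exact mul_le_of_le_one_right (h0 _) (h1 _)

/-! ### Truncated binomial series -/

/-- The coefficients `(α)_j / j!` of the Taylor series of `(1 - x)^{-α}`. -/
def binCoeff (α : ℝ) (j : ℕ) : ℝ := ∏ i ∈ Finset.range j, (α + i) / (i + 1)

/-- The Taylor polynomial of degree less than `m` of `(1 - x)^{-α}`. -/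
def binSum (α : ℝ) (m : ℕ) (x : ℝ) : ℝ := ∑ j ∈ Finset.range m, binCoeff α j * x ^ j

theorem binCoeff_succ (α : ℝ) (j : ℕ) : (j + 1) * binCoeff α (j + 1) = (α + j) * binCoeff α j := by
  rw [binCoeff, binCoeff, Finset.prod_range_succ]
  field_simp

theorem binCoeff_pos {α : ℝ} (hα : 0 < α) (j : ℕ) : 0 < binCoeff α j :=
  Finset.prod_pos fun _ _ => by positivity

theorem binSum_zero_right (α : ℝ) (p : ℕ) : binSum α (p + 1) 0 = 1 := by
  rw [binSum, Finset.sum_range_succ']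
  simp [binCoeff]

theorem one_le_binSum {α x : ℝ} (hα : 0 < α) (hx : 0 ≤ x) (p : ℕ) : 1 ≤ binSum α (p + 1) x := by
  rw [binSum, Finset.sum_range_succ']
  have : 0 ≤ ∑ k ∈ Finset.range p, binCoeff α (k + 1) * x ^ (k + 1) :=
    Finset.sum_nonneg fun k _ => mul_nonneg (binCoeff_pos hα _).le (by positivity)
  simpa [binCoeff] using this

/-- The truncation of the series solves the differential equation `(1 - x) y' = α y` of
`(1 - x)^{-α}` up to a single monomial. -/
theorem hasDerivAt_binSum (α : ℝ) (m : ℕ) (x : ℝ) :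
    ∃ D, HasDerivAt (binSum α m) D x ∧
      (1 - x) * D = α * binSum α m x - m * binCoeff α m * x ^ (m - 1) := by
  induction m with
  | zero =>
    refine ⟨0, ?_, by simp [binSum]⟩
    have : binSum α 0 = fun _ => 0 := by funext y; simp [binSum]
    rw [this]
    exact hasDerivAt_const x 0
  | succ m ih =>
    obtain ⟨D, hD, h⟩ := ih
    have hsucc : binSum α (m + 1) = fun y => binSum α m y + binCoeff α m * y ^ m := by
      funext y; simp [binSum, Finset.sum_range_succ]
    refine ⟨D + binCoeff α m * (m * x ^ (m - 1)), ?_, ?_⟩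
    · rw [hsucc]
      exact hD.add ((hasDerivAt_pow m x).const_mul _)
    · have hx : (m : ℝ) * (x * x ^ (m - 1)) = m * x ^ m := by
        rcases m with _ | m
        · simp
        · rw [Nat.add_sub_cancel, ← pow_succ']
      have hc := binCoeff_succ α m
      rw [hsucc]
      push_cast
      linear_combination h - binCoeff α m * hx + x ^ m * hc

/-- The polynomial `(1 - x)^{2p+1} P(x)²`, where `P` is the Taylor polynomial of degree `p` of
`(1 - x)^{-(p+1/2)}`. -/
def maxFlat (p : ℕ) (x : ℝ) : ℝ := (1 - x) ^ (2 * p + 1) * binSum (p + 1 / 2) (p + 1) x ^ 2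

theorem hasDerivAt_maxFlat (p : ℕ) (x : ℝ) :
    HasDerivAt (maxFlat p) (-(2 * ((p + 1) * binCoeff (p + 1 / 2) (p + 1)) * x ^ p *
      (1 - x) ^ (2 * p) * binSum (p + 1 / 2) (p + 1) x)) x := by
  obtain ⟨D, hD, h⟩ := hasDerivAt_binSum (p + 1 / 2) (p + 1) x
  have h1 : HasDerivAt (fun y : ℝ => (1 - y) ^ (2 * p + 1))
      (((2 * p + 1 : ℕ) : ℝ) * (1 - x) ^ (2 * p) * (-1)) x := by
    exact ((hasDerivAt_id x).const_sub 1).pow (2 * p + 1)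
  have h2 := h1.mul (hD.pow 2)
  refine h2.congr_deriv ?_
  push_cast at h ⊢
  simp only [Pi.pow_apply, pow_one]
  linear_combination 2 * (1 - x) ^ (2 * p) * binSum (p + 1 / 2) (p + 1) x * h

theorem maxFlat_zero (p : ℕ) : maxFlat p 0 = 1 := by
  rw [maxFlat, binSum_zero_right]; norm_num

theorem maxFlat_one (p : ℕ) : maxFlat p 1 = 0 := by simp [maxFlat]

theorem maxFlat_nonneg {p : ℕ} {x : ℝ} (hx : x ≤ 1) : 0 ≤ maxFlat p x := by
  have : 0 ≤ 1 - x := by linarith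
  rw [maxFlat]; positivity

theorem half_add_pos (p : ℕ) : (0 : ℝ) < p + 1 / 2 := by positivity

theorem binSum_flip_le {p : ℕ} {x : ℝ} (hx : 0 ≤ x) (hx2 : x ≤ 1 / 2) :
    x ^ p * binSum (p + 1 / 2) (p + 1) (1 - x) ≤ (1 - x) ^ p * binSum (p + 1 / 2) (p + 1) x := by
  rw [binSum, binSum, Finset.mul_sum, Finset.mul_sum]
  refine Finset.sum_le_sum fun j hj => ?_
  have hjp : j ≤ p := by simpa [Nat.lt_succ_iff] using hj
  obtain ⟨i, rfl⟩ := Nat.exists_eq_add_of_le hjp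
  have h1 : 0 ≤ 1 - x := by linarith
  have h2 : x ^ i ≤ (1 - x) ^ i := pow_le_pow_left₀ hx (by linarith) i
  have h3 := (binCoeff_pos (half_add_pos (j + i)) j).le
  calc x ^ (j + i) * (binCoeff ((j + i : ℕ) + 1 / 2) j * (1 - x) ^ j)
      = binCoeff ((j + i : ℕ) + 1 / 2) j * (x ^ j * (1 - x) ^ j) * x ^ i := by rw [pow_add]; ring
    _ ≤ binCoeff ((j + i : ℕ) + 1 / 2) j * (x ^ j * (1 - x) ^ j) * (1 - x) ^ i := by gcongr
    _ = _ := by rw [pow_add]; ring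

theorem maxFlat_add_flip_le_of_le_half {p : ℕ} {x : ℝ} (hx : 0 ≤ x) (hx2 : x ≤ 1 / 2) :
    maxFlat p x + maxFlat p (1 - x) ≤ 1 := by
  have hd : ∀ y, HasDerivAt (fun y => maxFlat p y + maxFlat p (1 - y))
      (-(2 * ((p + 1) * binCoeff (p + 1 / 2) (p + 1)) * (y ^ p * (1 - y) ^ p) *
        ((1 - y) ^ p * binSum (p + 1 / 2) (p + 1) y -
          y ^ p * binSum (p + 1 / 2) (p + 1) (1 - y)))) y := by
    intro y
    have h1 := hasDerivAt_maxFlat p y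
    have h2 := (hasDerivAt_maxFlat p (1 - y)).comp y ((hasDerivAt_id y).const_sub 1)
    refine (h1.add h2).congr_deriv ?_
    rw [sub_sub_cancel, two_mul p, pow_add, pow_add]
    ring
  have hanti : AntitoneOn (fun y => maxFlat p y + maxFlat p (1 - y)) (Set.Icc 0 (1 / 2)) := by
    refine antitoneOn_of_deriv_nonpos (convex_Icc _ _)
      (fun y _ => (hd y).continuousAt.continuousWithinAt)
      (fun y _ => (hd y).differentiableAt.differentiableWithinAt) fun y hy => ?_
    rw [interior_Icc] at hy
    rw [(hd y).deriv, neg_nonpos]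
    have h1 : 0 ≤ 1 - y := by linarith [hy.2]
    have h2 := sub_nonneg.mpr (binSum_flip_le (p := p) hy.1.le hy.2.le)
    have h3 := (binCoeff_pos (half_add_pos p) (p + 1)).le
    have h4 := hy.1.le
    positivity
  have := hanti (Set.left_mem_Icc.mpr (by norm_num)) ⟨hx, hx2⟩ hx
  simpa [maxFlat_zero, maxFlat_one] using this

/-- The deficit `1 - B(x) - B(1 - x)` of the real part of the filter is nonnegative. -/
theorem maxFlat_add_flip_le {p : ℕ} {x : ℝ} (hx : 0 ≤ x) (hx1 : x ≤ 1) :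
    maxFlat p x + maxFlat p (1 - x) ≤ 1 := by
  rcases le_total x (1 / 2) with h | h
  · exact maxFlat_add_flip_le_of_le_half hx h
  · have := maxFlat_add_flip_le_of_le_half (p := p) (x := 1 - x) (by linarith) (by linarith)
    rwa [sub_sub_cancel, add_comm] at this

theorem maxFlat_le_one {p : ℕ} {x : ℝ} (hx : 0 ≤ x) (hx1 : x ≤ 1) : maxFlat p x ≤ 1 := by
  have := maxFlat_add_flip_le (p := p) hx hx1
  have := maxFlat_nonneg (p := p) (x := 1 - x) (by linarith)
  linarith

/-- Evaluating at `x = 1/2` bounds the last coefficient. -/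
theorem binCoeff_le_four_pow (p : ℕ) : binCoeff (p + 1 / 2) p ≤ 4 ^ p := by
  have h := maxFlat_add_flip_le (p := p) (x := 1 / 2) (by norm_num) (by norm_num)
  have e : (1 : ℝ) - 1 / 2 = 1 / 2 := by norm_num
  rw [e, maxFlat, e] at h
  set T := binSum (p + 1 / 2) (p + 1) (1 / 2) with hT
  have hle : binCoeff (p + 1 / 2) p * (1 / 2) ^ p ≤ T :=
    Finset.single_le_sum (f := fun j => binCoeff ((p : ℝ) + 1 / 2) j * (1 / 2 : ℝ) ^ j)
      (fun j _ => mul_nonneg (binCoeff_pos (half_add_pos p) j).le (by positivity))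
      (Finset.self_mem_range_succ p)
  have hT0 : 0 ≤ T := (mul_nonneg (binCoeff_pos (half_add_pos p) p).le (by positivity)).trans hle
  have h2 : (1 / 2 : ℝ) ^ p * (1 / 2) ^ p * T ^ 2 ≤ 1 := by
    rw [pow_succ, two_mul, pow_add] at h
    linarith
  have h3 : (1 / 2 : ℝ) ^ p * T ≤ 1 := by
    refine (sq_le_one_iff₀ (by positivity)).mp ?_
    linarith [mul_pow ((1 / 2 : ℝ) ^ p) T 2, sq ((1 / 2 : ℝ) ^ p)]
  have h4 : (4 : ℝ) ^ p * ((1 / 2) ^ p * (1 / 2) ^ p) = 1 := by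
    rw [← mul_pow, ← mul_pow]; norm_num
  calc binCoeff (p + 1 / 2) p
      = 4 ^ p * ((1 / 2) ^ p * (binCoeff (p + 1 / 2) p * (1 / 2) ^ p)) := by
        linear_combination (-binCoeff ((p : ℝ) + 1 / 2) p) * h4
    _ ≤ 4 ^ p * ((1 / 2) ^ p * T) := by gcongr
    _ ≤ 4 ^ p * 1 := by gcongr
    _ = 4 ^ p := mul_one _

theorem binCoeff_last_le (p : ℕ) :
    (p + 1) * binCoeff (p + 1 / 2) (p + 1) ≤ (2 * p + 1) * 4 ^ p := by
  rw [binCoeff_succ]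
  have h1 := binCoeff_le_four_pow p
  have h2 := (binCoeff_pos (half_add_pos p) p).le
  calc ((p : ℝ) + 1 / 2 + p) * binCoeff (p + 1 / 2) p
      ≤ (2 * p + 1) * binCoeff (p + 1 / 2) p := mul_le_mul_of_nonneg_right (by linarith) h2
    _ ≤ _ := by gcongr

theorem one_sub_pow_mul_binSum_le {p : ℕ} {t : ℝ} (ht : 0 ≤ t) (ht2 : t ≤ 1 / 2) :
    (1 - t) ^ p * binSum (p + 1 / 2) (p + 1) t ≤ 2 := by
  have h := maxFlat_le_one (p := p) ht (by linarith)
  rw [maxFlat, pow_succ, two_mul, pow_add] at h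
  set T := binSum (p + 1 / 2) (p + 1) t
  have h1 : ((1 - t) ^ p * T) ^ 2 * (1 - t) ≤ 1 := by
    calc _ = _ := by ring
      _ ≤ 1 := h
  have h2 : ((1 - t) ^ p * T) ^ 2 ≤ 2 := by
    nlinarith [sq_nonneg ((1 - t) ^ p * T)]
  nlinarith

/-- The flatness of `B` at the origin, with an explicit constant. -/
theorem one_sub_maxFlat_le {p : ℕ} {y : ℝ} (hy : 0 ≤ y) (hy2 : y ≤ 1 / 2) :
    1 - maxFlat p y ≤ (4 * p + 2) * (4 * (y * (1 - y))) ^ (p + 1) := by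
  set K := (p + 1) * binCoeff (p + 1 / 2) (p + 1) with hK
  have hK0 : 0 < K := mul_pos (by positivity) (binCoeff_pos (half_add_pos p) _)
  have hd : ∀ t, HasDerivAt (fun t => 1 - maxFlat p t) (2 * K * t ^ p *
      (1 - t) ^ (2 * p) * binSum (p + 1 / 2) (p + 1) t) t := fun t => by
    refine ((hasDerivAt_maxFlat p t).const_sub 1).congr_deriv ?_
    ring
  have hmean := (convex_Icc (0 : ℝ) y).image_sub_le_mul_sub_of_deriv_le
    (f := fun t => 1 - maxFlat p t) (fun t _ => (hd t).continuousAt.continuousWithinAt)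
    (fun t _ => (hd t).differentiableAt.differentiableWithinAt)
    (C := 4 * K * (y * (1 - y)) ^ p) (fun t ht => by
      rw [interior_Icc] at ht
      rw [(hd t).deriv]
      have h0 : 0 ≤ t := ht.1.le
      have h1 : 0 ≤ 1 - t := by linarith [ht.2]
      have h2 := one_sub_pow_mul_binSum_le (p := p) h0 (by linarith [ht.2])
      have h3 : t * (1 - t) ≤ y * (1 - y) := by nlinarith [ht.2]
      have h4 := one_le_binSum (half_add_pos p) h0 p
      have h5 : 0 ≤ y * (1 - y) := mul_nonneg hy (by linarith)
      calc 2 * K * t ^ p * (1 - t) ^ (2 * p) * binSum (p + 1 / 2) (p + 1) t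
          = 2 * K * (t * (1 - t)) ^ p * ((1 - t) ^ p * binSum (p + 1 / 2) (p + 1) t) := by
            rw [mul_pow, two_mul p, pow_add]; ring
        _ ≤ 2 * K * (y * (1 - y)) ^ p * 2 := by gcongr
        _ = _ := by ring)
    0 (Set.left_mem_Icc.mpr hy) y (Set.right_mem_Icc.mpr hy) hy
  rw [maxFlat_zero] at hmean
  have hyy : 0 ≤ y * (1 - y) := mul_nonneg hy (by linarith)
  have hle : y ≤ 2 * (y * (1 - y)) := by nlinarith
  have hKle : K ≤ (2 * p + 1) * 4 ^ p := binCoeff_last_le p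
  calc 1 - maxFlat p y ≤ 4 * K * (y * (1 - y)) ^ p * y := by linarith
    _ ≤ 4 * ((2 * p + 1) * 4 ^ p) * (y * (1 - y)) ^ p * (2 * (y * (1 - y))) := by gcongr
    _ = _ := by rw [mul_pow 4, pow_succ, pow_succ]; ring

/-- The order of flatness of `B` at the origin is exact. -/
theorem exists_le_one_sub_maxFlat (p : ℕ) :
    ∃ κ : ℝ, 0 < κ ∧ ∀ y, 0 ≤ y → y ≤ 1 / 2 → κ * y ^ (p + 1) ≤ 1 - maxFlat p y := by
  set K := (p + 1) * binCoeff (p + 1 / 2) (p + 1) with hK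
  have hK0 : 0 < K := mul_pos (by positivity) (binCoeff_pos (half_add_pos p) _)
  refine ⟨2 * K * (1 / 2) ^ (2 * p) / (p + 1), by positivity, fun y hy hy2 => ?_⟩
  set κ := 2 * K * (1 / 2) ^ (2 * p) / (p + 1) with hκ
  have hd : ∀ t, HasDerivAt (fun t => 1 - maxFlat p t - κ * t ^ (p + 1)) (2 * K * t ^ p *
      (1 - t) ^ (2 * p) * binSum (p + 1 / 2) (p + 1) t - κ * (((p + 1 : ℕ) : ℝ) * t ^ p)) t := by
    intro t
    refine (((hasDerivAt_maxFlat p t).const_sub 1).sub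
      ((hasDerivAt_pow (p + 1) t).const_mul κ)).congr_deriv ?_
    rw [Nat.add_sub_cancel]
    ring
  have hmono : MonotoneOn (fun t => 1 - maxFlat p t - κ * t ^ (p + 1)) (Set.Icc 0 (1 / 2)) := by
    refine monotoneOn_of_deriv_nonneg (convex_Icc _ _)
      (fun y _ => (hd y).continuousAt.continuousWithinAt)
      (fun y _ => (hd y).differentiableAt.differentiableWithinAt) fun t ht => ?_
    rw [interior_Icc] at ht
    rw [(hd t).deriv, sub_nonneg]
    have h0 : 0 ≤ t := ht.1.le
    have h1 : 1 / 2 ≤ 1 - t := by linarith [ht.2]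
    have h2 := one_le_binSum (half_add_pos p) h0 p
    calc κ * (((p + 1 : ℕ) : ℝ) * t ^ p) = 2 * K * t ^ p * (1 / 2) ^ (2 * p) * 1 := by
          rw [hκ]; push_cast; field_simp
      _ ≤ 2 * K * t ^ p * (1 - t) ^ (2 * p) * binSum (p + 1 / 2) (p + 1) t := by gcongr
  have := hmono (Set.left_mem_Icc.mpr (by norm_num)) ⟨hy, hy2⟩ hy
  simp only [maxFlat_zero, ne_eq, Nat.succ_ne_zero, not_false_eq_true, zero_pow, mul_zero,
    sub_self] at this
  linarith

/-! ### Real and imaginary parts of a symmetric filter -/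

/-- The real part of a filter. -/
def reFilt (a : Filt 1) : Filt 1 := a.mapRange (fun z => (z.re : ℂ)) (by simp)

/-- The imaginary part of a filter. -/
def imFilt (a : Filt 1) : Filt 1 := a.mapRange (fun z => (z.im : ℂ)) (by simp)

theorem symbol_eq_re_add_im (a : Filt 1) (ω : Fin 1 → ℝ) :
    symbol a ω = symbol (reFilt a) ω + Complex.I * symbol (imFilt a) ω := by
  rw [← symbol_smul, ← symbol_add]
  congr 1
  ext k
  simp only [reFilt, imFilt, Finsupp.add_apply, Finsupp.smul_apply, Finsupp.mapRange_apply,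
    smul_eq_mul]
  rw [mul_comm, Complex.re_add_im]

/-- The real function `S(t) = e^{it/2} ŝ(t)` of the imaginary part `s` of a symmetric filter. -/
def imPart (a : Filt 1) (t : ℝ) : ℝ := (imFilt a).sum fun k x => x.re * Real.cos ((k 0 - 1 / 2) * t)

theorem imPart_neg (a : Filt 1) (t : ℝ) : imPart a (-t) = imPart a t := by
  simp only [imPart]
  refine Finsupp.sum_congr fun k _ => ?_
  rw [mul_neg, Real.cos_neg]

theorem analyticAt_imPart (a : Filt 1) (t : ℝ) : AnalyticAt ℝ (imPart a) t := by
  unfold imPart Finsupp.sum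
  fun_prop

theorem exp_mul_symbol_imFilt {a : Filt 1} (h : IsSymmetricHalf a) (t : ℝ) :
    Complex.exp (Complex.I * (t / 2 : ℝ)) * symbol (imFilt a) ![t] = imPart a t := by
  have hs : IsSymmetricHalf (imFilt a) := fun k => by
    simp only [imFilt, Finsupp.mapRange_apply, h k]
  set z := Complex.exp (Complex.I * (t / 2 : ℝ)) * symbol (imFilt a) ![t] with hz
  have hconj : (starRingEnd ℂ) (symbol (imFilt a) ![t]) = symbol (imFilt a) ![-t] := by
    simp only [symbol, Finsupp.sum, map_sum, map_mul, ← Complex.exp_conj]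
    refine Finset.sum_congr rfl fun k _ => ?_
    simp [imFilt]
  have hreal : (starRingEnd ℂ) z = z := by
    rw [hz, map_mul, hconj, symbol_neg_freq hs, ← mul_assoc, ← Complex.exp_conj, ← Complex.exp_add,
      map_mul, Complex.conj_I, Complex.conj_ofReal]
    congr 2
    push_cast
    ring
  rw [← Complex.conj_eq_iff_re.mp hreal]
  congr 1
  rw [hz, symbol, Finsupp.mul_sum, Finsupp.sum, Complex.re_sum]
  refine Finset.sum_congr rfl fun k _ => ?_
  have e : Complex.exp (Complex.I * (t / 2 : ℝ)) * ((imFilt a) k * Complex.exp (-Complex.I *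
      ((∑ i, (k i : ℝ) * (![t] : Fin 1 → ℝ) i : ℝ) : ℂ))) =
      ((a k).im : ℂ) * Complex.exp (((-((k 0 - 1 / 2) * t) : ℝ) : ℂ) * Complex.I) := by
    rw [mul_left_comm, ← Complex.exp_add]
    simp only [imFilt, Finsupp.mapRange_apply]
    congr 2
    simp
    ring
  rw [e, Complex.re_ofReal_mul, Complex.exp_ofReal_mul_I_re, Real.cos_neg]
  simp [imFilt]

/-! ### The filters with maximally flat real part -/

theorem IsHanFilter.amp_sq {p : ℕ} {a : Filt 1} (h : IsHanFilter (p + 1) a) (t : ℝ) :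
    amp a t ^ 2 = maxFlat p (Real.sin (t / 2) ^ 2) + imPart a t ^ 2 := by
  set R : ℝ := Real.cos (t / 2) ^ (2 * (p + 1) - 1) *
    ∑ j ∈ Finset.range (p + 1),
      (∏ i ∈ Finset.range j, (((p + 1 : ℕ) : ℝ) - 1 / 2 + i) / (i + 1)) *
        Real.sin (t / 2) ^ (2 * j) with hR
  have hre : symbol (reFilt a) ![t] = Complex.exp (-Complex.I * (t / 2 : ℝ)) * (R : ℂ) :=
    h.realPart t
  have hone :
      Complex.exp (Complex.I * (t / 2 : ℝ)) * Complex.exp (-Complex.I * (t / 2 : ℝ)) = 1 := by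
    rw [← Complex.exp_add]; simp
  have h1 : Complex.exp (Complex.I * (t / 2 : ℝ)) * symbol a ![t] =
      (R : ℂ) + (imPart a t : ℂ) * Complex.I := by
    rw [symbol_eq_re_add_im, hre, mul_add, ← mul_assoc, hone, mul_left_comm,
      exp_mul_symbol_imFilt h.symm]
    ring
  have h2 : amp a t = ‖(R : ℂ) + (imPart a t : ℂ) * Complex.I‖ := by
    rw [← h1, norm_mul, mul_comm Complex.I, Complex.norm_exp_ofReal_mul_I, one_mul, amp]
  rw [h2, ← Complex.normSq_eq_norm_sq, Complex.normSq_add_mul_I]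
  congr 1
  have e : (2 * (p + 1) - 1) = 2 * p + 1 := by omega
  have hα : ((p + 1 : ℕ) : ℝ) - 1 / 2 = p + 1 / 2 := by push_cast; ring
  rw [hR, e, hα, maxFlat, binSum, mul_pow, ← pow_mul, mul_comm (2 * p + 1) 2, pow_mul,
    Real.cos_sq']
  simp only [binCoeff, ← pow_mul]

theorem IsHanFilter.maxFlat_le {p : ℕ} {a : Filt 1} (h : IsHanFilter (p + 1) a) (t : ℝ) :
    maxFlat p (Real.sin (t / 2) ^ 2) ≤ amp a t ^ 2 := by
  rw [h.amp_sq]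
  linarith [sq_nonneg (imPart a t)]

/-- Orthonormality turns the flatness of the real part at the origin into decay at `π`. -/
theorem IsHanFilter.amp_sq_le {p : ℕ} {a : Filt 1} (h : IsHanFilter (p + 1) a) (t : ℝ) :
    amp a (t + Real.pi) ^ 2 ≤ 1 - maxFlat p (Real.sin (t / 2) ^ 2) := by
  have h1 := (isOrthonormalFilter_dil2_iff a).mp h.orthonormal t
  linarith [h.maxFlat_le t]

theorem IsHanFilter.amp_sq_le_cos {p : ℕ} {a : Filt 1} (h : IsHanFilter (p + 1) a) (t : ℝ) :
    amp a t ^ 2 ≤ 1 - maxFlat p (Real.cos (t / 2) ^ 2) := by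
  have h1 := h.amp_sq_le (t - Real.pi)
  have e : (t - Real.pi) / 2 = t / 2 - Real.pi / 2 := by ring
  rwa [sub_add_cancel, e, Real.sin_sub_pi_div_two, neg_sq] at h1

theorem sin_half_sq_le (t : ℝ) : Real.sin (t / 2) ^ 2 ≤ t ^ 2 / 4 := by
  have h1 : |Real.sin (t / 2)| ≤ |t / 2| := Real.abs_sin_le_abs
  have := sq_le_sq' (by linarith [abs_nonneg (Real.sin (t / 2)), abs_nonneg (t / 2)]) h1
  rw [sq_abs, sq_abs] at this
  linarith

theorem eventually_abs_le {δ : ℝ} (hδ : 0 < δ) : ∀ᶠ t in 𝓝 (0 : ℝ), |t| ≤ δ := by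
  filter_upwards [Metric.closedBall_mem_nhds (0 : ℝ) hδ] with t ht
  simpa using ht

theorem le_sin_half_sq {t : ℝ} (ht : |t| ≤ 1) : t ^ 2 / 16 ≤ Real.sin (t / 2) ^ 2 := by
  have key : ∀ s : ℝ, 0 ≤ s → s ≤ 1 → s ^ 2 / 16 ≤ Real.sin (s / 2) ^ 2 := by
    intro s hs hs1
    have h1 := Real.mul_le_sin (x := s / 2) (by linarith) (by linarith [Real.pi_gt_three])
    have h2 : s / 4 ≤ 2 / Real.pi * (s / 2) := by
      rw [div_mul_eq_mul_div, le_div_iff₀ Real.pi_pos]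
      nlinarith [Real.pi_lt_four]
    have h3 := pow_le_pow_left₀ (by linarith : 0 ≤ s / 4) (h2.trans h1) 2
    linarith
  have := key |t| (abs_nonneg t) ht
  rcases abs_choice t with h | h <;> rw [h] at this
  · exact this
  · rwa [neg_sq, neg_div, Real.sin_neg, neg_sq] at this

theorem eventually_one_sub_maxFlat_le (p : ℕ) : ∀ᶠ t in 𝓝 (0 : ℝ),
    1 - maxFlat p (Real.sin (t / 2) ^ 2) ≤ (4 * p + 2) * (t ^ 2) ^ (p + 1) := by
  filter_upwards [eventually_abs_le one_pos] with t ht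
  have h1 := sin_half_sq_le t
  have h2 : t ^ 2 ≤ 1 := (sq_le_one_iff_abs_le_one t).mpr ht
  have h3 := sq_nonneg (Real.sin (t / 2))
  refine (one_sub_maxFlat_le h3 (by linarith)).trans ?_
  have h4 : 0 ≤ 1 - Real.sin (t / 2) ^ 2 := by linarith
  have h5 : 4 * (Real.sin (t / 2) ^ 2 * (1 - Real.sin (t / 2) ^ 2)) ≤ t ^ 2 := by nlinarith
  gcongr

theorem IsHanFilter.symbol_zero {p : ℕ} {a : Filt 1} (h : IsHanFilter (p + 1) a) :
    symbol a 0 = 1 := by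
  have hz : (![0] : Fin 1 → ℝ) = 0 := by funext i; fin_cases i; rfl
  have hre : symbol (reFilt a) ![0] = 1 := by
    refine (h.realPart 0).trans ?_
    rw [zero_div, Real.sin_zero, Finset.sum_range_succ']
    simp
  have h1 := h.amp_sq 0
  have h2 := amp_le_one h.orthonormal 0
  rw [zero_div, Real.sin_zero, zero_pow two_ne_zero, maxFlat_zero] at h1
  have h3 : imPart a 0 = 0 := by
    have : imPart a 0 ^ 2 ≤ 0 := by nlinarith [amp_nonneg a 0]
    exact pow_eq_zero_iff two_ne_zero |>.mp (le_antisymm this (sq_nonneg _))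
  have h4 := exp_mul_symbol_imFilt h.symm 0
  rw [h3] at h4
  simp only [zero_div, Complex.ofReal_zero, mul_zero, Complex.exp_zero, one_mul] at h4
  rw [← hz, symbol_eq_re_add_im, hre, h4]
  simp

theorem IsHanFilter.hasSumRules {p : ℕ} {a : Filt 1} (h : IsHanFilter (p + 1) a) :
    HasSumRules a dil2 (p + 1) := by
  refine (hasSumRules_dil2_iff a _).mpr ⟨h.symbol_zero, 4 * p + 2, ?_⟩
  filter_upwards [eventually_one_sub_maxFlat_le p] with t ht
  refine (sq_le_sq₀ (amp_nonneg _ _) (by positivity)).mp ?_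
  refine (h.amp_sq_le t).trans (ht.trans ?_)
  rw [mul_pow, ← sq_abs t, ← pow_mul, ← pow_mul, mul_comm 2]
  gcongr
  nlinarith [(Nat.cast_nonneg p : (0 : ℝ) ≤ p)]

/-- An even analytic function does not vanish to an odd order. -/
theorem even_of_analytic_even {S g : ℝ → ℝ} (hS : ∀ t, S (-t) = S t) {k : ℕ}
    (hg : ContinuousAt g 0) (hg0 : g 0 ≠ 0) (h : ∀ᶠ t in 𝓝 (0 : ℝ), S t = t ^ k * g t) :
    Even k := by
  by_contra hk
  rw [Nat.not_even_iff_odd] at hk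
  have hneg : Tendsto (fun t : ℝ => -t) (𝓝 0) (𝓝 0) := by
    simpa using (continuous_neg (G := ℝ)).tendsto 0
  have h1 : ∀ᶠ t in 𝓝[≠] (0 : ℝ), g t + g (-t) = 0 := by
    filter_upwards [nhdsWithin_le_nhds h, nhdsWithin_le_nhds (hneg.eventually h),
      self_mem_nhdsWithin] with t h1 h2 h3
    have h4 : t ^ k ≠ 0 := pow_ne_zero k h3
    rw [hS, h1, hk.neg_pow] at h2
    have : t ^ k * (g t + g (-t)) = 0 := by linear_combination h2
    exact (mul_eq_zero.mp this).resolve_left h4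
  have hg' : Tendsto g (𝓝 0) (𝓝 (g 0)) := hg
  have h2 : Tendsto (fun t => g t + g (-t)) (𝓝[≠] 0) (𝓝 (g 0 + g 0)) :=
    (hg'.add (hg'.comp hneg)).mono_left nhdsWithin_le_nhds
  have h3 := tendsto_nhds_unique_of_eventuallyEq h2 (tendsto_const_nhds (x := (0 : ℝ))) h1
  exact hg0 (by linarith)

/-- More than `p + 1` sum rules would make the square of the even analytic function `S` vanish
exactly to the order `2 (p + 1)`, which is impossible for odd `p + 1`. -/
theorem IsHanFilter.le_of_hasSumRules {p : ℕ} (hp : Even p) {a : Filt 1}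
    (h : IsHanFilter (p + 1) a) {k : ℕ} (hk : HasSumRules a dil2 k) : k ≤ p + 1 := by
  by_contra hkp
  obtain ⟨-, C, hC⟩ := (hasSumRules_dil2_iff a _).mp (hk.of_le (by omega : p + 2 ≤ k))
  obtain ⟨κ, hκ, hlow⟩ := exists_le_one_sub_maxFlat p
  have hS : ∀ t, imPart a t ^ 2 =
      1 - maxFlat p (Real.sin (t / 2) ^ 2) - amp a (t + Real.pi) ^ 2 := by
    intro t
    have h1 := (isOrthonormalFilter_dil2_iff a).mp h.orthonormal t
    linarith [h.amp_sq t]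
  have hup : ∀ᶠ t in 𝓝 (0 : ℝ), imPart a t ^ 2 ≤ (4 * p + 2) * t ^ (2 * (p + 1)) := by
    filter_upwards [eventually_one_sub_maxFlat_le p] with t ht
    rw [hS, pow_mul]
    linarith [sq_nonneg (amp a (t + Real.pi))]
  have hdown : ∀ᶠ t in 𝓝 (0 : ℝ),
      (κ / 16 ^ (p + 1) - C ^ 2 * t ^ 2) * t ^ (2 * (p + 1)) ≤ imPart a t ^ 2 := by
    filter_upwards [hC, eventually_abs_le one_pos] with t hC ht
    have h1 := sin_half_sq_le t
    have h2 : t ^ 2 ≤ 1 := (sq_le_one_iff_abs_le_one t).mpr ht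
    have h3 := hlow _ (sq_nonneg (Real.sin (t / 2))) (by linarith)
    have h4 : κ * (t ^ 2 / 16) ^ (p + 1) ≤ κ * (Real.sin (t / 2) ^ 2) ^ (p + 1) := by
      have := le_sin_half_sq ht
      gcongr
    have h5 : amp a (t + Real.pi) ^ 2 ≤ C ^ 2 * (t ^ 2 * t ^ (2 * (p + 1))) := by
      refine (pow_le_pow_left₀ (amp_nonneg _ _) hC 2).trans (le_of_eq ?_)
      rw [mul_pow, ← pow_mul, mul_comm (p + 2) 2, pow_mul, sq_abs, pow_mul, ← pow_succ']
    rw [hS]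
    rw [div_pow, ← pow_mul] at h4
    have h6 : (κ / 16 ^ (p + 1) - C ^ 2 * t ^ 2) * t ^ (2 * (p + 1)) =
        κ * (t ^ (2 * (p + 1)) / 16 ^ (p + 1)) - C ^ 2 * (t ^ 2 * t ^ (2 * (p + 1))) := by ring
    rw [h6]
    linarith
  have hκ' : 0 < κ / 16 ^ (p + 1) := by positivity
  have hlim : Tendsto (fun t : ℝ => κ / 16 ^ (p + 1) - C ^ 2 * t ^ 2) (𝓝 0)
      (𝓝 (κ / 16 ^ (p + 1))) := by
    have : Continuous fun t : ℝ => κ / 16 ^ (p + 1) - C ^ 2 * t ^ 2 := by fun_prop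
    simpa using this.tendsto 0
  have han := analyticAt_imPart a 0
  have hfin : analyticOrderAt (imPart a) 0 ≠ ⊤ := by
    intro htop
    rw [analyticOrderAt_eq_top] at htop
    have hle : ∀ᶠ t in 𝓝[≠] (0 : ℝ), κ / 16 ^ (p + 1) - C ^ 2 * t ^ 2 ≤ 0 := by
      filter_upwards [nhdsWithin_le_nhds htop, nhdsWithin_le_nhds hdown,
        self_mem_nhdsWithin] with t h1 h2 h3
      have h3 : t ≠ 0 := h3
      have : 0 < t ^ (2 * (p + 1)) := by rw [pow_mul]; positivity
      rw [h1] at h2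
      by_contra hcon
      have := mul_pos (not_le.mp hcon) this
      linarith
    exact absurd (le_of_tendsto (hlim.mono_left nhdsWithin_le_nhds) hle) (not_le.mpr hκ')
  obtain ⟨q, hq⟩ := ENat.ne_top_iff_exists.mp hfin
  obtain ⟨g, hg, hg0, hSg⟩ := (han.analyticOrderAt_eq_natCast).mp hq.symm
  simp only [sub_zero, smul_eq_mul] at hSg
  have hqe := even_of_analytic_even (imPart_neg a) hg.continuousAt hg0 hSg
  have hgt : Tendsto g (𝓝 0) (𝓝 (g 0)) := hg.continuousAt
  have hg2 : Tendsto (fun t => g t ^ 2) (𝓝[≠] 0) (𝓝 (g 0 ^ 2)) :=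
    (hgt.pow 2).mono_left nhdsWithin_le_nhds
  have hne : q ≠ p + 1 := by
    rintro rfl
    exact (Nat.not_even_iff_odd.mpr hp.add_one) hqe
  have hpow0 : ∀ i : ℕ, Tendsto (fun t : ℝ => t ^ (2 * (i + 1))) (𝓝[≠] 0) (𝓝 0) := by
    intro i
    have : Continuous fun t : ℝ => t ^ (2 * (i + 1)) := by fun_prop
    simpa using (this.tendsto 0).mono_left nhdsWithin_le_nhds
  rcases lt_or_gt_of_ne hne with hlt | hgt'
  · -- a smaller order contradicts the upper bound
    obtain ⟨i, hi⟩ := Nat.exists_eq_add_of_lt hlt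
    have hle : ∀ᶠ t in 𝓝[≠] (0 : ℝ), g t ^ 2 ≤ (4 * p + 2) * t ^ (2 * (i + 1)) := by
      filter_upwards [nhdsWithin_le_nhds hSg, nhdsWithin_le_nhds hup,
        self_mem_nhdsWithin] with t h1 h2 h3
      have h3 : t ≠ 0 := h3
      have h4 : 0 < t ^ (2 * q) := by rw [pow_mul]; positivity
      rw [h1, hi, add_assoc, mul_add, pow_add, mul_pow, ← pow_mul, mul_comm q] at h2
      refine le_of_mul_le_mul_left ?_ h4
      linarith
    have := le_of_tendsto_of_tendsto hg2 ((hpow0 i).const_mul _) hle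
    rw [mul_zero] at this
    exact hg0 (pow_eq_zero_iff two_ne_zero |>.mp (le_antisymm this (sq_nonneg _)))
  · -- a larger order contradicts the lower bound
    obtain ⟨i, hi⟩ := Nat.exists_eq_add_of_lt hgt'
    have hle : ∀ᶠ t in 𝓝[≠] (0 : ℝ),
        κ / 16 ^ (p + 1) - C ^ 2 * t ^ 2 ≤ t ^ (2 * (i + 1)) * g t ^ 2 := by
      filter_upwards [nhdsWithin_le_nhds hSg, nhdsWithin_le_nhds hdown,
        self_mem_nhdsWithin] with t h1 h2 h3
      have h3 : t ≠ 0 := h3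
      have h4 : 0 < t ^ (2 * (p + 1)) := by rw [pow_mul]; positivity
      have e : t ^ (2 * q) = t ^ (2 * (p + 1)) * t ^ (2 * (i + 1)) := by
        rw [← pow_add]; congr 1; omega
      rw [h1, mul_pow, ← pow_mul, mul_comm q, e] at h2
      refine le_of_mul_le_mul_left ?_ h4
      linarith
    have := le_of_tendsto_of_tendsto (hlim.mono_left nhdsWithin_le_nhds) ((hpow0 i).mul hg2) hle
    rw [zero_mul] at this
    linarith

theorem IsHanFilter.sumRuleOrder_eq {p : ℕ} (hp : Even p) {a : Filt 1}
    (h : IsHanFilter (p + 1) a) : sumRuleOrder a dil2 = p + 1 :=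
  IsGreatest.csSup_eq ⟨h.hasSumRules, fun _ hk => h.le_of_hasSumRules hp hk⟩

/-! ### Smoothness of the filters with maximally flat real part -/

theorem one_sub_maxFlat_le_four {p : ℕ} {y : ℝ} (hy : 0 ≤ y) (hy1 : y ≤ 1) :
    1 - maxFlat p y ≤ (4 * p + 2) * (4 * y) ^ (p + 1) ∧
      (1 / 4 ≤ y → 1 - maxFlat p y ≤ (4 * p + 2) * (3 * y) ^ (p + 1)) := by
  have hp : (0 : ℝ) ≤ p := Nat.cast_nonneg p
  rcases le_total y (1 / 2) with h | h
  · have h1 := one_sub_maxFlat_le (p := p) hy h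
    have h2 : 0 ≤ y * (1 - y) := mul_nonneg hy (by linarith)
    constructor
    · refine h1.trans ?_
      gcongr
      nlinarith
    · intro hq
      refine h1.trans ?_
      have : 4 * (y * (1 - y)) ≤ 3 * y := by nlinarith
      gcongr
  · have h1 : 1 - maxFlat p y ≤ 1 := by linarith [maxFlat_nonneg (p := p) hy1]
    have key : ∀ x : ℝ, 1 ≤ x → 1 - maxFlat p y ≤ (4 * p + 2) * x ^ (p + 1) := fun x hx => by
      have := one_le_pow₀ hx (n := p + 1)
      nlinarith
    exact ⟨key _ (by linarith), fun _ => key _ (by linarith)⟩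

/-- Of two consecutive frequencies `t, 2t` at least one satisfies `cos² ≥ 1/4`, where the better
bound holds. -/
theorem IsHanFilter.amp_sq_mul_le {p : ℕ} {a : Filt 1} (h : IsHanFilter (p + 1) a) (t : ℝ) :
    amp a t ^ 2 * amp a (2 * t) ^ 2 ≤ (4 * p + 2) ^ 2 *
      (12 * (Real.cos (t / 2) ^ 2 * Real.cos t ^ 2)) ^ (p + 1) := by
  have h1 := h.amp_sq_le_cos t
  have h2 := h.amp_sq_le_cos (2 * t)
  have e : 2 * t / 2 = t := by ring
  rw [e] at h2
  have hc : Real.cos t = 2 * Real.cos (t / 2) ^ 2 - 1 := by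
    rw [← Real.cos_two_mul]; congr 1; ring
  set y := Real.cos (t / 2) ^ 2 with hy
  set y' := Real.cos t ^ 2 with hy'
  have y0 : 0 ≤ y := sq_nonneg _
  have y1 : y ≤ 1 := Real.cos_sq_le_one _
  have y0' : 0 ≤ y' := sq_nonneg _
  have y1' : y' ≤ 1 := Real.cos_sq_le_one _
  obtain ⟨b1, b2⟩ := one_sub_maxFlat_le_four (p := p) y0 y1
  obtain ⟨b3, b4⟩ := one_sub_maxFlat_le_four (p := p) y0' y1'
  have hp : (0 : ℝ) ≤ 4 * p + 2 := by positivity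
  have fin : ∀ u v : ℝ, 0 ≤ u → u * v = 12 * (y * y') →
      amp a t ^ 2 ≤ (4 * p + 2) * u ^ (p + 1) → amp a (2 * t) ^ 2 ≤ (4 * p + 2) * v ^ (p + 1) →
      amp a t ^ 2 * amp a (2 * t) ^ 2 ≤ (4 * p + 2) ^ 2 * (12 * (y * y')) ^ (p + 1) := by
    intro u v hu huv hu1 hv1
    calc _ ≤ ((4 * p + 2) * u ^ (p + 1)) * ((4 * p + 2) * v ^ (p + 1)) := by gcongr
      _ = _ := by rw [← huv, mul_pow u v]; ring
  rcases le_total (1 / 4) y with hq | hq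
  · exact fin (3 * y) (4 * y') (by linarith) (by ring) (h1.trans (b2 hq)) (h2.trans b3)
  · have hq' : 1 / 4 ≤ y' := by rw [hy', hc]; nlinarith
    exact fin (4 * y) (3 * y') (by linarith) (by ring) (h1.trans b1) (h2.trans (b4 hq'))

/-- The subdivision scheme after `j` steps, with a difference operator of order `p + 1`: each pair
of steps contributes the factor `16 = 2⁴` of the scheme, the constant of `amp_sq_mul_le` squared,
and the power of `3/4` left over when the sines and cosines telescope. -/
theorem IsHanFilter.sin_mul_cascadeAbs_le {p : ℕ} {a : Filt 1} (h : IsHanFilter (p + 1) a) (j : ℕ)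
    (t : ℝ) : (Real.sin (t / 2) ^ 2) ^ (p + 1) * cascadeAbs a dil2 j ![t] ^ 2 ≤
      4 * (16 * (4 * p + 2) ^ 2 * (3 / 4) ^ (p + 1)) ^ (j / 2) := by
  have hsin : ∀ t : ℝ, (Real.sin (t / 2) ^ 2) ^ (p + 1) ≤ 1 := fun t =>
    pow_le_one₀ (sq_nonneg _) (Real.sin_sq_le_one _)
  induction j using Nat.twoStepInduction generalizing t with
  | zero =>
    rw [cascadeAbs_zero, Nat.zero_div, pow_zero]
    linarith [hsin t]
  | one =>
    have h1 := cascadeAbs_dil2_le h.orthonormal 1 t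
    have h2 := pow_le_pow_left₀ (cascadeAbs_nonneg _ _ _ _) h1 2
    have h3 := mul_le_mul (hsin t) h2 (by positivity) zero_le_one
    norm_num at h3 ⊢
    exact h3
  | more j ih _ =>
    have e : (j + 2) / 2 = j / 2 + 1 := by omega
    have e4 : 2 * (2 * t) = 4 * t := by ring
    have e2 : 4 * t / 2 = 2 * t := by ring
    rw [cascadeAbs_dil2_succ, cascadeAbs_dil2_succ, e4, e, pow_succ _ (j / 2)]
    have hih := ih (4 * t)
    rw [e2] at hih
    set U := cascadeAbs a dil2 j ![4 * t]
    -- `sin (t/2) cos (t/2) cos t = sin (2t) / 4` telescopes the cosines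
    have hs : Real.sin (t / 2) ^ 2 * (12 * (Real.cos (t / 2) ^ 2 * Real.cos t ^ 2)) =
        3 / 4 * Real.sin (2 * t) ^ 2 := by
      have s1 : Real.sin t = 2 * Real.sin (t / 2) * Real.cos (t / 2) := by
        rw [← Real.sin_two_mul]; congr 1; ring
      rw [Real.sin_two_mul, s1]
      ring
    calc (Real.sin (t / 2) ^ 2) ^ (p + 1) * (2 * (2 * U * amp a (2 * t)) * amp a t) ^ 2
        = 16 * U ^ 2 * (Real.sin (t / 2) ^ 2) ^ (p + 1) *
            (amp a t ^ 2 * amp a (2 * t) ^ 2) := by ring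
      _ ≤ 16 * U ^ 2 * (Real.sin (t / 2) ^ 2) ^ (p + 1) * ((4 * p + 2) ^ 2 *
            (12 * (Real.cos (t / 2) ^ 2 * Real.cos t ^ 2)) ^ (p + 1)) :=
          mul_le_mul_of_nonneg_left (h.amp_sq_mul_le t) (by positivity)
      _ = 16 * (4 * p + 2) ^ 2 * U ^ 2 * (Real.sin (t / 2) ^ 2 *
            (12 * (Real.cos (t / 2) ^ 2 * Real.cos t ^ 2))) ^ (p + 1) := by
          rw [mul_pow (Real.sin (t / 2) ^ 2)]; ring
      _ = (Real.sin (2 * t) ^ 2) ^ (p + 1) * U ^ 2 *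
            (16 * (4 * p + 2) ^ 2 * (3 / 4) ^ (p + 1)) := by rw [hs, mul_pow]; ring
      _ ≤ 4 * (16 * (4 * p + 2) ^ 2 * (3 / 4) ^ (p + 1)) ^ (j / 2) *
            (16 * (4 * p + 2) ^ 2 * (3 / 4) ^ (p + 1)) := by gcongr
      _ = _ := by ring

/-- A bound for `ρ⁴`, which decays exponentially in the order of the filter. -/
def decayRate (p : ℕ) : ℝ := 16 * (4 * p + 2) ^ 2 * (3 / 4) ^ (p + 1)

theorem decayRate_pos (p : ℕ) : 0 < decayRate p := by unfold decayRate; positivity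

theorem IsHanFilter.rho_le {p : ℕ} {a : Filt 1} (h : IsHanFilter (p + 1) a) :
    rho (p + 1) a dil2 ≤ Real.sqrt (Real.sqrt (decayRate p)) := by
  set r := Real.sqrt (Real.sqrt (decayRate p)) with hr
  have hr0 : 0 < r := Real.sqrt_pos.mpr (Real.sqrt_pos.mpr (decayRate_pos p))
  have hr4 : r ^ 4 = decayRate p := by
    have h1 : r ^ 2 = Real.sqrt (decayRate p) := Real.sq_sqrt (Real.sqrt_nonneg _)
    have h2 : Real.sqrt (decayRate p) ^ 2 = decayRate p := Real.sq_sqrt (decayRate_pos p).le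
    rw [← h2, ← h1]; ring
  refine _root_.rho_le hr0.le fun μ hμ => ?_
  rw [fun_eq_const_of_sum_eq hμ]
  refine ⟨2 ^ (p + 1) * 2 * (1 + r⁻¹), Eventually.of_forall fun j => ?_⟩
  have hle : l2norm (nablaPow (fun _ => p + 1)
      ((subdivision a dil2)^[j] (Finsupp.single 0 1))) ≤
        2 ^ (p + 1) * 2 * r ^ (2 * (j / 2)) := by
    refine (sq_le_sq₀ (l2norm_nonneg _) (by positivity)).mp ?_
    refine l2norm_sq_le_of_symbol_le _ fun ω => ?_
    rw [eq_vec_one ω, norm_symbol_nablaPow_dil2]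
    have h1 := h.sin_mul_cascadeAbs_le j (ω 0)
    rw [← decayRate, ← hr4, ← pow_mul r] at h1
    calc ((2 * |Real.sin (ω 0 / 2)|) ^ (p + 1) * cascadeAbs a dil2 j ![ω 0]) ^ 2
        = (2 ^ (p + 1)) ^ 2 * ((Real.sin (ω 0 / 2) ^ 2) ^ (p + 1) *
            cascadeAbs a dil2 j ![ω 0] ^ 2) := by
          rw [← sq_abs (Real.sin (ω 0 / 2))]; ring
      _ ≤ (2 ^ (p + 1)) ^ 2 * (4 * r ^ (4 * (j / 2))) :=
          mul_le_mul_of_nonneg_left h1 (by positivity)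
      _ = (2 ^ (p + 1) * 2 * r ^ (2 * (j / 2))) ^ 2 := by
          have : r ^ (4 * (j / 2)) = (r ^ (2 * (j / 2))) ^ 2 := by rw [← pow_mul]; congr 1; ring
          rw [this]; ring
  calc _ ≤ _ := hle
    _ ≤ 2 ^ (p + 1) * 2 * ((1 + r⁻¹) * r ^ j) := by
        gcongr
        exact pow_two_mul_half_le hr0 j
    _ = _ := by ring

theorem tendsto_decayRate : Tendsto decayRate atTop (𝓝 0) := by
  have h := fun i => tendsto_pow_const_mul_const_pow_of_abs_lt_one i
    (by norm_num [abs_lt] : |(3 / 4 : ℝ)| < 1)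
  have h2 := (((h 2).const_mul 192).add ((h 1).const_mul 192)).add ((h 0).const_mul 48)
  simp only [mul_zero, add_zero] at h2
  refine h2.congr fun p => ?_
  rw [decayRate, pow_succ]
  ring

theorem tendsto_smoothness {a : ℕ → Filt 1}
    (h : ∀ n : ℕ, 1 ≤ n → IsHanFilter (2 * n - 1) (a n)) :
    Tendsto (fun n => 2 * smoothness (a n) dil2) atTop atTop := by
  have hp : Tendsto (fun n : ℕ => 2 * n - 2) atTop atTop :=
    tendsto_atTop_mono (fun n => by omega) (tendsto_sub_atTop_nat 2)
  have hlim : Tendsto (fun n : ℕ => Real.sqrt (Real.sqrt (decayRate (2 * n - 2)))) atTop (𝓝 0) := by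
    have := (Real.continuous_sqrt.comp Real.continuous_sqrt).tendsto 0
    simp only [Function.comp_apply, Real.sqrt_zero] at this
    exact (this.comp tendsto_decayRate).comp hp
  have hfac : ∀ n : ℕ, 1 ≤ n → IsHanFilter (2 * n - 2 + 1) (a n) := fun n hn => by
    have : 2 * n - 2 + 1 = 2 * n - 1 := by omega
    rw [this]; exact h n hn
  have hsm : ∀ n : ℕ, 1 ≤ n → smoothness (a n) dil2 =
      1 / 2 - Real.logb 2 (rho (2 * n - 2 + 1) (a n) dil2) := fun n hn => by
    rw [smoothness_dil2, (hfac n hn).sumRuleOrder_eq ⟨n - 1, by omega⟩]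
  have hpos : ∀ n : ℕ, 1 ≤ n → 0 < rho (2 * n - 2 + 1) (a n) dil2 := fun n hn =>
    rho_dil2_pos (hfac n hn).orthonormal (hfac n hn).symbol_zero _
  have hrho : Tendsto (fun n : ℕ => rho (2 * n - 2 + 1) (a n) dil2) atTop (𝓝[>] 0) := by
    refine tendsto_nhdsWithin_iff.mpr ⟨?_, ?_⟩
    · refine tendsto_of_tendsto_of_tendsto_of_le_of_le' tendsto_const_nhds hlim ?_ ?_
      · filter_upwards [eventually_ge_atTop 1] with n hn using (hpos n hn).le
      · filter_upwards [eventually_ge_atTop 1] with n hn using (hfac n hn).rho_le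
    · filter_upwards [eventually_ge_atTop 1] with n hn using hpos n hn
  have hlog : Tendsto (fun n : ℕ => Real.logb 2 (rho (2 * n - 2 + 1) (a n) dil2)) atTop atBot := by
    have := (Real.tendsto_log_nhdsGT_zero.comp hrho).atBot_div_const
      (Real.log_pos (by norm_num : (1 : ℝ) < 2))
    exact this
  have hfinal := (tendsto_atTop_add_const_left _ (1 / 2)
    (tendsto_neg_atBot_atTop.comp hlog)).const_mul_atTop (by norm_num : (0 : ℝ) < 2)
  refine hfinal.congr' ?_
  filter_upwards [eventually_ge_atTop 1] with n hn
  rw [hsm n hn, Function.comp_apply, sub_eq_add_neg]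

/-! ### Spectral factorization with real coefficients -/

open Polynomial in
theorem nonneg_of_mul_nonneg_on {g h : ℝ[X]} (hg : g ≠ 0)
    (hg0 : ∀ t ∈ Set.Icc (-1 : ℝ) 1, 0 ≤ g.eval t)
    (hgh : ∀ t ∈ Set.Icc (-1 : ℝ) 1, 0 ≤ (g * h).eval t) :
    ∀ t ∈ Set.Icc (-1 : ℝ) 1, 0 ≤ h.eval t := by
  intro t ht
  by_contra hneg
  rw [not_le] at hneg
  have hU : IsOpen {x : ℝ | h.eval x < 0} := isOpen_lt h.continuous continuous_const
  have hcl : t ∈ closure (Set.Ioo (-1 : ℝ) 1) := by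
    rwa [closure_Ioo (by norm_num)]
  obtain ⟨x, hx1, hx2⟩ := mem_closure_iff.mp hcl _ hU hneg
  have hinf : {y : ℝ | h.eval y < 0 ∧ y ∈ Set.Ioo (-1 : ℝ) 1}.Infinite :=
    infinite_of_mem_nhds x (Filter.inter_mem (hU.mem_nhds hx1) (isOpen_Ioo.mem_nhds hx2))
  refine hg (Polynomial.eq_zero_of_infinite_isRoot g (hinf.mono ?_))
  rintro y ⟨hy1, hy2⟩
  have hy := Set.Ioo_subset_Icc_self hy2
  have h1 := hgh y hy
  rw [Polynomial.eval_mul] at h1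
  have h2 := hg0 y hy
  by_contra hne
  have h3 : 0 < g.eval y := lt_of_le_of_ne h2 (Ne.symm hne)
  linarith [mul_neg_of_pos_of_neg h3 hy1]

open Polynomial in
/-- The factor `|cos θ - w|²`. With `z = e^{iθ}` and `r + 1/r = 2 w` one has
`(z - r)(z̄ - r) = -2 r (cos θ - w)`; as `|z̄ - r| = |z - r̄|`, the real polynomial
`(z - r)(z - r̄)` has the required absolute value up to the constant `2 |r|`. -/
theorem exists_factor_quadratic (w : ℂ) : ∃ f : ℝ[X], f.natDegree ≤ 2 ∧ ∀ θ : ℝ,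
    ‖aeval (Complex.exp (θ * Complex.I)) f‖ ^ 2 = (Real.cos θ - w.re) ^ 2 + w.im ^ 2 := by
  obtain ⟨r, hr⟩ : ∃ r : ℂ, 1 * (r * r) + (-2 * w) * r + 1 = 0 := by
    obtain ⟨s, hs⟩ := IsAlgClosed.exists_eq_mul_self (discrim (1 : ℂ) (-2 * w) 1)
    exact exists_quadratic_eq_zero one_ne_zero ⟨s, hs⟩
  have hr0 : r ≠ 0 := by rintro rfl; simp at hr
  have hrn : 0 < ‖r‖ := norm_pos_iff.mpr hr0
  refine ⟨C (2 * ‖r‖)⁻¹ * (X ^ 2 - C (2 * r.re) * X + C (‖r‖ ^ 2)), by compute_degree, fun θ => ?_⟩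
  set z := Complex.exp (θ * Complex.I) with hz
  have hzz : z * (starRingEnd ℂ) z = 1 := by
    rw [Complex.mul_conj, Complex.normSq_eq_norm_sq, hz, Complex.norm_exp_ofReal_mul_I]; simp
  have hzc : z + (starRingEnd ℂ) z = ((2 * Real.cos θ : ℝ) : ℂ) := by
    rw [Complex.add_conj, hz, Complex.exp_ofReal_mul_I_re]
  have hfac : aeval z (X ^ 2 - C (2 * r.re) * X + C (‖r‖ ^ 2) : ℝ[X]) =
      (z - r) * (z - (starRingEnd ℂ) r) := by
    simp only [map_add, map_sub, map_mul, map_pow, aeval_X, aeval_C, Complex.coe_algebraMap]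
    have h1 : r * (starRingEnd ℂ) r = (‖r‖ : ℂ) ^ 2 := Complex.mul_conj' r
    have h2 : r + (starRingEnd ℂ) r = ((2 * r.re : ℝ) : ℂ) := Complex.add_conj r
    push_cast at h2 ⊢
    linear_combination z * h2 - h1
  have hnorm : ‖(z - r) * (z - (starRingEnd ℂ) r)‖ = 2 * ‖r‖ * ‖(Real.cos θ : ℂ) - w‖ := by
    have h1 : ‖z - (starRingEnd ℂ) r‖ = ‖(starRingEnd ℂ) z - r‖ := by
      rw [← RCLike.norm_conj, map_sub, Complex.conj_conj]
    rw [norm_mul, h1, ← norm_mul]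
    have h2 : (z - r) * ((starRingEnd ℂ) z - r) = -(2 * r * ((Real.cos θ : ℂ) - w)) := by
      rw [Complex.ofReal_mul, Complex.ofReal_ofNat] at hzc
      linear_combination hzz - r * hzc + hr
    rw [h2, norm_neg, norm_mul, norm_mul]
    norm_num
  rw [map_mul, hfac, norm_mul, hnorm, aeval_C]
  have h3 : ‖(algebraMap ℝ ℂ) (2 * ‖r‖)⁻¹‖ = (2 * ‖r‖)⁻¹ := by
    rw [norm_algebraMap', Real.norm_of_nonneg (by positivity)]
  rw [h3, ← mul_assoc, inv_mul_cancel₀ (by positivity), one_mul, ← Complex.normSq_eq_norm_sq,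
    Complex.normSq_apply, Complex.sub_re, Complex.sub_im, Complex.ofReal_re, Complex.ofReal_im]
  ring

open Polynomial in
/-- The factor `|cos θ - c|` for a real number `c` outside the open interval `(-1, 1)`. -/
theorem exists_factor_linear {c : ℝ} (hc : 1 ≤ |c|) : ∃ f : ℝ[X], f.natDegree ≤ 1 ∧ ∀ θ : ℝ,
    ‖aeval (Complex.exp (θ * Complex.I)) f‖ ^ 2 = |Real.cos θ - c| := by
  obtain ⟨r, hr⟩ : ∃ r : ℝ, 1 * (r * r) + (-2 * c) * r + 1 = 0 := by
    refine exists_quadratic_eq_zero one_ne_zero ⟨Real.sqrt (discrim (1 : ℝ) (-2 * c) 1), ?_⟩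
    rw [Real.mul_self_sqrt]
    have : 1 ≤ c ^ 2 := (one_le_sq_iff_one_le_abs c).mpr hc
    rw [discrim]
    linarith
  have hr0 : r ≠ 0 := by rintro rfl; simp at hr
  have hrn : 0 < 2 * |r| := by positivity
  refine ⟨C (Real.sqrt (2 * |r|))⁻¹ * (X - C r), by compute_degree, fun θ => ?_⟩
  have h1 : aeval (Complex.exp (θ * Complex.I)) (C (Real.sqrt (2 * |r|))⁻¹ * (X - C r) : ℝ[X]) =
      ((Real.sqrt (2 * |r|))⁻¹ : ℝ) *
        (((Real.cos θ - r : ℝ) : ℂ) + (Real.sin θ : ℝ) * Complex.I) := by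
    simp only [map_mul, map_sub, aeval_X, aeval_C, Complex.coe_algebraMap]
    rw [Complex.exp_mul_I, ← Complex.ofReal_cos, ← Complex.ofReal_sin]
    push_cast
    ring
  rw [h1, norm_mul, mul_pow, ← Complex.normSq_eq_norm_sq (((_ : ℝ) : ℂ) + _),
    Complex.normSq_add_mul_I, Complex.norm_real, Real.norm_of_nonneg (by positivity), inv_pow,
    Real.sq_sqrt hrn.le]
  have h2 : (Real.cos θ - r) ^ 2 + Real.sin θ ^ 2 = 2 * |r| * |Real.cos θ - c| := by
    have h3 : (Real.cos θ - r) ^ 2 + Real.sin θ ^ 2 = -(2 * r * (Real.cos θ - c)) := by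
      linear_combination hr + Real.cos_sq_add_sin_sq θ
    have h4 : 0 ≤ (Real.cos θ - r) ^ 2 + Real.sin θ ^ 2 := by positivity
    rw [← abs_of_nonneg h4, h3, abs_neg, abs_mul, abs_mul, abs_of_pos (two_pos : (0 : ℝ) < 2)]
  rw [h2, ← mul_assoc, inv_mul_cancel₀ hrn.ne', one_mul]

open Polynomial in
/-- The Fejér–Riesz theorem with real coefficients: a polynomial in `cos θ` that is nonnegative on
`[-1, 1]` is the square of the absolute value of a real polynomial in `e^{iθ}`. -/
theorem exists_fejerRiesz (q : ℝ[X]) (hq : ∀ t ∈ Set.Icc (-1 : ℝ) 1, 0 ≤ q.eval t) :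
    ∃ s : ℝ[X], s.natDegree ≤ q.natDegree ∧ ∀ θ : ℝ,
      ‖aeval (Complex.exp (θ * Complex.I)) s‖ ^ 2 = q.eval (Real.cos θ) := by
  induction hn : q.natDegree using Nat.strong_induction_on generalizing q with
  | _ n ih =>
  subst hn
  by_cases h0 : q.natDegree = 0
  · obtain ⟨c, rfl⟩ := natDegree_eq_zero.mp h0
    have hc : 0 ≤ c := by simpa using hq 0 (by simp)
    refine ⟨C (Real.sqrt c), by simp, fun θ => ?_⟩
    rw [aeval_C, norm_algebraMap', Real.norm_of_nonneg (Real.sqrt_nonneg c), Real.sq_sqrt hc,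
      eval_C]
  have hq0 : q ≠ 0 := by rintro rfl; simp at h0
  -- splitting off a factor `g` with a known spectral factor `f`
  have split : ∀ g h : ℝ[X], q = g * h → g.natDegree ≠ 0 →
      (∀ t ∈ Set.Icc (-1 : ℝ) 1, 0 ≤ g.eval t) →
      (∃ f : ℝ[X], f.natDegree ≤ g.natDegree ∧ ∀ θ : ℝ,
        ‖aeval (Complex.exp (θ * Complex.I)) f‖ ^ 2 = g.eval (Real.cos θ)) →
      ∃ s : ℝ[X], s.natDegree ≤ q.natDegree ∧ ∀ θ : ℝ,
        ‖aeval (Complex.exp (θ * Complex.I)) s‖ ^ 2 = q.eval (Real.cos θ) := by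
    rintro g h hgh hdeg hg ⟨f, hf1, hf2⟩
    have hg0 : g ≠ 0 := by rintro rfl; simp at hdeg
    have hh0 : h ≠ 0 := by rintro rfl; exact hq0 (by rw [hgh, mul_zero])
    have hdq : q.natDegree = g.natDegree + h.natDegree := by rw [hgh, natDegree_mul hg0 hh0]
    obtain ⟨s, hs1, hs2⟩ := ih h.natDegree (by omega) h
      (nonneg_of_mul_nonneg_on hg0 hg (by rwa [← hgh])) rfl
    refine ⟨f * s, natDegree_mul_le.trans (by omega), fun θ => ?_⟩
    rw [map_mul, norm_mul, mul_pow, hf2, hs2, hgh, eval_mul]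
  obtain ⟨w, hw⟩ := IsAlgClosed.exists_aeval_eq_zero ℂ q (by
    intro hd
    exact h0 (natDegree_eq_of_degree_eq_some hd))
  have hquad : ∀ w : ℂ, ∀ h : ℝ[X],
      q = (X ^ 2 - C (2 * w.re) * X + C (‖w‖ ^ 2)) * h → _ := fun w h hgh => by
    have heval : ∀ t : ℝ, (X ^ 2 - C (2 * w.re) * X + C (‖w‖ ^ 2) : ℝ[X]).eval t =
        (t - w.re) ^ 2 + w.im ^ 2 := fun t => by
      simp only [eval_add, eval_sub, eval_mul, eval_pow, eval_X, eval_C]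
      rw [← Complex.normSq_eq_norm_sq, Complex.normSq_apply]
      ring
    have hdeg : (X ^ 2 - C (2 * w.re) * X + C (‖w‖ ^ 2) : ℝ[X]).natDegree = 2 := by
      compute_degree!
    refine split _ h hgh (by omega) (fun t _ => by rw [heval]; positivity) ?_
    obtain ⟨f, hf1, hf2⟩ := exists_factor_quadratic w
    exact ⟨f, by omega, fun θ => by rw [hf2, heval]⟩
  by_cases him : w.im = 0
  · obtain ⟨c, rfl⟩ : ∃ c : ℝ, w = c := ⟨w.re, by apply Complex.ext <;> simp [him]⟩
    have hroot : q.IsRoot c := by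
      have h1 : aeval ((algebraMap ℝ ℂ) c) q = 0 := hw
      rw [aeval_algebraMap_apply, map_eq_zero] at h1
      rwa [coe_aeval_eq_eval] at h1
    obtain ⟨h, hh⟩ := dvd_iff_isRoot.mpr hroot
    have hone : (X - C c).natDegree = 1 := natDegree_X_sub_C c
    rcases lt_or_ge |c| 1 with hc | hc
    · -- an interior zero is a minimum, hence a double zero
      obtain ⟨hc1, hc2⟩ := abs_lt.mp hc
      have hmin : IsLocalMin (fun t => q.eval t) c := by
        filter_upwards [Icc_mem_nhds hc1 hc2] with t ht
        rw [show q.eval c = 0 from hroot]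
        exact hq t ht
      have hder := hmin.hasDerivAt_eq_zero (q.hasDerivAt c)
      have hroot2 : h.IsRoot c := by
        rw [hh, derivative_mul] at hder
        simpa using hder
      obtain ⟨h', hh'⟩ := dvd_iff_isRoot.mpr hroot2
      refine hquad c h' ?_
      rw [hh, hh', ← mul_assoc]
      congr 1
      simp only [Complex.ofReal_re, Complex.norm_real, Real.norm_eq_abs, sq_abs, map_mul, map_pow,
        map_ofNat]
      ring
    · obtain ⟨f, hf1, hf2⟩ := exists_factor_linear hc
      rcases le_abs.mp hc with hc' | hc'
      · refine split (-(X - C c)) (-h) (by rw [hh]; ring) (by rw [natDegree_neg, hone]; simp)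
          (fun t ht => by simp; linarith [ht.2]) ⟨f, by rwa [natDegree_neg, hone], fun θ => ?_⟩
        rw [hf2, abs_of_nonpos (by linarith [Real.cos_le_one θ])]
        simp
      · refine split (X - C c) h hh (by rw [hone]; simp)
          (fun t ht => by simp; linarith [ht.1]) ⟨f, by rwa [hone], fun θ => ?_⟩
        rw [hf2, abs_of_nonneg (by linarith [Real.neg_one_le_cos θ])]
        simp
  · obtain ⟨h, hh⟩ := quadratic_dvd_of_aeval_eq_zero_im_ne_zero q hw him
    exact hquad w h hh

/-! ### Filters symmetric about `1/2` -/

/-- The filter symmetric about `1/2` with `a(k + 1) = a(-k) = c(k)` for `0 ≤ k < N`. -/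
def symFilt (N : ℕ) (c : ℕ → ℂ) : Filt 1 :=
  ∑ k ∈ Finset.range N,
    (Finsupp.single ![(k : ℤ) + 1] (c k) + Finsupp.single ![-(k : ℤ)] (c k))

theorem symFilt_apply (N : ℕ) (c : ℕ → ℂ) (n : ℤ) :
    symFilt N c ![n] = ∑ k ∈ Finset.range N,
      ((if (k : ℤ) + 1 = n then c k else 0) + if -(k : ℤ) = n then c k else 0) := by
  have h : ∀ (l : ℤ) (x : ℂ), (Finsupp.single ![l] x : Filt 1) ![n] = if l = n then x else 0 := by
    intro l x
    rw [Finsupp.single_apply]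
    have : (![l] : Fin 1 → ℤ) = ![n] ↔ l = n :=
      ⟨fun h => congrFun h 0, fun h => by rw [h]⟩
    simp only [this]
  simp only [symFilt, Finsupp.finsetSum_apply, Finsupp.add_apply, h]

theorem isSymmetricHalf_symFilt (N : ℕ) (c : ℕ → ℂ) : IsSymmetricHalf (symFilt N c) := by
  intro n
  rw [symFilt_apply, symFilt_apply]
  refine Finset.sum_congr rfl fun k _ => ?_
  rw [add_comm]
  have h1 : (-(k : ℤ) = 1 - n) ↔ (k : ℤ) + 1 = n := by omega
  have h2 : ((k : ℤ) + 1 = 1 - n) ↔ -(k : ℤ) = n := by omega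
  simp only [h1, h2]

theorem symFilt_support {N : ℕ} {c : ℕ → ℂ} {n : ℤ} (h : symFilt N c ![n] ≠ 0) :
    1 - (N : ℤ) ≤ n ∧ n ≤ N := by
  rw [symFilt_apply] at h
  obtain ⟨k, hk, hne⟩ := Finset.exists_ne_zero_of_sum_ne_zero h
  rw [Finset.mem_range] at hk
  by_contra hcon
  refine hne ?_
  rw [if_neg (by omega), if_neg (by omega), add_zero]

theorem reFilt_symFilt (N : ℕ) (c : ℕ → ℂ) :
    reFilt (symFilt N c) = symFilt N fun k => ((c k).re : ℂ) := by
  ext n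
  rw [eq_vec_one n, reFilt, Finsupp.mapRange_apply, symFilt_apply, symFilt_apply, Complex.re_sum,
    Complex.ofReal_sum]
  refine Finset.sum_congr rfl fun k _ => ?_
  rw [Complex.add_re]
  split_ifs <;> simp

theorem symbol_symFilt (N : ℕ) (c : ℕ → ℂ) (t : ℝ) :
    symbol (symFilt N c) ![t] = Complex.exp (-Complex.I * (t / 2 : ℝ)) *
      ∑ k ∈ Finset.range N, 2 * c k * (Real.cos ((k + 1 / 2) * t) : ℝ) := by
  rw [symFilt, symbol_finsetSum, Finset.mul_sum]
  refine Finset.sum_congr rfl fun k _ => ?_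
  rw [symbol_add, symbol_single, symbol_single, Complex.ofReal_cos, Complex.cos]
  have e1 : Complex.exp (-Complex.I * ((∑ i, (((![(k : ℤ) + 1] : Fin 1 → ℤ) i : ℤ) : ℝ) *
      (![t] : Fin 1 → ℝ) i : ℝ) : ℂ)) = Complex.exp (-Complex.I * (t / 2 : ℝ)) *
        Complex.exp (-(((k + 1 / 2) * t : ℝ) : ℂ) * Complex.I) := by
    rw [← Complex.exp_add]
    congr 1
    simp
    ring
  have e2 : Complex.exp (-Complex.I * ((∑ i, (((![-(k : ℤ)] : Fin 1 → ℤ) i : ℤ) : ℝ) *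
      (![t] : Fin 1 → ℝ) i : ℝ) : ℂ)) = Complex.exp (-Complex.I * (t / 2 : ℝ)) *
        Complex.exp ((((k + 1 / 2) * t : ℝ) : ℂ) * Complex.I) := by
    rw [← Complex.exp_add]
    congr 1
    simp
    ring
  rw [e1, e2]
  ring

/-! ### Cosine polynomials of half-integer frequencies -/

/-- The span of the functions `cos ((k + 1/2) t)` with `k < N`. -/
def halfCos (N : ℕ) : Submodule ℝ (ℝ → ℝ) :=
  Submodule.span ℝ ((fun (k : ℕ) (t : ℝ) => Real.cos ((k + 1 / 2) * t)) '' Set.Iio N)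

theorem cos_mem_halfCos {k N : ℕ} (h : k < N) :
    (fun t : ℝ => Real.cos ((k + 1 / 2) * t)) ∈ halfCos N :=
  Submodule.subset_span ⟨k, h, rfl⟩

theorem halfCos_mono {N N' : ℕ} (h : N ≤ N') : halfCos N ≤ halfCos N' :=
  Submodule.span_mono (Set.image_mono (Set.Iio_subset_Iio h))

theorem exists_coeff_of_mem_halfCos {N : ℕ} {f : ℝ → ℝ} (h : f ∈ halfCos N) :
    ∃ r : ℕ → ℝ, ∀ t, f t = ∑ k ∈ Finset.range N, r k * Real.cos ((k + 1 / 2) * t) := by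
  rw [halfCos, ← Finset.coe_range, Submodule.mem_span_image_finset_iff_exists_fun] at h
  obtain ⟨r, rfl⟩ := h
  refine ⟨fun k => if h : k ∈ Finset.range N then r ⟨k, h⟩ else 0, fun t => ?_⟩
  rw [Finset.sum_apply, ← Finset.sum_attach (Finset.range N)]
  refine Finset.sum_congr rfl fun k _ => ?_
  beta_reduce
  rw [dif_pos k.2]
  rfl

theorem cos_mul_mem_halfCos {N : ℕ} {f : ℝ → ℝ} (h : f ∈ halfCos N) :
    (fun t => Real.cos t * f t) ∈ halfCos (N + 1) := by
  induction h using Submodule.span_induction with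
  | mem f hf =>
    obtain ⟨k, hk, rfl⟩ := hf
    have hk : k < N := hk
    have h1 : (fun t : ℝ => Real.cos ((k - 1 + 1 / 2) * t)) ∈ halfCos (N + 1) := by
      rcases k with _ | k
      · have : (fun t : ℝ => Real.cos ((((0 : ℕ) : ℝ) - 1 + 1 / 2) * t)) =
            fun t : ℝ => Real.cos ((((0 : ℕ) : ℝ) + 1 / 2) * t) := by
          funext t
          rw [← Real.cos_neg]
          congr 1
          push_cast
          ring
        rw [this]
        exact cos_mem_halfCos (by omega)
      · have : (fun t : ℝ => Real.cos ((((k + 1 : ℕ) : ℝ) - 1 + 1 / 2) * t)) =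
            fun t : ℝ => Real.cos ((k + 1 / 2) * t) := by
          funext t
          congr 1
          push_cast
          ring
        rw [this]
        exact cos_mem_halfCos (by omega)
    have h2 : (fun t : ℝ => Real.cos ((((k + 1 : ℕ) : ℝ) + 1 / 2) * t)) ∈ halfCos (N + 1) :=
      cos_mem_halfCos (by omega)
    convert (halfCos (N + 1)).smul_mem (1 / 2) ((halfCos (N + 1)).add_mem h1 h2) using 1
    funext t
    have e1 : ((k : ℝ) - 1 + 1 / 2) * t = (k + 1 / 2) * t - t := by ring
    have e2 : (((k + 1 : ℕ) : ℝ) + 1 / 2) * t = (k + 1 / 2) * t + t := by push_cast; ring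
    simp only [Pi.smul_apply, Pi.add_apply, smul_eq_mul]
    rw [e1, e2, Real.cos_sub, Real.cos_add]
    ring
  | zero => simp only [Pi.zero_apply, mul_zero]; exact (halfCos (N + 1)).zero_mem
  | add f g _ _ hf hg =>
    simp only [Pi.add_apply, mul_add]
    exact (halfCos (N + 1)).add_mem hf hg
  | smul c f _ hf =>
    simp only [Pi.smul_apply, smul_eq_mul, mul_left_comm _ c]
    exact (halfCos (N + 1)).smul_mem c hf

open Polynomial in
theorem cos_half_mul_eval_mem_halfCos (T : ℝ[X]) {N : ℕ} (h : T.natDegree < N) :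
    (fun t => Real.cos (t / 2) * T.eval (Real.cos t)) ∈ halfCos N := by
  have hmon : ∀ k : ℕ, (fun t => Real.cos t ^ k * Real.cos (t / 2)) ∈ halfCos (k + 1) := by
    intro k
    induction k with
    | zero =>
      convert cos_mem_halfCos (k := 0) (N := 0 + 1) (by omega) using 1
      funext t
      rw [pow_zero, one_mul]
      congr 1
      push_cast
      ring
    | succ k ih =>
      convert cos_mul_mem_halfCos ih using 1
      funext t
      ring
  have : (fun t => Real.cos (t / 2) * T.eval (Real.cos t)) =
      ∑ k ∈ Finset.range N, T.coeff k • fun t => Real.cos t ^ k * Real.cos (t / 2) := by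
    funext t
    rw [eval_eq_sum_range' h, Finset.mul_sum, Finset.sum_apply]
    refine Finset.sum_congr rfl fun k _ => ?_
    simp only [Pi.smul_apply, smul_eq_mul]
    ring
  rw [this]
  refine (halfCos N).sum_mem fun k hk => (halfCos N).smul_mem _ (halfCos_mono ?_ (hmon k))
  exact Finset.mem_range.mp hk

/-! ### Existence of the filters -/

open Polynomial in
/-- The polynomial whose values are `binSum`. -/
def binPoly (α : ℝ) (m : ℕ) : ℝ[X] := ∑ j ∈ Finset.range m, C (binCoeff α j) * X ^ j

open Polynomial in
theorem eval_binPoly (α : ℝ) (m : ℕ) (x : ℝ) : (binPoly α m).eval x = binSum α m x := by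
  simp [binPoly, binSum, eval_finsetSum]

open Polynomial in
theorem natDegree_binPoly_le (α : ℝ) (p : ℕ) : (binPoly α (p + 1)).natDegree ≤ p := by
  refine natDegree_sum_le_of_forall_le _ _ fun j hj => (natDegree_C_mul_X_pow_le _ _).trans ?_
  exact Nat.lt_succ_iff.mp (Finset.mem_range.mp hj)

open Polynomial in
/-- An even polynomial in `t` is a polynomial in `t²`. -/
theorem exists_even_part (F : ℝ[X]) (hF : ∀ t : ℝ, F.eval (-t) = F.eval t) {N : ℕ}
    (hN : F.natDegree ≤ 2 * N + 1) :
    ∃ G : ℝ[X], G.natDegree ≤ N ∧ ∀ t : ℝ, F.eval t = G.eval (t ^ 2) := by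
  refine ⟨∑ j ∈ Finset.range (N + 1), C (F.coeff (2 * j)) * X ^ j, ?_, fun t => ?_⟩
  · refine natDegree_sum_le_of_forall_le _ _ fun j hj => (natDegree_C_mul_X_pow_le _ _).trans ?_
    exact Nat.lt_succ_iff.mp (Finset.mem_range.mp hj)
  have hpair : ∀ (g : ℕ → ℝ) (n : ℕ), ∑ k ∈ Finset.range (2 * n), g k =
      ∑ j ∈ Finset.range n, (g (2 * j) + g (2 * j + 1)) := by
    intro g n
    induction n with
    | zero => simp
    | succ n ih =>
      rw [mul_add, mul_one, Finset.sum_range_succ, Finset.sum_range_succ, ih,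
        Finset.sum_range_succ, add_assoc]
  have hev : ∀ x : ℝ, F.eval x = ∑ j ∈ Finset.range (N + 1),
      (F.coeff (2 * j) * x ^ (2 * j) + F.coeff (2 * j + 1) * x ^ (2 * j + 1)) := by
    intro x
    rw [eval_eq_sum_range' (by omega : F.natDegree < 2 * (N + 1)), hpair]
  have hsum : F.eval t + F.eval (-t) =
      2 * ∑ j ∈ Finset.range (N + 1), F.coeff (2 * j) * t ^ (2 * j) := by
    rw [hev, hev, ← Finset.sum_add_distrib, Finset.mul_sum]
    refine Finset.sum_congr rfl fun j _ => ?_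
    rw [(even_two_mul j).neg_pow, (odd_two_mul_add_one j).neg_pow]
    ring
  rw [hF] at hsum
  simp only [eval_finsetSum, eval_mul, eval_C, eval_pow, eval_X, ← pow_mul]
  linarith

open Polynomial in
/-- The polynomial whose values are `maxFlat p x`. -/
def maxFlatPoly (p : ℕ) : ℝ[X] := (1 - X) ^ (2 * p + 1) * binPoly (p + 1 / 2) (p + 1) ^ 2

open Polynomial in
theorem eval_maxFlatPoly (p : ℕ) (x : ℝ) : (maxFlatPoly p).eval x = maxFlat p x := by
  simp [maxFlatPoly, maxFlat, eval_binPoly]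

open Polynomial in
theorem natDegree_maxFlatPoly_le (p : ℕ) : (maxFlatPoly p).natDegree ≤ 4 * p + 1 := by
  have h1 : (1 - X : ℝ[X]).natDegree ≤ 1 := by compute_degree
  have h2 := natDegree_binPoly_le (p + 1 / 2) p
  have h3 : ((1 - X : ℝ[X]) ^ (2 * p + 1)).natDegree ≤ (2 * p + 1) * 1 :=
    natDegree_pow_le_of_le _ h1
  have h4 : (binPoly ((p : ℝ) + 1 / 2) (p + 1) ^ 2).natDegree ≤ 2 * p :=
    natDegree_pow_le_of_le _ h2
  exact (natDegree_mul_le_of_le h3 h4).trans (by omega)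

open Polynomial in
/-- The deficit `1 - B(x) - B(1 - x)` at `x = sin² (t/2)` is invariant under `t ↦ t + π`, and so a
polynomial in `cos (2t)`; being nonnegative it has a spectral factor. -/
theorem exists_deficit_factor (p : ℕ) : ∃ s : ℝ[X], s.natDegree ≤ 2 * p ∧ ∀ t : ℝ,
    4 * ‖aeval (Complex.exp ((2 * t : ℝ) * Complex.I)) s‖ ^ 2 =
      1 - maxFlat p (Real.sin (t / 2) ^ 2) - maxFlat p (Real.cos (t / 2) ^ 2) := by
  set F : ℝ[X] := 1 - (maxFlatPoly p).comp (C (1 / 2) * (1 - X)) -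
    (maxFlatPoly p).comp (C (1 / 2) * (1 + X)) with hF
  have hFe : ∀ u : ℝ, F.eval u = 1 - maxFlat p (1 / 2 * (1 - u)) - maxFlat p (1 / 2 * (1 + u)) := by
    intro u
    simp [hF, eval_maxFlatPoly]
  have hFd : F.natDegree ≤ 2 * (2 * p) + 1 := by
    have h1 : (C (1 / 2) * (1 - X) : ℝ[X]).natDegree ≤ 1 := by compute_degree
    have h2 : (C (1 / 2) * (1 + X) : ℝ[X]).natDegree ≤ 1 := by compute_degree
    have key : ∀ L : ℝ[X], L.natDegree ≤ 1 →
        ((maxFlatPoly p).comp L).natDegree ≤ 2 * (2 * p) + 1 := by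
      intro L hL
      refine natDegree_comp_le.trans ((Nat.mul_le_mul (natDegree_maxFlatPoly_le p) hL).trans ?_)
      omega
    exact (natDegree_sub_le_of_le (natDegree_sub_le_of_le (m := 0) (by simp) (key _ h1))
      (key _ h2)).trans (by simp)
  obtain ⟨G, hGd, hG⟩ := exists_even_part F (fun u => by
    rw [hFe, hFe, sub_neg_eq_add, ← sub_eq_add_neg]; ring) hFd
  have hq : ∀ u ∈ Set.Icc (-1 : ℝ) 1,
      0 ≤ (C (1 / 4) * G.comp (C (1 / 2) * (1 + X)) : ℝ[X]).eval u := by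
    rintro u ⟨hu1, hu2⟩
    have h1 : 0 ≤ 1 / 2 * (1 + u) := by linarith
    have h2 : (C (1 / 4) * G.comp (C (1 / 2) * (1 + X)) : ℝ[X]).eval u =
        1 / 4 * F.eval (Real.sqrt (1 / 2 * (1 + u))) := by
      rw [hG, Real.sq_sqrt h1]; simp
    have h3 : Real.sqrt (1 / 2 * (1 + u)) ≤ 1 := Real.sqrt_le_one.mpr (by linarith)
    have h4 := Real.sqrt_nonneg (1 / 2 * (1 + u))
    rw [h2, hFe]
    set v := Real.sqrt (1 / 2 * (1 + u))
    have h5 := maxFlat_add_flip_le (p := p) (x := 1 / 2 * (1 - v)) (by linarith) (by linarith)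
    have h6 : 1 - 1 / 2 * (1 - v) = 1 / 2 * (1 + v) := by ring
    rw [h6] at h5
    linarith
  obtain ⟨s, hs1, hs2⟩ := exists_fejerRiesz _ hq
  refine ⟨s, hs1.trans ?_, fun t => ?_⟩
  · refine (natDegree_C_mul_le _ _).trans (natDegree_comp_le.trans ?_)
    have h2 : (C (1 / 2) * (1 + X) : ℝ[X]).natDegree ≤ 1 := by compute_degree
    exact (Nat.mul_le_mul hGd h2).trans (by omega)
  · have e1 : Real.sin (t / 2) ^ 2 = 1 / 2 * (1 - Real.cos t) := by
      have := Real.cos_sq (t / 2)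
      have e : 2 * (t / 2) = t := by ring
      rw [e] at this
      rw [Real.sin_sq, this]; ring
    have e2 : Real.cos (t / 2) ^ 2 = 1 / 2 * (1 + Real.cos t) := by
      have := Real.cos_sq (t / 2)
      have e : 2 * (t / 2) = t := by ring
      rw [e] at this
      rw [this]; ring
    have e3 : (1 / 2 * (1 + Real.cos (2 * t))) = Real.cos t ^ 2 := by rw [Real.cos_sq]; ring
    rw [hs2, e1, e2, ← hFe, hG]
    simp only [eval_mul, eval_C, eval_comp, eval_add, eval_one, eval_X]
    rw [e3]
    ring

open Polynomial in
/-- The imaginary part of the filter: the real part of `2 e^{-i(2p+1/2)t} s(e^{2it})` for a spectral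
factor `s` of the deficit. The shift by `π` turns its cosines into sines, so that the two squares
add up to `4 |s|²`. -/
theorem exists_imaginary_part (p : ℕ) : ∃ S ∈ halfCos (2 * p + 1), ∀ t : ℝ,
    S t ^ 2 + S (t + Real.pi) ^ 2 =
      1 - maxFlat p (Real.sin (t / 2) ^ 2) - maxFlat p (Real.cos (t / 2) ^ 2) := by
  obtain ⟨s, hs, hs2⟩ := exists_deficit_factor p
  have hmem : ∀ i < 2 * p + 1,
      (fun t : ℝ => Real.cos ((2 * i - 2 * p - 1 / 2) * t)) ∈ halfCos (2 * p + 1) := by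
    intro i hi
    rcases le_or_gt i p with h | h
    · obtain ⟨k, rfl⟩ := Nat.exists_eq_add_of_le h
      convert cos_mem_halfCos (k := 2 * k) (N := 2 * (i + k) + 1) (by omega) using 1
      funext t
      rw [← Real.cos_neg]
      congr 1
      push_cast
      ring
    · obtain ⟨k, rfl⟩ := Nat.exists_eq_add_of_lt h
      convert cos_mem_halfCos (k := 2 * k + 1) (N := 2 * p + 1) (by omega) using 1
      funext t
      congr 1
      push_cast
      ring
  refine ⟨∑ i ∈ Finset.range (2 * p + 1),
      (2 * s.coeff i) • fun t : ℝ => Real.cos ((2 * i - 2 * p - 1 / 2) * t),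
    (halfCos _).sum_mem fun i hi => (halfCos _).smul_mem _ (hmem i (Finset.mem_range.mp hi)),
    fun t => ?_⟩
  simp only [Finset.sum_apply, Pi.smul_apply, smul_eq_mul]
  have hshift : ∀ i : ℕ, Real.cos ((2 * i - 2 * p - 1 / 2) * (t + Real.pi)) =
      Real.sin ((2 * i - 2 * p - 1 / 2) * t) := by
    intro i
    have e : (2 * i - 2 * p - 1 / 2) * (t + Real.pi) =
        (2 * i - 2 * p - 1 / 2) * t - Real.pi / 2 + ((i : ℤ) - (p : ℤ) : ℤ) * (2 * Real.pi) := by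
      push_cast; ring
    rw [e, Real.cos_add_int_mul_two_pi, Real.cos_sub_pi_div_two]
  simp only [hshift]
  rw [← hs2 t]
  set A := ∑ i ∈ Finset.range (2 * p + 1),
    s.coeff i * Real.cos ((2 * i - 2 * p - 1 / 2) * t) with hA
  set B := ∑ i ∈ Finset.range (2 * p + 1),
    s.coeff i * Real.sin ((2 * i - 2 * p - 1 / 2) * t) with hB
  have h1 : Complex.exp (((-(2 * p + 1 / 2) * t : ℝ) : ℂ) * Complex.I) *
      aeval (Complex.exp ((2 * t : ℝ) * Complex.I)) s = (A : ℂ) + (B : ℂ) * Complex.I := by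
    rw [aeval_eq_sum_range' (by omega : s.natDegree < 2 * p + 1), hA, hB, Finset.mul_sum]
    push_cast
    rw [Finset.sum_mul, ← Finset.sum_add_distrib]
    refine Finset.sum_congr rfl fun i _ => ?_
    have e : -(2 * (p : ℂ) + 1 / 2) * t * Complex.I + i * (2 * t * Complex.I) =
        (2 * i - 2 * p - 1 / 2) * t * Complex.I := by ring
    rw [Complex.real_smul, mul_left_comm, ← Complex.exp_nat_mul, ← Complex.exp_add, e,
      Complex.exp_mul_I]
    ring
  have h2 : ‖aeval (Complex.exp ((2 * t : ℝ) * Complex.I)) s‖ ^ 2 = A ^ 2 + B ^ 2 := by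
    rw [← Complex.normSq_add_mul_I, ← h1, Complex.normSq_eq_norm_sq, norm_mul,
      Complex.norm_exp_ofReal_mul_I, one_mul]
  rw [h2]
  simp only [mul_assoc, ← Finset.mul_sum]
  ring

open Polynomial in
theorem maxFlat_root_mem_halfCos (p : ℕ) :
    (fun t : ℝ => Real.cos (t / 2) ^ (2 * p + 1) *
      binSum (p + 1 / 2) (p + 1) (Real.sin (t / 2) ^ 2)) ∈ halfCos (2 * p + 1) := by
  have hd : ((C (1 / 2) * (1 + X)) ^ p *
      (binPoly (p + 1 / 2) (p + 1)).comp (C (1 / 2) * (1 - X)) : ℝ[X]).natDegree ≤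
        p * 1 + p * 1 := by
    have h1 : (C (1 / 2) * (1 - X) : ℝ[X]).natDegree ≤ 1 := by compute_degree
    have h2 : (C (1 / 2) * (1 + X) : ℝ[X]).natDegree ≤ 1 := by compute_degree
    exact natDegree_mul_le_of_le (natDegree_pow_le_of_le _ h2)
      (natDegree_comp_le.trans (Nat.mul_le_mul (natDegree_binPoly_le _ p) h1))
  convert cos_half_mul_eval_mem_halfCos _ (lt_of_le_of_lt hd (by omega : _ < 2 * p + 1)) using 1
  funext t
  have e : 2 * (t / 2) = t := by ring
  have e2 : Real.cos (t / 2) ^ 2 = 1 / 2 * (1 + Real.cos t) := by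
    rw [Real.cos_sq, e]; ring
  have e1 : Real.sin (t / 2) ^ 2 = 1 / 2 * (1 - Real.cos t) := by
    rw [Real.sin_sq, e2]; ring
  simp only [eval_mul, eval_pow, eval_C, eval_comp, eval_add, eval_sub, eval_one, eval_X,
    eval_binPoly]
  rw [← e1, ← e2]
  ring

theorem exists_isHanFilter (p : ℕ) : ∃ a : Filt 1, IsHanFilter (p + 1) a := by
  obtain ⟨r, hr⟩ := exists_coeff_of_mem_halfCos (maxFlat_root_mem_halfCos p)
  obtain ⟨S, hS, hS2⟩ := exists_imaginary_part p
  obtain ⟨s, hs⟩ := exists_coeff_of_mem_halfCos hS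
  have hsym : ∀ t : ℝ, symbol (symFilt (2 * p + 1) fun k => ((r k / 2 : ℝ) : ℂ) +
      ((s k / 2 : ℝ) : ℂ) * Complex.I) ![t] = Complex.exp (-Complex.I * (t / 2 : ℝ)) *
        (((Real.cos (t / 2) ^ (2 * p + 1) *
          binSum (p + 1 / 2) (p + 1) (Real.sin (t / 2) ^ 2) : ℝ) : ℂ) + (S t : ℂ) * Complex.I) := by
    intro t
    rw [symbol_symFilt, hs, hr t, Complex.ofReal_sum, Complex.ofReal_sum, Finset.sum_mul,
      ← Finset.sum_add_distrib]
    congr 1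
    refine Finset.sum_congr rfl fun k _ => ?_
    push_cast
    ring
  refine ⟨symFilt (2 * p + 1) fun k => ((r k / 2 : ℝ) : ℂ) + ((s k / 2 : ℝ) : ℂ) * Complex.I,
    fun k hk => ?_, isSymmetricHalf_symFilt _ _, ?_, fun t => ?_⟩
  · have := symFilt_support hk
    push_cast at *
    omega
  · have hamp : ∀ t : ℝ, amp (symFilt (2 * p + 1) fun k => ((r k / 2 : ℝ) : ℂ) +
        ((s k / 2 : ℝ) : ℂ) * Complex.I) t ^ 2 =
        maxFlat p (Real.sin (t / 2) ^ 2) + S t ^ 2 := by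
      intro t
      have e : -Complex.I * ((t / 2 : ℝ) : ℂ) = ((-(t / 2) : ℝ) : ℂ) * Complex.I := by
        push_cast; ring
      rw [amp, hsym, norm_mul, e, Complex.norm_exp_ofReal_mul_I, one_mul,
        ← Complex.normSq_eq_norm_sq, Complex.normSq_add_mul_I, maxFlat, ← Real.cos_sq']
      ring
    rw [isOrthonormalFilter_dil2_iff]
    intro t
    have e : Real.sin ((t + Real.pi) / 2) ^ 2 = Real.cos (t / 2) ^ 2 := by
      rw [add_div, Real.sin_add_pi_div_two]
    rw [hamp, hamp, e]
    linarith [hS2 t]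
  · refine (congrArg (fun b => symbol b ![t]) (reFilt_symFilt _ _)).trans ?_
    have e : 2 * (p + 1) - 1 = 2 * p + 1 := by omega
    have hα : ((p + 1 : ℕ) : ℝ) - 1 / 2 = p + 1 / 2 := by push_cast; ring
    have hb : ∑ j ∈ Finset.range (p + 1), (∏ i ∈ Finset.range j, ((p : ℝ) + 1 / 2 + i) / (i + 1)) *
        Real.sin (t / 2) ^ (2 * j) = binSum (p + 1 / 2) (p + 1) (Real.sin (t / 2) ^ 2) := by
      simp only [binSum, binCoeff, ← pow_mul]
    rw [symbol_symFilt, e, hα, hb, hr t, Complex.ofReal_sum]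
    congr 1
    refine Finset.sum_congr rfl fun k _ => ?_
    have hre : (((r k / 2 : ℝ) : ℂ) + ((s k / 2 : ℝ) : ℂ) * Complex.I).re = r k / 2 := by simp
    rw [hre]
    push_cast
    ring

end

theorem mainTheorem4 :
    -- the one-dimensional filters `aₙ` exist and have exactly `2n-1` sum rules
    (∀ n : ℕ, 1 ≤ n → ∃ a : Filt 1, IsHanFilter (2 * n - 1) a) ∧
    (∀ n : ℕ, 1 ≤ n → ∀ a : Filt 1, IsHanFilter (2 * n - 1) a →
      sumRuleOrder a dil2 = 2 * n - 1) ∧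
    -- the quincunx filter bank built from a symmetric orthonormal filter with `2n-1` sum rules
    (∀ n : ℕ, 1 ≤ n → ∀ a : Filt 1, IsSymmetricHalf a → IsOrthonormalFilter a dil2 →
      sumRuleOrder a dil2 = 2 * n - 1 →
      IsDoubleCanonical (lowpass2D a) (highpass1 a) (highpass2 a) (highpass3 a) ∧
      IsSymmetricAbout groupD4 ![1 / 2, 1 / 2] (fun _ => 1) (lowpass2D a) ∧
      2 * n ≤ sumRuleOrder (lowpass2D a) quincunxM ∧
      smoothness (lowpass2D a) quincunxM = smoothness (lowpass2D a) quincunxN ∧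
      2 * smoothness a dil2 ≤ smoothness (lowpass2D a) quincunxM ∧
      IsSymmetricAbout groupD4 ![1 / 2, -1 / 2]
        (fun E => E 0 0 * E 1 1 + E 0 1 * E 1 0) (highpass1 a) ∧
      IsSymmetricAbout groupD4plus ![1 / 2, 1 / 2] (fun E => E 1 1) (highpass2 a) ∧
      IsSymmetricAbout groupD4plus ![1 / 2, -1 / 2] (fun E => E 0 0) (highpass3 a) ∧
      HasVanishingMoments (highpass1 a) n ∧
      HasVanishingMoments (highpass2 a) n ∧
      HasVanishingMoments (highpass3 a) n) ∧
    -- the smoothness exponents of the filters `aₙ` tend to infinity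
    (∀ a : ℕ → Filt 1, (∀ n : ℕ, 1 ≤ n → IsHanFilter (2 * n - 1) (a n)) →
      Tendsto (fun n => 2 * smoothness (a n) dil2) atTop atTop) := by
  refine ⟨fun n hn => ?_, fun n hn a ha => ?_,
    fun n hn a hs ho hsr => quincunx_filterBank hn hs ho hsr, fun a ha => tendsto_smoothness ha⟩
  · have e : 2 * n - 1 = 2 * n - 2 + 1 := by omega
    rw [e]
    exact exists_isHanFilter _
  · have e : 2 * n - 1 = 2 * n - 2 + 1 := by omega
    rw [e] at ha ⊢
    exact ha.sumRuleOrder_eq ⟨n - 1, by omega⟩
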